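/- By a curve over a finite field $k$ we mean a smooth, projective, geometrically irreducible curve over $k$. For a prime power $q$ let $N_q(4)$ denote the maximal number of $\mathbf{F}_q$-rational points on a curve of genus $4$ over $\mathbf{F}_q$. For each row $(q, N, e_1, e_2)$ of the table below, the two equations $e_1, e_2$ (with integer coefficients read in $\mathbf{F}_q$) generate a prime ideal of $\mathbf{F}_q[x,y,z]$, and the smooth projective curve over $\mathbf{F}_q$ whose function field is the fraction field of the quotient ring is a geometrically irreducible curve of genus $4$ with exactly $N$ rational points. Consequently $N_q(4)\ge N$ for each row. \[ \begin{array}{|r|r|ll|} \hline q & N & e_1 & e_2 \\ \hline 13 & 38 & y^2 = x^3 + 4 & z^2 = x^3 + x^2 - 4 x - 3 \\ 17 & 46 & y^2 = x^3 + x + 8 & z^2 = x^3 - 5 x^2 - 2 x - 8 \\ 19 & 48 & y^2 = x^3 + 8 & z^2 = x^3 - 9 x^2 - 5 \\ 23 & 57 & y^2 = x^3 - 6 x^2 - 3 x - 7 & z^2 = x y + 2 x^3 - 11 x^2 + 7 x + 1 \\ 29 & 67 & y^2 = x^3 - 3 x + 18 & z^2 = y + 7 x^3 + 6 x^2 + 2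 x - 10 \\ 31 & 72 & y^2 = x^3 + x + 10 & z^2 = x^3 + 7 x^2 - 13 x - 13 \\ 37 & 82 & y^2 = x^3 + 2 x & z^2 = x^3 + x^2 - 10 x - 13 \\ 41 & 88 & y^2 = x^3 + 6 x + 5 & z^2 = 3 x^3 - 17 x^2 - 11 x \\ 43 & 92 & y^2 = x^3 + 2 x + 1 & z^2 = x^3 - 6 x^2 + 11 x \\ 47 & 98 & y^2 = x^5 - 6 x^3 + 8 x^2 - 5 x + 12 & z^2 = y + 6 x^3 + 6 x^2 - x - 3 \\ 49 & 102 & y^2 = x^3 + x & z^2 = x^3 + x^2 + x + 4 \\ 53 & 108 & y^2 = x^3 + 4 x + 10 & z^2 = x^3 + 12 x^2 + 17 x + 9 \\ 59 & 116 & y^2 = x^3 + 2 x + 22 & z^2 = 2 x^3 + x^2 - x + 9 \\ 61 & 118 & y^2 = x^3 + 4 & z^2 = x^3 + 23 x^2 + 25 x + 36 \\ 67 & 129 & y^2 = x^3 + 25 & z^2 = x y - 8 x^3 - 27 x + 4 \\ 71 & 134 & y^2 = x^3 + x + 9 & z^2 = x^3 + 9 x^2 + 24 x - 9 \\ 73 &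 138 & y^2 = x^3 + 3 x + 11 & z^2 = x^3 + 34 x^2 + 18 x + 40 \\ 79 & 148 & y^2 = x^3 + x + 6 & z^3 = y + 33 x + 2 \\ 83 & 152 & y^2 = x^3 + 2 x + 19 & z^2 = x^3 + 38 x^2 - 6 x + 39 \\ 89 & 160 & y^2 = x^3 + 3 x & z^2 = x^3 + 13 x^2 - 22 x + 28 \\ 97 & 174 & y^2 = x^3 + 5 x + 26 & z^3 = y + 37 x + 16 \\ \hline \end{array} \] (For $q=79$ and $q=97$ the exponent on $z$ is $3$, not $2$.) -/

import Mathlib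

/-!
Curves over a finite field `k` are handled through their function fields: a smooth projective
geometrically irreducible curve over `k` is the same thing as a finitely generated extension `F/k`
of transcendence degree one in which `k` is algebraically closed.  The closed points of the curve
are the places of `F/k`, and the local ring at a closed point is the valuation ring of the place.
-/

namespace GenusFour

universe u v

/-- `F` is the function field of a (smooth, projective, geometrically irreducible) curve over the
finite field `k`. -/
structure IsCurveFunctionField (k : Type u) (F : Type v) [Field k] [Field F] [Algebra k F] :
    Prop where
  fg : (⊤ : IntermediateField k F).FG
  trdeg_eq_one : Algebra.trdeg k F = 1
  constants : ∀ a : F, IsAlgebraic k a → a ∈ Set.range (algebraMap k F)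

/-- A place of `F/k`: a valuation ring of `F` that contains `k` and is not all of `F`.
The places are the closed points of the curve with function field `F`, and `P.ring` is the local
ring at the point `P`. -/
structure Place (k : Type u) (F : Type v) [Field k] [Field F] [Algebra k F] where
  ring : ValuationSubring F
  algebraMap_mem : ∀ c : k, algebraMap k F c ∈ ring
  ne_top : ring ≠ ⊤

section

variable (k : Type u) (F : Type v) [Field k] [Field F] [Algebra k F]

instance Place.algebra {k : Type u} {F : Type v} [Field k] [Field F] [Algebra k F]
    (P : Place k F) : Algebra k P.ring :=
  ((algebraMap k F).codRestrict P.ring P.algebraMap_mem).toAlgebra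

instance Place.isScalarTower {k : Type u} {F : Type v} [Field k] [Field F] [Algebra k F]
    (P : Place k F) : IsScalarTower k P.ring F :=
  IsScalarTower.of_algebraMap_eq fun _ => rfl

/-- A rational point is a place of degree one: its residue field is `k`. -/
def RationalPoint : Type v :=
  {P : Place k F // Function.Surjective (algebraMap k (IsLocalRing.ResidueField P.ring))}

/-- The space `H⁰(Ω¹)` of regular differentials: those `ω ∈ Ω[F⁄k]` that at every closed point `P`
are of the form `∑ aᵢ d bᵢ` with `aᵢ`, `bᵢ` in the local ring at `P`. -/
noncomputable def regularDifferentials : Submodule k (Ω[F⁄k]) :=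
  ⨅ P : Place k F, (Submodule.span P.ring
    (Set.range fun b : P.ring => KaehlerDifferential.D k F (b : F))).restrictScalars k

/-- The genus of the curve with function field `F`. -/
noncomputable def genus : ℕ :=
  Module.finrank k (regularDifferentials k F)

end

/-- `N_q(g)`: the maximal number of rational points on a curve of genus `g` over a field with `q`
elements, as a supremum in `ℕ∞`. -/
noncomputable def maxPoints (q g : ℕ) : ℕ∞ :=
  sSup {n : ℕ∞ | ∃ (k F : Type) (_ : Field k) (_ : Field F) (_ : Algebra k F),
    Nat.card k = q ∧ IsCurveFunctionField k F ∧ genus k F = g ∧ n = ENat.card (RationalPoint k F)}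

/-- The coordinates `x`, `y`, `z` of affine three-space. -/
noncomputable def x : MvPolynomial (Fin 3) ℤ := MvPolynomial.X 0
noncomputable def y : MvPolynomial (Fin 3) ℤ := MvPolynomial.X 1
noncomputable def z : MvPolynomial (Fin 3) ℤ := MvPolynomial.X 2

/-- A row of the table: `q`, `N`, and two polynomials (left side minus right side of the two
equations), whose coefficients are to be read in a field with `q` elements. -/
structure Row where
  q : ℕ
  N : ℕ
  e₁ : MvPolynomial (Fin 3) ℤ
  e₂ : MvPolynomial (Fin 3) ℤ

/-- The ideal of `k[x, y, z]` generated by the two equations. -/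
noncomputable def Row.ideal (r : Row) (k : Type u) [Field k] : Ideal (MvPolynomial (Fin 3) k) :=
  Ideal.span {MvPolynomial.map (Int.castRingHom k) r.e₁, MvPolynomial.map (Int.castRingHom k) r.e₂}

/-- The coordinate ring of the affine scheme cut out by the two equations. -/
abbrev Row.CoordRing (r : Row) (k : Type u) [Field k] : Type u :=
  MvPolynomial (Fin 3) k ⧸ r.ideal k

noncomputable def table : List Row :=
  [
    ⟨13, 38, y ^ 2 - (x ^ 3 + 4), z ^ 2 - (x ^ 3 + x ^ 2 - 4 * x - 3)⟩,
    ⟨17, 46, y ^ 2 - (x ^ 3 + x + 8), z ^ 2 - (x ^ 3 - 5 * x ^ 2 - 2 * x - 8)⟩,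
    ⟨19, 48, y ^ 2 - (x ^ 3 + 8), z ^ 2 - (x ^ 3 - 9 * x ^ 2 - 5)⟩,
    ⟨23, 57, y ^ 2 - (x ^ 3 - 6 * x ^ 2 - 3 * x - 7), z ^ 2 - (x * y + 2 * x ^ 3 - 11 * x ^ 2 + 7 * x + 1)⟩,
    ⟨29, 67, y ^ 2 - (x ^ 3 - 3 * x + 18), z ^ 2 - (y + 7 * x ^ 3 + 6 * x ^ 2 + 2 * x - 10)⟩,
    ⟨31, 72, y ^ 2 - (x ^ 3 + x + 10), z ^ 2 - (x ^ 3 + 7 * x ^ 2 - 13 * x - 13)⟩,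
    ⟨37, 82, y ^ 2 - (x ^ 3 + 2 * x), z ^ 2 - (x ^ 3 + x ^ 2 - 10 * x - 13)⟩,
    ⟨41, 88, y ^ 2 - (x ^ 3 + 6 * x + 5), z ^ 2 - (3 * x ^ 3 - 17 * x ^ 2 - 11 * x)⟩,
    ⟨43, 92, y ^ 2 - (x ^ 3 + 2 * x + 1), z ^ 2 - (x ^ 3 - 6 * x ^ 2 + 11 * x)⟩,
    ⟨47, 98, y ^ 2 - (x ^ 5 - 6 * x ^ 3 + 8 * x ^ 2 - 5 * x + 12), z ^ 2 - (y + 6 * x ^ 3 + 6 * x ^ 2 - x - 3)⟩,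
    ⟨49, 102, y ^ 2 - (x ^ 3 + x), z ^ 2 - (x ^ 3 + x ^ 2 + x + 4)⟩,
    ⟨53, 108, y ^ 2 - (x ^ 3 + 4 * x + 10), z ^ 2 - (x ^ 3 + 12 * x ^ 2 + 17 * x + 9)⟩,
    ⟨59, 116, y ^ 2 - (x ^ 3 + 2 * x + 22), z ^ 2 - (2 * x ^ 3 + x ^ 2 - x + 9)⟩,
    ⟨61, 118, y ^ 2 - (x ^ 3 + 4), z ^ 2 - (x ^ 3 + 23 * x ^ 2 + 25 * x + 36)⟩,
    ⟨67, 129, y ^ 2 - (x ^ 3 + 25), z ^ 2 - (x * y - 8 * x ^ 3 - 27 * x + 4)⟩,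
    ⟨71, 134, y ^ 2 - (x ^ 3 + x + 9), z ^ 2 - (x ^ 3 + 9 * x ^ 2 + 24 * x - 9)⟩,
    ⟨73, 138, y ^ 2 - (x ^ 3 + 3 * x + 11), z ^ 2 - (x ^ 3 + 34 * x ^ 2 + 18 * x + 40)⟩,
    ⟨79, 148, y ^ 2 - (x ^ 3 + x + 6), z ^ 3 - (y + 33 * x + 2)⟩,
    ⟨83, 152, y ^ 2 - (x ^ 3 + 2 * x + 19), z ^ 2 - (x ^ 3 + 38 * x ^ 2 - 6 * x + 39)⟩,
    ⟨89, 160, y ^ 2 - (x ^ 3 + 3 * x), z ^ 2 - (x ^ 3 + 13 * x ^ 2 - 22 * x + 28)⟩,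
    ⟨97, 174, y ^ 2 - (x ^ 3 + 5 * x + 26), z ^ 3 - (y + 37 * x + 16)⟩
  ]

end GenusFour

/-! Every row is a cyclic cover of degree `m + 1` (two or three) of a curve `y² = f(x)` of genus one
or two, given by `z ^ (m + 1) = h` with `h = p(x) + l(x) y`. All claims about it reduce to
polynomial identities and a point count over the finite field, which are decided by computation.

The bridge from places to explicit rings is a local fact. If `A` is a finitely generated domain over
a perfect field and `Ω[A⁄k]` is generated by one element, then the localizations of `A` at primes
are valuation rings (`valuationRing_localization`). Hence `A` is integrally closed, a place
containing `A` is a localization of `A`, and the generator of `Ω[A⁄k]` decides which differentials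
are regular at that place (`Place.span_eq`). Two kinds of charts are used: the affine curve, where
Bézout identities show that `dx / (y zᵐ)` is a generator, and a chart around infinity generated by
`1/x`, `τ = x ^ g / y` and a rescaling `w` of `z`, where `dτ` is a generator.

Primality: the monomials `yⁱ zʲ` with `i ≤ 1`, `j ≤ m` span the coordinate ring over `k[x]`, and
they are independent in a field obtained by adjoining `y` and then `z`. Such a field exists because
`f` has odd degree and because `h` is not an `(m + 1)`-th power: a root would be a polynomial in
`x`, `y`, which is excluded by its value at one rational point (`exists_isTower`).

Genus: comparing `dx / (y zᵐ)` with `dτ` shows that it has order `N` at infinity, where `N + 2 = 2 g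
+ (i + 2 j) m`. So the regular differentials are `c dx / (y zᵐ)` with `c` regular on the affine
curve and of pole order at most `N` at infinity. The action `z ↦ ζ z` splits `c` into its components
along the powers of `z`, and parity of orders bounds the degrees of the coefficients. The bases
found are `1, x, y, z` for double covers of elliptic curves and `1, x, z, z²` for cubic covers. In
the row `q = 47` the base has genus two and the affine model has a conjugate pair of double points
over the zeros of a quadratic `u`. There `c / z` must also be regular, and the basis is `u, (p mod
u) + y, z, x z`.

Points: rational places correspond bijectively to the rational solutions of the two affine equations
together with the solutions of `s ^ (m + 1) = c₀` at infinity, where `c₀` is the value of `w ^ (m +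
1)` there (`IsTower.card_rationalPoint`). A rational place exists, so `k` is algebraically closed in
the function field. -/

namespace GenusFour

open KaehlerDifferential IsLocalRing

/-! ### Rings whose differentials are generated by one element. -/

section Local

variable {k : Type*} [Field k]

/-- If the differentials of a local ring with formally smooth residue field are generated by one
element, then so is its maximal ideal. -/
theorem maximalIdeal_isPrincipal_of_kaehler {R : Type*} [CommRing R] [IsLocalRing R]
    [IsNoetherianRing R] [Algebra k R] [Algebra.FormallySmooth k (ResidueField R)]
    {ω : Ω[R⁄k]} (hω : Submodule.span R {ω} = ⊤) : (maximalIdeal R).IsPrincipal := by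
  have hker : RingHom.ker (algebraMap R (ResidueField R)) = maximalIdeal R :=
    IsLocalRing.ker_residue
  have hsurj : Function.Surjective (algebraMap R (ResidueField R)) :=
    IsLocalRing.residue_surjective
  obtain ⟨g, hg⟩ : ∃ g, (IsScalarTower.toAlgHom k R (ResidueField R)).kerSquareLift.comp g =
      AlgHom.id k (ResidueField R) := by
    have hs : Function.Surjective
        (IsScalarTower.toAlgHom k R (ResidueField R)).kerSquareLift := by
      intro c
      obtain ⟨r, rfl⟩ := hsurj c
      exact ⟨Ideal.Quotient.mk _ r, rfl⟩
    refine ⟨Algebra.FormallySmooth.liftOfSurjective (AlgHom.id k _) _ hs ?_,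
      Algebra.FormallySmooth.comp_liftOfSurjective _ _ _ _⟩
    refine ⟨2, ?_⟩
    have := AlgHom.ker_kerSquareLift (IsScalarTower.toAlgHom k R (ResidueField R))
    exact (congrArg (· ^ 2) this).trans (Ideal.cotangentIdeal_square _)
  -- A section of `R/m² → R/m` amounts to a left inverse `l` of the map from `m/m²` to the
  -- differentials tensored with the residue field. So every class in `m/m²` is a multiple of `l (1
  -- ⊗ ω)`, and Nakayama's lemma lifts this to `m`.
  obtain ⟨l, hl⟩ := (retractionKerCotangentToTensorEquivSection (R := k) hsurj).symm ⟨g, hg⟩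
  obtain ⟨⟨t, ht⟩, htl⟩ := Ideal.toCotangent_surjective _ (l (1 ⊗ₜ ω))
  have hle : maximalIdeal R ≤ Ideal.span {t} ⊔ maximalIdeal R • maximalIdeal R := by
    intro r hr
    have hr' : r ∈ RingHom.ker (algebraMap R (ResidueField R)) := hker ▸ hr
    obtain ⟨a, ha⟩ : ∃ a : R, a • ω = D k R r := by
      rw [← Submodule.mem_span_singleton, hω]; trivial
    have h1 : Ideal.toCotangent _ ⟨r, hr'⟩ = a • Ideal.toCotangent _ ⟨t, ht⟩ := by
      rw [htl, ← map_smul, TensorProduct.smul_tmul', TensorProduct.smul_tmul, ha]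
      exact (LinearMap.congr_fun hl (Ideal.toCotangent _ ⟨r, hr'⟩)).symm
    rw [← map_smul, Ideal.toCotangent_eq] at h1
    have h2 : r = a * t + (r - a * t) := by ring
    rw [h2]
    refine Submodule.add_mem_sup (Ideal.mul_mem_left _ _ (Ideal.mem_span_singleton_self t)) ?_
    rw [smul_eq_mul, ← pow_two, ← hker]
    exact h1
  have hle' := Submodule.le_of_le_smul_of_le_jacobson_bot
    (IsNoetherian.noetherian (maximalIdeal R)) (IsLocalRing.maximalIdeal_le_jacobson _) hle
  refine ⟨t, le_antisymm hle' ?_⟩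
  rw [Submodule.span_singleton_le_iff_mem]
  exact hker ▸ ht

theorem span_image_localization_eq_top {A B : Type*} [CommRing A] [CommRing B] [Algebra k A]
    [Algebra k B] [Algebra A B] [IsScalarTower k A B] (S : Submonoid A) [IsLocalization S B]
    {ω : Ω[A⁄k]} (hω : Submodule.span A {ω} = ⊤) :
    Submodule.span B {KaehlerDifferential.map k k A B ω} = ⊤ := by
  have := span_eq_top_of_isLocalizedModule B S (KaehlerDifferential.map k k A B) (v := {ω}) hω
  simpa using this

variable [PerfectField k] {A : Type*} [CommRing A] [IsDomain A] [Algebra k A]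
  [Algebra.FiniteType k A]

/-- The residue field is essentially of finite type over a perfect field, hence formally smooth. So
the maximal ideal is principal, and a noetherian local domain with principal maximal ideal is a
valuation ring. -/
theorem valuationRing_localization {ω : Ω[A⁄k]} (hω : Submodule.span A {ω} = ⊤)
    (p : Ideal A) [p.IsPrime] : ValuationRing (Localization.AtPrime p) := by
  have : IsNoetherianRing A := Algebra.FiniteType.isNoetherianRing k A
  have : IsNoetherianRing (Localization.AtPrime p) :=
    IsLocalization.isNoetherianRing p.primeCompl _ inferInstance
  have : Algebra.EssFiniteType A (Localization.AtPrime p) :=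
    Algebra.EssFiniteType.of_isLocalization _ p.primeCompl
  have : Algebra.EssFiniteType k (Localization.AtPrime p) := Algebra.EssFiniteType.comp k A _
  have : Algebra.EssFiniteType k (ResidueField (Localization.AtPrime p)) :=
    Algebra.EssFiniteType.comp k (Localization.AtPrime p) _
  have := maximalIdeal_isPrincipal_of_kaehler
    (span_image_localization_eq_top (B := Localization.AtPrime p) p.primeCompl hω)
  exact ((tfae_of_isNoetherianRing_of_isLocalRing_of_isDomain
    (R := Localization.AtPrime p)).out 1 4).mpr this

theorem isIntegrallyClosed_of_kaehler {ω : Ω[A⁄k]} (hω : Submodule.span A {ω} = ⊤) :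
    IsIntegrallyClosed A :=
  IsIntegrallyClosed.of_localization_maximal fun p _ _ =>
    have := valuationRing_localization hω p
    inferInstance

variable {F : Type*} [Field F] [Algebra A F] [IsFractionRing A F]

/-- The valuation rings above a ring whose differentials are generated by one element are its
localizations. -/
theorem exists_div_of_mem_valuationSubring {ω : Ω[A⁄k]} (hω : Submodule.span A {ω} = ⊤)
    (V : ValuationSubring F) (hV : ∀ a : A, algebraMap A F a ∈ V) {b : F} (hb : b ∈ V) :
    ∃ a s : A, V.valuation (algebraMap A F s) = 1 ∧ b * algebraMap A F s = algebraMap A F a := by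
  let φ : A →+* V := (algebraMap A F).codRestrict V.toSubring hV
  let p : Ideal A := (maximalIdeal V).comap φ
  have hp : ∀ s : A, s ∈ p.primeCompl → V.valuation (algebraMap A F s) = 1 := fun s hs =>
    le_antisymm ((V.valuation_le_one_iff _).2 (hV s))
      (not_lt.1 fun h => hs (Ideal.mem_comap.2 ((V.valuation_lt_one_iff (φ s)).2 h)))
  have := valuationRing_localization hω p
  obtain ⟨a₀, s₀, hs₀, rfl⟩ := IsFractionRing.div_surjective (A := A) b
  have hs₀' : algebraMap A F s₀ ≠ 0 := IsFractionRing.to_map_ne_zero_of_mem_nonZeroDivisors hs₀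
  have inj : Function.Injective (algebraMap A (Localization.AtPrime p)) :=
    IsLocalization.injective _ p.primeCompl_le_nonZeroDivisors
  have key : ∀ u v : A, algebraMap A (Localization.AtPrime p) u ∣ algebraMap A _ v →
      ∃ a, ∃ s ∈ p.primeCompl, u * a = v * s := by
    rintro u v ⟨c, hc⟩
    obtain ⟨⟨a, s⟩, rfl⟩ := IsLocalization.mk'_surjective p.primeCompl c
    refine ⟨a, s, s.2, inj ?_⟩
    rw [map_mul, map_mul, hc, mul_assoc, IsLocalization.mk'_spec]
  rcases ValuationRing.dvd_total (algebraMap A (Localization.AtPrime p) s₀)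
    (algebraMap A _ a₀) with h | h
  · obtain ⟨a, s, hs, e⟩ := key _ _ h
    refine ⟨a, s, hp s hs, ?_⟩
    have e' := congrArg (algebraMap A F) e
    rw [map_mul, map_mul] at e'
    rw [div_mul_eq_mul_div, div_eq_iff hs₀', ← e', mul_comm]
  -- Here `b = s / a` with `s` a unit of `V`. Since `b` lies in `V`, the element `a` is a unit as
  -- well.
  · obtain ⟨a, s, hs, e⟩ := key _ _ h
    have e' := congrArg (algebraMap A F) e
    rw [map_mul, map_mul] at e'
    have hs1 := hp s hs
    have hsne : algebraMap A F s ≠ 0 := fun h0 => by simp [h0] at hs1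
    have hba : algebraMap A F a₀ / algebraMap A F s₀ * algebraMap A F a = algebraMap A F s := by
      rw [div_mul_eq_mul_div, e', mul_div_cancel_left₀ _ hs₀']
    refine ⟨s, a, ?_, hba⟩
    have h1 := congrArg V.valuation hba
    rw [map_mul, hs1] at h1
    refine le_antisymm ((V.valuation_le_one_iff _).2 (hV a)) ?_
    rw [← h1]
    exact mul_le_of_le_one_left' ((V.valuation_le_one_iff _).2 hb)

end Local

end GenusFour

namespace GenusFour

open KaehlerDifferential IsLocalRing

/-! ### Places and affine charts. -/

section Place

variable {k : Type*} {F : Type*} [Field k] [Field F] [Algebra k F]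

theorem Place.valuation_le_one_iff (P : Place k F) (b : F) :
    P.ring.valuation b ≤ 1 ↔ b ∈ P.ring :=
  P.ring.valuation_le_one_iff b

theorem Place.valuation_algebraMap (P : Place k F) {c : k} (hc : c ≠ 0) :
    P.ring.valuation (algebraMap k F c) = 1 := by
  refine le_antisymm ((P.valuation_le_one_iff _).2 (P.algebraMap_mem c)) ?_
  have h := (P.valuation_le_one_iff _).2 (P.algebraMap_mem c⁻¹)
  have h1 : P.ring.valuation (algebraMap k F c) * P.ring.valuation (algebraMap k F c⁻¹) = 1 := by
    rw [← map_mul, ← map_mul, mul_inv_cancel₀ hc, map_one, map_one]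
  rw [← h1]
  exact mul_le_of_le_one_right' h

theorem Place.ext {P Q : Place k F} (h : ∀ b, b ∈ P.ring ↔ b ∈ Q.ring) : P = Q := by
  cases P; cases Q
  congr
  exact SetLike.ext h

/-- A subalgebra is contained in the local ring of a place at which a given proper nonzero ideal
vanishes. -/
theorem exists_place (A : Subalgebra k F) (p : Ideal A) (htop : p ≠ ⊤) (hbot : p ≠ ⊥) :
    ∃ P : Place k F, (∀ a : A, (a : F) ∈ P.ring) ∧ ∀ a ∈ p, P.ring.valuation (a : F) < 1 := by
  obtain ⟨V, hAV, hV⟩ := Ideal.image_subset_nonunits_valuationSubring (A := A.toSubring) p htop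
  have hlt : ∀ a ∈ p, V.valuation (a : F) < 1 := fun a ha =>
    V.mem_nonunits_iff.1 (hV ⟨a, ha, rfl⟩)
  refine ⟨⟨V, fun c => hAV (A.algebraMap_mem c), ?_⟩, fun a => hAV a.2, hlt⟩
  rintro rfl
  obtain ⟨a, ha, ha0⟩ := Submodule.exists_mem_ne_zero_of_ne_bot hbot
  have hne : (a : F) ≠ 0 := fun h => ha0 (Subtype.ext h)
  have h1 := hlt a ha
  have h2 : (⊤ : ValuationSubring F).valuation (a : F)⁻¹ ≤ 1 :=
    (ValuationSubring.valuation_le_one_iff _ _).2 (ValuationSubring.mem_top _)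
  rw [map_inv₀, inv_le_one₀ (zero_lt_iff.2 ((Valuation.ne_zero_iff _).2 hne))] at h2
  exact absurd h1 (not_lt.2 h2)

theorem isFractionRing_of_adjoin_eq_top {S : Set F} (h : IntermediateField.adjoin k S = ⊤)
    (A : Subalgebra k F) (hA : S ⊆ A) : IsFractionRing A F := by
  refine .of_field _ _ fun b => ?_
  obtain ⟨r, hr, s, hs, e⟩ := IntermediateField.mem_adjoin_iff_div.1
    (h ▸ IntermediateField.mem_top : b ∈ IntermediateField.adjoin k S)
  have hle := Algebra.adjoin_le hA
  exact ⟨⟨r, hle hr⟩, ⟨s, hle hs⟩, e⟩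

theorem span_kaehler_adjoin_eq_top {S : Set F} {ω : Ω[Algebra.adjoin k S⁄k]}
    (h : ∀ s (hs : s ∈ S), D k (Algebra.adjoin k S) ⟨s, Algebra.subset_adjoin hs⟩ ∈
      Submodule.span (Algebra.adjoin k S) {ω}) :
    Submodule.span (Algebra.adjoin k S) {ω} = ⊤ := by
  rw [← top_le_iff, ← KaehlerDifferential.span_range_derivation, Submodule.span_le]
  rintro _ ⟨⟨a, ha⟩, rfl⟩
  induction ha using Algebra.adjoin_induction with
  | mem s hs => exact h s hs
  | algebraMap c =>
    have : D k (Algebra.adjoin k S) ⟨algebraMap k F c, Subalgebra.algebraMap_mem _ c⟩ = 0 :=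
      (D k (Algebra.adjoin k S)).map_algebraMap c
    rw [this]
    exact zero_mem _
  | add a b ha hb ia ib =>
    have := (D k (Algebra.adjoin k S)).map_add ⟨a, ha⟩ ⟨b, hb⟩
    exact this ▸ add_mem ia ib
  | mul a b ha hb ia ib =>
    have := (D k (Algebra.adjoin k S)).leibniz ⟨a, ha⟩ ⟨b, hb⟩
    exact this ▸ add_mem (Submodule.smul_mem _ _ ib) (Submodule.smul_mem _ _ ia)

section Chart

theorem span_map_eq_top (A : Subalgebra k F) [IsFractionRing A F] {ω : Ω[A⁄k]}
    (hω : Submodule.span A {ω} = ⊤) :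
    Submodule.span F {KaehlerDifferential.map k k A F ω} = ⊤ :=
  span_image_localization_eq_top (nonZeroDivisors A) hω

variable [PerfectField k] (A : Subalgebra k F) [Algebra.FiniteType k A] [IsFractionRing A F]

/-- Functions regular at `P` are quotients `a / s` of elements of `A` with `s` a unit at `P`, so by
the quotient rule their differentials are multiples of `ω`. This reduces regularity at `P` to a
condition on one coefficient. -/
theorem Place.span_eq {ω : Ω[A⁄k]} (hω : Submodule.span A {ω} = ⊤) (P : Place k F)
    (hP : ∀ a : A, (a : F) ∈ P.ring) :
    Submodule.span P.ring (Set.range fun b : P.ring => D k F (b : F)) =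
      Submodule.span P.ring {KaehlerDifferential.map k k A F ω} := by
  have hA : ∀ a : A, D k F (a : F) ∈
      Submodule.span P.ring {KaehlerDifferential.map k k A F ω} := fun a => by
    obtain ⟨c, hc⟩ : ∃ c : A, c • ω = D k A a := by
      rw [← Submodule.mem_span_singleton, hω]; trivial
    refine Submodule.mem_span_singleton.2 ⟨⟨c, hP c⟩, ?_⟩
    have := congrArg (KaehlerDifferential.map k k A F) hc
    rw [map_smul, KaehlerDifferential.map_D] at this
    exact this
  apply le_antisymm
  · rw [Submodule.span_le]
    rintro _ ⟨b, rfl⟩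
    obtain ⟨a, s, hs, e⟩ := exists_div_of_mem_valuationSubring hω P.ring hP b.2
    have hs0 : (s : F) ≠ 0 := fun h0 => by
      have : P.ring.valuation (s : F) = 1 := hs
      simp [h0] at this
    have hsu : (s : F)⁻¹ ∈ P.ring := by
      rw [← P.ring.valuation_le_one_iff, map_inv₀]
      have : P.ring.valuation (s : F) = 1 := hs
      simp [this]
    have e' := congrArg (D k F) e
    rw [Derivation.leibniz] at e'
    have e2 : D k F (b : F) = (s : F)⁻¹ • (D k F (a : F) - (b : F) • D k F (s : F)) := by
      rw [eq_inv_smul_iff₀ hs0, eq_sub_iff_add_eq, add_comm]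
      exact e'
    show D k F (b : F) ∈ _
    rw [e2]
    exact Submodule.smul_mem _ (⟨_, hsu⟩ : P.ring)
      (sub_mem (hA a) (Submodule.smul_mem _ b (hA s)))
  · rw [Submodule.span_singleton_le_iff_mem]
    have hmem : ω ∈ Submodule.span A (Set.range (D k A)) := by
      rw [KaehlerDifferential.span_range_derivation]; trivial
    clear hω hA
    induction hmem using Submodule.span_induction with
    | mem η h =>
      obtain ⟨a, rfl⟩ := h
      rw [KaehlerDifferential.map_D]
      exact Submodule.subset_span ⟨⟨a, hP a⟩, rfl⟩
    | zero => rw [map_zero]; exact zero_mem _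
    | add η ξ _ _ ih1 ih2 => rw [map_add]; exact add_mem ih1 ih2
    | smul c η _ ih =>
      rw [map_smul]
      exact Submodule.smul_mem _ (⟨c, hP c⟩ : P.ring) ih

theorem exists_div_of_mem_place {ω : Ω[A⁄k]} (hω : Submodule.span A {ω} = ⊤) (P : Place k F)
    (hP : ∀ a : A, (a : F) ∈ P.ring) {b : F}
    (hb : b ∈ P.ring) : ∃ a s : A, P.ring.valuation (s : F) = 1 ∧ b * s = a :=
  exists_div_of_mem_valuationSubring hω P.ring hP hb

/-- The local ring of a place on the chart is the localization of `A` at the elements that are units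
there. -/
theorem Place.eq_of_chart {ω : Ω[A⁄k]} (hω : Submodule.span A {ω} = ⊤) {P Q : Place k F}
    (hP : ∀ a : A, (a : F) ∈ P.ring)
    (hQ : ∀ a : A, (a : F) ∈ Q.ring)
    (h : ∀ a : A, P.ring.valuation (a : F) = 1 ↔ Q.ring.valuation (a : F) = 1) : P = Q := by
  have key : ∀ P Q : Place k F, (∀ a : A, (a : F) ∈ P.ring) → (∀ a : A, (a : F) ∈ Q.ring) →
      (∀ a : A, P.ring.valuation (a : F) = 1 → Q.ring.valuation (a : F) = 1) →
      ∀ b, b ∈ P.ring → b ∈ Q.ring := by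
    intro P Q hP hQ h b hb
    obtain ⟨a, s, hs, e⟩ := exists_div_of_mem_place A hω P hP hb
    have h1 := h s hs
    have h2 := congrArg Q.ring.valuation e
    rw [map_mul, h1, mul_one] at h2
    rw [← Q.ring.valuation_le_one_iff, h2, Q.ring.valuation_le_one_iff]
    exact hQ a
  exact Place.ext fun b => ⟨key P Q hP hQ (fun a => (h a).1) b, key Q P hQ hP (fun a => (h a).2) b⟩

end Chart

/-- Without differentials, `F` would be formally unramified over `k`, hence separable algebraic. -/
theorem kaehler_nontrivial [PerfectField k] [Algebra.EssFiniteType k F]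
    (h : ¬ Algebra.IsAlgebraic k F) : Nontrivial Ω[F⁄k] := by
  by_contra hn
  rw [not_nontrivial_iff_subsingleton] at hn
  have : Algebra.FormallyUnramified k F := ⟨hn⟩
  have := Algebra.FormallyUnramified.isSeparable k F
  exact h inferInstance

end Place

end GenusFour

namespace GenusFour

open KaehlerDifferential Polynomial

/-! ### Cyclic covers of `y² = f(x)`: normal form, prime ideal, automorphisms. -/

section Tower

/-- The element `∑ (aⱼ(x) + bⱼ(x) y) zʲ`. -/
noncomputable def towerSum {k R : Type*} [Field k] [CommRing R] [Algebra k R] (m : ℕ) (x y z : R)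
    (a b : ℕ → k[X]) : R :=
  ∑ j ∈ Finset.range (m + 1), (aeval x (a j) + aeval x (b j) * y) * z ^ j

/-- `F = k(x, y, z)` with `y² = f(x)` and `z ^ (m + 1) = p(x) + l(x) y`, where the monomials
`yⁱ zʲ` with `i ≤ 1`, `j ≤ m` are linearly independent over `k[x]`. -/
structure IsTower {k F : Type*} [Field k] [Field F] [Algebra k F] (f p l : k[X]) (m : ℕ)
    (x y z : F) : Prop where
  sq_eq : y ^ 2 = aeval x f
  pow_eq : z ^ (m + 1) = aeval x p + aeval x l * y
  adjoin_eq_top : IntermediateField.adjoin k {x, y, z} = ⊤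
  indep : ∀ a b : ℕ → k[X], towerSum m x y z a b = 0 → ∀ j ≤ m, a j = 0 ∧ b j = 0

/-- The ideal of `k[x, y, z]` generated by `y² - f(x)` and `z ^ (m + 1) - (p(x) + l(x) y)`. -/
noncomputable def towerIdeal {k : Type*} [Field k] (f p l : k[X]) (m : ℕ) :
    Ideal (MvPolynomial (Fin 3) k) :=
  Ideal.span {MvPolynomial.X 1 ^ 2 - aeval (MvPolynomial.X 0) f,
    MvPolynomial.X 2 ^ (m + 1) -
      (aeval (MvPolynomial.X 0) p + aeval (MvPolynomial.X 0) l * MvPolynomial.X 1)}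

variable {k : Type*} [Field k] {f p l : k[X]} {m : ℕ}

theorem exists_eq_add_mul {R : Type*} [CommRing R] [Algebra k R] {x y : R}
    (hy : y ^ 2 = aeval x f) {r : R} (hr : r ∈ Algebra.adjoin k {x, y}) :
    ∃ a b : k[X], r = aeval x a + aeval x b * y := by
  induction hr using Algebra.adjoin_induction with
  | mem s hs =>
    rcases hs with rfl | rfl
    · exact ⟨X, 0, by simp⟩
    · exact ⟨0, 1, by simp⟩
  | algebraMap c => exact ⟨C c, 0, by simp⟩
  | add r s _ _ hr hs =>
    obtain ⟨a, b, rfl⟩ := hr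
    obtain ⟨c, d, rfl⟩ := hs
    exact ⟨a + c, b + d, by simp only [map_add]; ring⟩
  | mul r s _ _ hr hs =>
    obtain ⟨a, b, rfl⟩ := hr
    obtain ⟨c, d, rfl⟩ := hs
    exact ⟨a * c + b * d * f, a * d + b * c, by
      simp only [map_add, map_mul]
      linear_combination (aeval x b) * (aeval x d) * hy⟩

theorem exists_eq_towerSum {R : Type*} [CommRing R] [Algebra k R] {x y z : R}
    (hy : y ^ 2 = aeval x f) (hz : z ^ (m + 1) = aeval x p + aeval x l * y) {r : R}
    (hr : r ∈ Algebra.adjoin k {x, y, z}) : ∃ a b : ℕ → k[X], r = towerSum m x y z a b := by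
  -- Multiplication by `r` is shown to preserve the span of the monomials. In this form the product
  -- case is a composition, and two sums never have to be multiplied out.
  suffices h : ∀ s, (∃ a b : ℕ → k[X], s = towerSum m x y z a b) →
      ∃ a b : ℕ → k[X], r * s = towerSum m x y z a b by
    have := h 1 ⟨fun j => if j = 0 then 1 else 0, 0, by
      simp [towerSum]⟩
    simpa using this
  induction hr using Algebra.adjoin_induction with
  | mem t ht =>
    rintro _ ⟨a, b, rfl⟩
    rcases ht with rfl | rfl | rfl
    · refine ⟨fun j => X * a j, fun j => X * b j, ?_⟩
      simp only [towerSum, Finset.mul_sum, map_mul, aeval_X]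
      exact Finset.sum_congr rfl fun _ _ => by ring
    · refine ⟨fun j => f * b j, a, ?_⟩
      simp only [towerSum, Finset.mul_sum, map_mul]
      exact Finset.sum_congr rfl fun j _ => by
        linear_combination (aeval x (b j)) * z ^ j * hy
    · refine ⟨fun j => if j = 0 then p * a m + l * f * b m else a (j - 1),
        fun j => if j = 0 then l * a m + p * b m else b (j - 1), ?_⟩
      rw [towerSum, towerSum, Finset.sum_range_succ, Finset.sum_range_succ', mul_add,
        Finset.mul_sum]
      congr 1
      · exact Finset.sum_congr rfl fun j _ => by simp; ring
      · simp only [if_true, map_add, map_mul, pow_zero, mul_one]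
        rw [← hy]
        linear_combination (aeval x (a m) + aeval x (b m) * y) * hz
  | algebraMap c =>
    rintro _ ⟨a, b, rfl⟩
    refine ⟨fun j => C c * a j, fun j => C c * b j, ?_⟩
    simp only [towerSum, Finset.mul_sum, map_mul, aeval_C]
    exact Finset.sum_congr rfl fun _ _ => by ring
  | add r s _ _ hr hs =>
    intro t ht
    obtain ⟨a, b, e⟩ := hr t ht
    obtain ⟨a', b', e'⟩ := hs t ht
    refine ⟨fun j => a j + a' j, fun j => b j + b' j, ?_⟩
    rw [add_mul, e, e']
    simp only [towerSum, ← Finset.sum_add_distrib, map_add]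
    exact Finset.sum_congr rfl fun _ _ => by ring
  | mul r s _ _ hr hs =>
    intro t ht
    rw [mul_assoc]
    exact hr _ (hs _ ht)

theorem towerSum_map {R S : Type*} [CommRing R] [CommRing S] [Algebra k R] [Algebra k S]
    (φ : R →ₐ[k] S) (x y z : R) (a b : ℕ → k[X]) :
    φ (towerSum m x y z a b) = towerSum m (φ x) (φ y) (φ z) a b := by
  simp [towerSum, Polynomial.aeval_algHom_apply]

theorem towerIdeal_le_ker {S : Type*} [CommRing S] [Algebra k S] {x y z : S}
    (hy : y ^ 2 = aeval x f) (hz : z ^ (m + 1) = aeval x p + aeval x l * y) :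
    towerIdeal f p l m ≤
      RingHom.ker (MvPolynomial.aeval ![x, y, z] : MvPolynomial (Fin 3) k →ₐ[k] S) := by
  rw [towerIdeal, Ideal.span_le]
  rintro _ (rfl | rfl)
  · simp [RingHom.mem_ker, ← Polynomial.aeval_algHom_apply, hy]
  · simp [RingHom.mem_ker, ← Polynomial.aeval_algHom_apply, hz]

theorem exists_sub_towerSum_mem (q : MvPolynomial (Fin 3) k) : ∃ a b : ℕ → k[X],
    q - towerSum m (MvPolynomial.X 0) (MvPolynomial.X 1) (MvPolynomial.X 2) a b ∈
      towerIdeal f p l m := by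
  let π := Ideal.Quotient.mkₐ k (towerIdeal f p l m)
  have hy : π (MvPolynomial.X 1) ^ 2 = aeval (π (MvPolynomial.X 0)) f := by
    rw [← map_pow, Polynomial.aeval_algHom_apply]
    exact Ideal.Quotient.eq.2 (Ideal.subset_span (Or.inl rfl))
  have hz : π (MvPolynomial.X 2) ^ (m + 1) = aeval (π (MvPolynomial.X 0)) p +
      aeval (π (MvPolynomial.X 0)) l * π (MvPolynomial.X 1) := by
    rw [← map_pow, Polynomial.aeval_algHom_apply, Polynomial.aeval_algHom_apply, ← map_mul,
      ← map_add]
    exact Ideal.Quotient.eq.2 (Ideal.subset_span (Or.inr rfl))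
  have hq : π q ∈ Algebra.adjoin k
      {π (MvPolynomial.X 0), π (MvPolynomial.X 1), π (MvPolynomial.X 2)} := by
    have h1 : q ∈ Algebra.adjoin k (Set.range (MvPolynomial.X : Fin 3 → MvPolynomial (Fin 3) k)) :=
      by rw [MvPolynomial.adjoin_range_X]; trivial
    have h2 : π q ∈ (Algebra.adjoin k (Set.range
      (MvPolynomial.X : Fin 3 → MvPolynomial (Fin 3) k))).map π := ⟨q, h1, rfl⟩
    rw [AlgHom.map_adjoin, ← Set.range_comp] at h2
    refine Algebra.adjoin_mono ?_ h2
    rintro _ ⟨i, rfl⟩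
    fin_cases i <;> simp
  obtain ⟨a, b, e⟩ := exists_eq_towerSum hy hz hq
  refine ⟨a, b, ?_⟩
  rw [← towerSum_map] at e
  exact Ideal.Quotient.eq.1 e

/-- Modulo the ideal every polynomial is a tower sum; if it vanishes in `F`, independence makes all
coefficients zero. -/
theorem IsTower.ker_aeval {F : Type*} [Field F] [Algebra k F] {x y z : F}
    (h : IsTower f p l m x y z) :
    RingHom.ker (MvPolynomial.aeval ![x, y, z] : MvPolynomial (Fin 3) k →ₐ[k] F) =
      towerIdeal f p l m := by
  refine le_antisymm (fun q hq => ?_) (towerIdeal_le_ker h.sq_eq h.pow_eq)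
  obtain ⟨a, b, hab⟩ := exists_sub_towerSum_mem (f := f) (p := p) (l := l) (m := m) q
  have h1 := towerIdeal_le_ker h.sq_eq h.pow_eq hab
  rw [RingHom.mem_ker] at h1 hq
  rw [map_sub, hq, zero_sub, neg_eq_zero, towerSum_map] at h1
  have h2 := h.indep a b (by simpa using h1)
  have h3 : towerSum m (MvPolynomial.X 0 : MvPolynomial (Fin 3) k) (MvPolynomial.X 1)
      (MvPolynomial.X 2) a b = 0 := by
    refine Finset.sum_eq_zero fun j hj => ?_
    obtain ⟨ha, hb⟩ := h2 j (Nat.lt_succ_iff.1 (Finset.mem_range.1 hj))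
    simp [ha, hb]
  rwa [h3, sub_zero] at hab

theorem towerIdeal_isPrime {F : Type*} [Field F] [Algebra k F] {x y z : F}
    (h : IsTower f p l m x y z) : (towerIdeal f p l m).IsPrime := by
  rw [← h.ker_aeval]
  exact RingHom.ker_isPrime _

/-- The fraction field of `k[x, y, z]` modulo the ideal is a tower, once there is any tower. -/
theorem isTower_of_isFractionRing {F₀ : Type*} [Field F₀] [Algebra k F₀] {x₀ y₀ z₀ : F₀}
    (h₀ : IsTower f p l m x₀ y₀ z₀) {I : Ideal (MvPolynomial (Fin 3) k)}
    (hI : I = towerIdeal f p l m) {F : Type*} [Field F] [Algebra k F]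
    [Algebra (MvPolynomial (Fin 3) k ⧸ I) F] [IsScalarTower k (MvPolynomial (Fin 3) k ⧸ I) F]
    [IsFractionRing (MvPolynomial (Fin 3) k ⧸ I) F] :
    IsTower f p l m (algebraMap (MvPolynomial (Fin 3) k ⧸ I) F (Ideal.Quotient.mk I (.X 0)))
      (algebraMap (MvPolynomial (Fin 3) k ⧸ I) F (Ideal.Quotient.mk I (.X 1)))
      (algebraMap (MvPolynomial (Fin 3) k ⧸ I) F (Ideal.Quotient.mk I (.X 2))) := by
  let π : MvPolynomial (Fin 3) k →ₐ[k] F :=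
    (IsScalarTower.toAlgHom k (MvPolynomial (Fin 3) k ⧸ I) F).comp (Ideal.Quotient.mkₐ k I)
  have hπ : ∀ q, π q = 0 ↔ q ∈ towerIdeal f p l m := fun q => by
    rw [← hI, ← Ideal.Quotient.eq_zero_iff_mem]
    exact map_eq_zero_iff _ (IsFractionRing.injective (MvPolynomial (Fin 3) k ⧸ I) F)
  change IsTower f p l m (π (.X 0)) (π (.X 1)) (π (.X 2))
  refine ⟨?_, ?_, ?_, ?_⟩
  · rw [← map_pow, Polynomial.aeval_algHom_apply, ← sub_eq_zero, ← map_sub, hπ]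
    exact Ideal.subset_span (Or.inl rfl)
  · rw [← map_pow, Polynomial.aeval_algHom_apply, Polynomial.aeval_algHom_apply, ← map_mul,
      ← map_add, ← sub_eq_zero, ← map_sub, hπ]
    exact Ideal.subset_span (Or.inr rfl)
  · rw [eq_top_iff]
    intro b _
    have hmem : ∀ q, π q ∈ IntermediateField.adjoin k {π (.X 0), π (.X 1), π (.X 2)} := by
      intro q
      induction q using MvPolynomial.induction_on with
      | C c => exact (π.commutes c).symm ▸ IntermediateField.algebraMap_mem _ c
      | add p q hp hq => rw [map_add]; exact add_mem hp hq
      | mul_X q i hq =>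
        rw [map_mul]
        refine mul_mem hq (IntermediateField.subset_adjoin _ _ ?_)
        fin_cases i <;> simp
    obtain ⟨r, s, _, rfl⟩ := IsFractionRing.div_surjective (A := MvPolynomial (Fin 3) k ⧸ I) b
    obtain ⟨r, rfl⟩ := Ideal.Quotient.mk_surjective r
    obtain ⟨s, rfl⟩ := Ideal.Quotient.mk_surjective s
    exact div_mem (hmem r) (hmem s)
  -- A vanishing tower sum comes from an element of the ideal, hence vanishes in `F₀` as well, where
  -- independence is known.
  · intro a b hab
    rw [← towerSum_map, hπ] at hab
    have := towerIdeal_le_ker h₀.sq_eq h₀.pow_eq hab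
    rw [RingHom.mem_ker, towerSum_map] at this
    exact h₀.indep a b (by simpa using this)

theorem IsTower.smul {F : Type*} [Field F] [Algebra k F] {x y z : F}
    (h : IsTower f p l m x y z) {ζ : k} (hζ : ζ ^ (m + 1) = 1) :
    IsTower f p l m x y (algebraMap k F ζ * z) := by
  have hζ0 : ζ ≠ 0 := by rintro rfl; simp at hζ
  refine ⟨h.sq_eq, ?_, ?_, ?_⟩
  · rw [mul_pow, ← map_pow, hζ, map_one, one_mul, h.pow_eq]
  · rw [← h.adjoin_eq_top]
    refine le_antisymm (h.adjoin_eq_top ▸ le_top) (IntermediateField.adjoin_le_iff.2 ?_)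
    have hsub := IntermediateField.subset_adjoin k {x, y, algebraMap k F ζ * z}
    rintro t (ht | ht | ht) <;> rw [ht]
    · exact hsub (by simp)
    · exact hsub (by simp)
    · have h1 := mul_mem (IntermediateField.algebraMap_mem
        (IntermediateField.adjoin k {x, y, algebraMap k F ζ * z}) ζ⁻¹)
        (hsub (show algebraMap k F ζ * z ∈ _ by simp))
      rwa [← mul_assoc, ← map_mul, inv_mul_cancel₀ hζ0, map_one, one_mul] at h1
  · intro a b hab j hj
    have := h.indep (fun j => C (ζ ^ j) * a j) (fun j => C (ζ ^ j) * b j) (by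
      rw [← hab]
      refine Finset.sum_congr rfl fun j _ => ?_
      simp only [map_mul, aeval_C, mul_pow, map_pow]
      ring) j hj
    simpa [hζ0] using this

/-- The automorphism `z ↦ ζ z` of a tower. -/
theorem IsTower.exists_algEquiv {F : Type*} [Field F] [Algebra k F] {x y z : F}
    (h : IsTower f p l m x y z) {ζ : k} (hζ : ζ ^ (m + 1) = 1) :
    ∃ σ : F ≃ₐ[k] F, σ x = x ∧ σ y = y ∧ σ z = algebraMap k F ζ * z := by
  have h' := h.smul hζ
  let e : MvPolynomial (Fin 3) k →ₐ[k] F := MvPolynomial.aeval ![x, y, z]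
  let e' : MvPolynomial (Fin 3) k →ₐ[k] F := MvPolynomial.aeval ![x, y, algebraMap k F ζ * z]
  -- Both evaluations have kernel `towerIdeal`, so `z ↦ ζ z` is well defined and injective on the
  -- coordinate ring and extends to the fraction field.
  have hker : RingHom.ker e.rangeRestrict = RingHom.ker e' := by
    rw [AlgHom.ker_rangeRestrict]
    exact h.ker_aeval.trans h'.ker_aeval.symm
  let g : e.range →ₐ[k] F := (Ideal.Quotient.liftₐ _ e' fun q hq => by
      exact (hker ▸ hq : q ∈ RingHom.ker e')).comp
    (Ideal.quotientKerAlgEquivOfSurjective e.rangeRestrict_surjective).symm.toAlgHom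
  have hg : ∀ q, g (e.rangeRestrict q) = e' q := by
    intro q
    simp only [g, AlgHom.comp_apply]
    have : (Ideal.quotientKerAlgEquivOfSurjective e.rangeRestrict_surjective).symm
        (e.rangeRestrict q) = Ideal.Quotient.mk _ q := by
      rw [AlgEquiv.symm_apply_eq]
      rfl
    erw [this]
    rfl
  have hinj : Function.Injective g := by
    rw [injective_iff_map_eq_zero]
    intro r hr
    obtain ⟨q, rfl⟩ := e.rangeRestrict_surjective r
    rw [hg] at hr
    exact (hker ▸ hr : q ∈ RingHom.ker e.rangeRestrict)
  have hmem : ∀ i, e (.X i) ∈ e.range := fun i => ⟨_, rfl⟩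
  have : IsFractionRing e.range F := by
    refine isFractionRing_of_adjoin_eq_top h.adjoin_eq_top _ ?_
    rintro _ (rfl | rfl | rfl)
    · exact ⟨.X 0, by simp [e]⟩
    · exact ⟨.X 1, by simp [e]⟩
    · exact ⟨.X 2, by simp [e]⟩
  let σ : F →ₐ[k] F := IsFractionRing.liftAlgHom (K := F) (g := g) hinj
  have hσ : ∀ q, σ (e q) = e' q := fun q => by
    rw [← hg]
    exact IsFractionRing.lift_algebraMap hinj (e.rangeRestrict q)
  have hx : σ x = x := by simpa [e, e'] using hσ (.X 0)
  have hy : σ y = y := by simpa [e, e'] using hσ (.X 1)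
  have hz : σ z = algebraMap k F ζ * z := by simpa [e, e'] using hσ (.X 2)
  refine ⟨AlgEquiv.ofBijective σ ⟨σ.injective, ?_⟩, hx, hy, hz⟩
  rw [← AlgHom.fieldRange_eq_top, eq_top_iff, ← h'.adjoin_eq_top,
    IntermediateField.adjoin_le_iff]
  rintro t (ht | ht | ht) <;> rw [ht]
  · exact ⟨x, hx⟩
  · exact ⟨y, hy⟩
  · exact ⟨z, hz⟩

end Tower

end GenusFour

namespace GenusFour

open KaehlerDifferential Polynomial

theorem aeval_mem_subalgebra {k R : Type*} [Field k] [CommRing R] [Algebra k R]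
    {S : Subalgebra k R} {r : R} (hr : r ∈ S) (q : k[X]) : aeval r q ∈ S :=
  Algebra.adjoin_le (Set.singleton_subset_iff.2 hr) (aeval_mem_adjoin_singleton k r)

/-! ### Differentials on the affine curve. -/

section Differentials

variable {k : Type*} [Field k] {A : Type*} [CommRing A] [Algebra k A] {f p l : k[X]} {m : ℕ}
  {x y z : A}

/-- The differential `dx / y` on a smooth affine curve `y² = f(x)`. -/
theorem exists_dx_div_y (hy : y ^ 2 = aeval x f) {α β : k[X]}
    (h : α * f + β * derivative f = 1) :
    ∃ η : Ω[A⁄k], D k A x = y • η ∧ (2 : A) • D k A y = aeval x (derivative f) • η := by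
  have hd : (2 : A) • y • D k A y = aeval x (derivative f) • D k A x := by
    have := congrArg (D k A) hy
    rw [Derivation.map_aeval, pow_two, Derivation.leibniz] at this
    rw [← this]
    module
  have hA : aeval x α * aeval x f + aeval x β * aeval x (derivative f) = 1 := by
    rw [← map_mul, ← map_mul, ← map_add, h, map_one]
  -- Since `f = y²` and `f' dx = 2 y dy`, one has `dx / y = (α f + β f') dx / y = α y dx + 2 β dy`.
  refine ⟨(aeval x α * y) • D k A x + (2 * aeval x β) • D k A y, ?_, ?_⟩
  · have h1 : y • ((aeval x α * y) • D k A x + (2 * aeval x β) • D k A y) =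
        (aeval x α * y ^ 2) • D k A x + aeval x β • (2 : A) • y • D k A y := by module
    rw [h1, hd, hy, smul_smul, ← add_smul, hA, one_smul]
  · have h1 : (2 : A) • D k A y = (2 : A) • (1 : A) • D k A y := by module
    rw [h1, ← hA]
    have h2 : aeval x (derivative f) • ((aeval x α * y) • D k A x + (2 * aeval x β) • D k A y) =
        (aeval x α * y) • aeval x (derivative f) • D k A x +
          (2 * aeval x β * aeval x (derivative f)) • D k A y := by module
    rw [h2, ← hd, ← hy]
    module

/-- Twice the derivative of `p(x) + l(x) y` with respect to `dx / y`. -/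
noncomputable def jac (f p l : k[X]) (x y : A) : A :=
  2 * y * (aeval x (derivative p) + aeval x (derivative l) * y) +
    aeval x l * aeval x (derivative f)

theorem two_smul_D_add {η : Ω[A⁄k]} (hx : D k A x = y • η)
    (hdy : (2 : A) • D k A y = aeval x (derivative f) • η) :
    (2 : A) • D k A (aeval x p + aeval x l * y) = jac f p l x y • η := by
  rw [map_add, Derivation.leibniz, Derivation.map_aeval, Derivation.map_aeval]
  have : (2 : A) • (aeval x (derivative p) • D k A x +
      (aeval x l • D k A y + y • aeval x (derivative l) • D k A x)) =
      (2 * aeval x (derivative p) + 2 * y * aeval x (derivative l)) • D k A x +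
        aeval x l • (2 : A) • D k A y := by module
  rw [this, hx, hdy, jac]
  module

theorem smul_D_z {η : Ω[A⁄k]} (hx : D k A x = y • η)
    (hdy : (2 : A) • D k A y = aeval x (derivative f) • η)
    (hz : z ^ (m + 1) = aeval x p + aeval x l * y) :
    (2 * (m + 1) * z ^ m : A) • D k A z = jac f p l x y • η := by
  rw [← two_smul_D_add hx hdy, ← hz, Derivation.leibniz_pow]
  simp only [Nat.add_sub_cancel, ← Nat.cast_smul_eq_nsmul A]
  push_cast
  module

/-- The differential `dx / (y zᵐ)` on a smooth affine curve. -/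
theorem exists_dx_div_y_mul_pow {η : Ω[A⁄k]} (hx : D k A x = y • η)
    (hdy : (2 : A) • D k A y = aeval x (derivative f) • η)
    (hz : z ^ (m + 1) = aeval x p + aeval x l * y) {c d e : A}
    (h : (c * (aeval x p + aeval x l * y) + d * jac f p l x y) * e = 1) :
    ∃ ω : Ω[A⁄k], η = z ^ m • ω ∧ (2 * (m + 1) : A) • D k A z = jac f p l x y • ω := by
  have hdz := smul_D_z hx hdy hz
  rw [← hz] at h
  -- With `h = z ^ (m + 1)` and `jac η = 2 (m + 1) zᵐ dz`, dividing `η = (c h + d jac) e η` by `zᵐ`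
  -- gives `e c z η + 2 (m + 1) e d dz`.
  refine ⟨(e * c * z) • η + (e * d * (2 * (m + 1))) • D k A z, ?_, ?_⟩
  · have h1 : z ^ m • ((e * c * z) • η + (e * d * (2 * (m + 1))) • D k A z) =
        (e * c * z ^ (m + 1)) • η + (e * d) • (2 * (m + 1) * z ^ m : A) • D k A z := by
      module
    rw [h1, hdz, smul_smul, ← add_smul]
    conv_lhs => rw [← one_smul A η, ← h]
    congr 1
    ring
  · have h1 : (2 * (m + 1) : A) • D k A z = ((c * z ^ (m + 1) + d * jac f p l x y) * e) •
        (2 * (m + 1) : A) • D k A z := by rw [h, one_smul]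
    rw [h1]
    have h2 : (jac f p l x y) • ((e * c * z) • η + (e * d * (2 * (m + 1))) • D k A z) =
      (e * c * z) • (jac f p l x y) • η + (jac f p l x y * (e * d * (2 * (m + 1)))) • D k A z := by
      module
    rw [h2, ← hdz]
    module

theorem D_mem_span_of_mul_eq_one {ω : Ω[A⁄k]} {s t : A} (h : s * t = 1)
    (hs : D k A s ∈ Submodule.span A {ω}) : D k A t ∈ Submodule.span A {ω} := by
  have h1 := congrArg (D k A) h
  rw [Derivation.leibniz, Derivation.map_one_eq_zero] at h1
  have h2 : D k A t = -(t * t) • D k A s := by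
    have h3 : D k A t = t • (s • D k A t + t • D k A s) - (t * t) • D k A s := by
      have : t • (s • D k A t + t • D k A s) - (t * t) • D k A s = (s * t) • D k A t := by module
      rw [this, h, one_smul]
    rw [h3, h1]
    module
  rw [h2]
  exact Submodule.smul_mem _ _ hs

theorem mem_span_of_smul_mem {M : Type*} [AddCommGroup M] [Module A M] {N : Submodule A M}
    {v : M} {s t : A} (h : s * t = 1) (hs : s • v ∈ N) : v ∈ N := by
  have := N.smul_mem t hs
  rwa [smul_smul, mul_comm, h, one_smul] at this

theorem D_aeval_mem_span {ω : Ω[A⁄k]} (q : k[X]) (hx : D k A x ∈ Submodule.span A {ω}) :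
    D k A (aeval x q) ∈ Submodule.span A {ω} := by
  rw [Derivation.map_aeval]
  exact Submodule.smul_mem _ _ hx

theorem two_mul_inv (h2 : (2 : k) ≠ 0) : (2 : A) * algebraMap k A 2⁻¹ = 1 := by
  have : (2 : A) = algebraMap k A 2 := (map_ofNat _ 2).symm
  rw [this, ← map_mul, mul_inv_cancel₀ h2, map_one]

theorem natCast_mul_inv {n : ℕ} (h2 : (n : k) ≠ 0) : (n : A) * algebraMap k A (n : k)⁻¹ = 1 := by
  have : (n : A) = algebraMap k A n := by simp
  rw [this, ← map_mul, mul_inv_cancel₀ h2, map_one]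

end Differentials

/-! ### Construction of a tower. -/

section Existence

universe u

variable {k : Type u} [Field k] {f p l : k[X]} {m : ℕ}

/-- The affine coordinate ring of a smooth affine curve `y² = f(x)` is integrally closed. -/
theorem mem_adjoin_of_isIntegral [PerfectField k] {F : Type*} [Field F] [Algebra k F]
    (h2 : (2 : k) ≠ 0) {x y : F}
    (hy : y ^ 2 = aeval x f) {α β : k[X]} (h : α * f + β * derivative f = 1) {r : F}
    (hr : IsIntegral (Algebra.adjoin k {x, y}) r)
    (hF : r ∈ IntermediateField.adjoin k {x, y}) : r ∈ Algebra.adjoin k {x, y} := by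
  let B := Algebra.adjoin k {x, y}
  let X' : B := ⟨x, Algebra.subset_adjoin (by simp)⟩
  let Y' : B := ⟨y, Algebra.subset_adjoin (by simp)⟩
  have hy' : Y' ^ 2 = aeval X' f := by
    apply Subtype.ext
    have := Polynomial.aeval_algHom_apply B.val X' f
    rw [SubmonoidClass.coe_pow]
    exact hy.trans this
  obtain ⟨η, hx, hdy⟩ := exists_dx_div_y (k := k) hy' h
  have hspan : Submodule.span B {η} = ⊤ := by
    apply span_kaehler_adjoin_eq_top
    rintro s hs
    rcases hs with hs | hs
    · subst hs
      exact Submodule.mem_span_singleton.2 ⟨Y', hx.symm⟩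
    · have hs' : s = y := hs
      subst hs'
      refine mem_span_of_smul_mem (two_mul_inv h2) ?_
      exact Submodule.mem_span_singleton.2 ⟨_, hdy.symm⟩
  have : Algebra.FiniteType k B :=
    Subalgebra.fg_iff_finiteType _ |>.1 <| Subalgebra.fg_def.2 ⟨_, Set.toFinite _, rfl⟩
  have := isIntegrallyClosed_of_kaehler hspan
  obtain ⟨a, ha, s, hs, e⟩ := IntermediateField.mem_adjoin_iff_div.1 hF
  by_cases hs0 : s = 0
  · rw [e, hs0, div_zero]; exact zero_mem _
  -- `F` may be larger than the fraction field of `B`, so integrality of `r` is first moved into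
  -- `FractionRing B`.
  let φ : FractionRing B →ₐ[B] F := IsFractionRing.liftAlgHom (g := Algebra.ofId B F)
    Subtype.val_injective
  have hφ : φ (algebraMap B _ ⟨a, ha⟩ / algebraMap B _ ⟨s, hs⟩) = r := by
    rw [map_div₀, AlgHom.commutes, AlgHom.commutes, e]
    rfl
  have hint : IsIntegral B (algebraMap B (FractionRing B) ⟨a, ha⟩ / algebraMap B _ ⟨s, hs⟩) := by
    rw [← isIntegral_algHom_iff φ φ.injective, hφ]
    exact hr
  obtain ⟨b, hb⟩ := IsIntegrallyClosed.isIntegral_iff.1 hint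
  have : r = b := by
    rw [← hφ, ← hb, AlgHom.commutes]
    rfl
  rw [this]
  exact b.2

/-- The reduction `y² = f` happens on polynomial coefficients, so the same `c`, `d` serve for the
generic point and for the rational point `(x₀, y₀)`. -/
theorem exists_eq_pow_add_mul {R : Type*} [CommRing R] [Algebra k R] {x y : R}
    (hy : y ^ 2 = aeval x f) {x₀ y₀ : k} (hy₀ : y₀ ^ 2 = f.eval x₀) (a b : k[X]) (n : ℕ) :
    ∃ c d : k[X], (aeval x a + aeval x b * y) ^ n = aeval x c + aeval x d * y ∧
      (a.eval x₀ + b.eval x₀ * y₀) ^ n = c.eval x₀ + d.eval x₀ * y₀ := by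
  induction n with
  | zero => exact ⟨1, 0, by simp, by simp⟩
  | succ n ih =>
    obtain ⟨c, d, h, h₀⟩ := ih
    refine ⟨c * a + d * b * f, c * b + d * a, ?_, ?_⟩
    · rw [pow_succ, h]
      simp only [map_add, map_mul]
      linear_combination (aeval x d) * (aeval x b) * hy
    · rw [pow_succ, h₀]
      simp only [eval_add, eval_mul]
      linear_combination (eval x₀ d) * (eval x₀ b) * hy₀

theorem adjoinRoot_sum_eq_zero {K : Type*} [Field K] {q : K[X]} {n : ℕ}
    (hq : q.natDegree = n + 1) (c : ℕ → K)
    (h : ∑ j ∈ Finset.range (n + 1), AdjoinRoot.of q (c j) * AdjoinRoot.root q ^ j = 0) :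
    ∀ j ≤ n, c j = 0 := by
  have hq0 : q ≠ 0 := by rintro rfl; simp at hq
  have h1 : AdjoinRoot.mk q (∑ j ∈ Finset.range (n + 1), C (c j) * X ^ j) = 0 := by
    simpa [AdjoinRoot.mk_C, AdjoinRoot.mk_X] using h
  rw [AdjoinRoot.mk_eq_zero] at h1
  have h2 : (∑ j ∈ Finset.range (n + 1), C (c j) * X ^ j) = 0 := by
    refine Polynomial.eq_zero_of_dvd_of_degree_lt h1 ?_
    rw [Polynomial.degree_eq_natDegree hq0, hq]
    exact (Polynomial.degree_sum_fin_lt (n := n + 1) fun j => c j).trans_le' (by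
      rw [Finset.sum_range])
  intro j hj
  have h3 := congrArg (fun r => Polynomial.coeff r j) h2
  simpa [Polynomial.finsetSum_coeff, Polynomial.coeff_C_mul, Polynomial.coeff_X_pow,
    Nat.lt_succ_iff.2 hj] using h3

/-- A polynomial of odd degree is not a square in `k(x)`: the degrees in `s² f = r²` have different
parity. -/
theorem exists_quadratic_extension {g : ℕ} (hdeg : f.natDegree = 2 * g + 1) :
    ∃ (F : Type u) (_ : Field F) (_ : Algebra k F) (x y : F), y ^ 2 = aeval x f ∧
      IntermediateField.adjoin k {x, y} = ⊤ ∧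
      ∀ a b : k[X], aeval x a + aeval x b * y = 0 → a = 0 ∧ b = 0 := by
  let K := FractionRing k[X]
  have hinjK : Function.Injective (algebraMap k[X] K) := IsFractionRing.injective _ _
  have hirr : Irreducible (X ^ 2 - C (algebraMap k[X] K f) : K[X]) := by
    refine X_pow_sub_C_irreducible_of_prime Nat.prime_two fun b hb => ?_
    obtain ⟨r, s, hs, rfl⟩ := IsFractionRing.div_surjective (A := k[X]) b
    have hs0 : s ≠ 0 := nonZeroDivisors.ne_zero hs
    have hs0' : algebraMap k[X] K s ≠ 0 := (map_ne_zero_iff _ hinjK).2 hs0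
    rw [div_pow, div_eq_iff (pow_ne_zero 2 hs0'), ← map_pow, ← map_pow, ← map_mul] at hb
    have h3 := congrArg natDegree (hinjK hb)
    have hf0 : f ≠ 0 := by rintro rfl; simp at hdeg
    rw [natDegree_pow, natDegree_mul hf0 (pow_ne_zero 2 hs0), natDegree_pow, hdeg] at h3
    omega
  have : Fact (Irreducible (X ^ 2 - C (algebraMap k[X] K f) : K[X])) := ⟨hirr⟩
  let K₁ := AdjoinRoot (X ^ 2 - C (algebraMap k[X] K f) : K[X])
  let ι : k[X] →ₐ[k] K₁ := (Algebra.ofId K K₁).restrictScalars k |>.comp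
    ((Algebra.ofId k[X] K).restrictScalars k)
  let x₁ : K₁ := ι X
  have hι : ∀ q, ι q = aeval x₁ q := fun q => by
    rw [Polynomial.aeval_algHom_apply, Polynomial.aeval_X_left_apply]
  let y₁ : K₁ := AdjoinRoot.root _
  have hy₁ : y₁ ^ 2 = aeval x₁ f := by
    have := AdjoinRoot.eval₂_root (X ^ 2 - C (algebraMap k[X] K f) : K[X])
    rw [eval₂_sub, eval₂_pow, eval₂_X, eval₂_C, sub_eq_zero] at this
    rw [← hι]
    exact this
  have hind₁ : ∀ a b : k[X], aeval x₁ a + aeval x₁ b * y₁ = 0 → a = 0 ∧ b = 0 := by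
    intro a b hab
    rw [← hι, ← hι] at hab
    have := adjoinRoot_sum_eq_zero (q := (X ^ 2 - C (algebraMap k[X] K f) : K[X])) (n := 1)
      (by rw [natDegree_X_pow_sub_C]) (fun j => algebraMap k[X] K (if j = 0 then a else b)) (by
        rw [Finset.sum_range_succ, Finset.sum_range_one]
        simp only [if_true, one_ne_zero, if_false, pow_zero, mul_one, pow_one]
        exact hab)
    have h0 := this 0 (by norm_num)
    have h1 := this 1 le_rfl
    simp only [if_true, one_ne_zero, if_false] at h0 h1
    exact ⟨(map_eq_zero_iff _ hinjK).1 h0, (map_eq_zero_iff _ hinjK).1 h1⟩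
  have htop₁ : IntermediateField.adjoin k {x₁, y₁} = ⊤ := by
    rw [eq_top_iff]
    intro b _
    have hsub := IntermediateField.subset_adjoin k {x₁, y₁}
    have hpol : ∀ q, ι q ∈ IntermediateField.adjoin k {x₁, y₁} := fun q => by
      rw [hι]
      exact aeval_mem_subalgebra (S := (IntermediateField.adjoin k {x₁, y₁}).toSubalgebra)
        (hsub (by simp)) q
    have hK : ∀ c : K, AdjoinRoot.of _ c ∈ IntermediateField.adjoin k {x₁, y₁} := fun c => by
      obtain ⟨r, s, _, rfl⟩ := IsFractionRing.div_surjective (A := k[X]) c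
      rw [map_div₀]
      exact div_mem (hpol r) (hpol s)
    obtain ⟨q, rfl⟩ := AdjoinRoot.mk_surjective b
    induction q using Polynomial.induction_on' with
      | add q r hq hr =>
        rw [RingHom.map_add (AdjoinRoot.mk _)]
        exact add_mem (hq trivial) (hr trivial)
      | monomial n c =>
        rw [← C_mul_X_pow_eq_monomial, map_mul, map_pow, AdjoinRoot.mk_C, AdjoinRoot.mk_X]
        exact mul_mem (hK c) (pow_mem (hsub (by simp [y₁])) n)
  exact ⟨K₁, inferInstance, inferInstance, x₁, y₁, hy₁, htop₁, hind₁⟩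

/-- As `m + 1` is prime, it is enough that `h` is not an `(m + 1)`-th power in `k(x, y)`. A root
would be integral over the integrally closed ring `k[x, y]`, so of the form `a(x) + b(x) y`, and its
value at `(x₀, y₀)` would be a root of the value of `h`, contrary to `hne`. -/
theorem exists_isTower [PerfectField k] (h2 : (2 : k) ≠ 0) {g : ℕ} (hdeg : f.natDegree = 2 * g + 1)
    {α β : k[X]} (hf : α * f + β * derivative f = 1) (hm : (m + 1).Prime) {x₀ y₀ : k}
    (hy₀ : y₀ ^ 2 = f.eval x₀) (hne : ∀ c : k, c ^ (m + 1) ≠ p.eval x₀ + l.eval x₀ * y₀) :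
    ∃ (F : Type u) (_ : Field F) (_ : Algebra k F) (x y z : F), IsTower f p l m x y z := by
  obtain ⟨K₁, _, _, x₁, y₁, hy₁, htop₁, hind₁⟩ := exists_quadratic_extension hdeg
  let h₁ : K₁ := aeval x₁ p + aeval x₁ l * y₁
  have hirr' : Irreducible (X ^ (m + 1) - C h₁ : K₁[X]) := by
    refine X_pow_sub_C_irreducible_of_prime hm fun r hr => ?_
    have hB : h₁ ∈ Algebra.adjoin k {x₁, y₁} := by
      have hx : x₁ ∈ Algebra.adjoin k {x₁, y₁} := Algebra.subset_adjoin (by simp)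
      exact add_mem (aeval_mem_subalgebra hx p)
        (mul_mem (aeval_mem_subalgebra hx l) (Algebra.subset_adjoin (by simp)))
    have hint : IsIntegral (Algebra.adjoin k {x₁, y₁}) r :=
      IsIntegral.of_pow m.succ_pos (hr ▸ isIntegral_algebraMap (x := (⟨h₁, hB⟩ :
        Algebra.adjoin k {x₁, y₁})))
    have hrB := mem_adjoin_of_isIntegral h2 hy₁ hf hint (htop₁ ▸ IntermediateField.mem_top)
    obtain ⟨a, b, rfl⟩ := exists_eq_add_mul hy₁ hrB
    obtain ⟨c, d, e, e₀⟩ := exists_eq_pow_add_mul hy₁ hy₀ a b (m + 1)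
    rw [hr] at e
    have := hind₁ (p - c) (l - d) (by
      rw [map_sub, map_sub]
      linear_combination e)
    rw [← sub_eq_zero.1 this.1, ← sub_eq_zero.1 this.2] at e₀
    exact hne _ e₀
  have : Fact (Irreducible (X ^ (m + 1) - C h₁ : K₁[X])) := ⟨hirr'⟩
  let F := AdjoinRoot (X ^ (m + 1) - C h₁ : K₁[X])
  let κ : K₁ →ₐ[k] F := (Algebra.ofId K₁ F).restrictScalars k
  let z₂ : F := AdjoinRoot.root _
  refine ⟨F, inferInstance, inferInstance, κ x₁, κ y₁, z₂, ?_, ?_, ?_, ?_⟩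
  · rw [← map_pow, hy₁, Polynomial.aeval_algHom_apply]
  · have := AdjoinRoot.eval₂_root (X ^ (m + 1) - C h₁ : K₁[X])
    rw [eval₂_sub, eval₂_pow, eval₂_X, eval₂_C, sub_eq_zero] at this
    rw [Polynomial.aeval_algHom_apply, Polynomial.aeval_algHom_apply, ← map_mul, ← map_add]
    exact this
  · rw [eq_top_iff]
    intro b _
    have hsub := IntermediateField.subset_adjoin k {κ x₁, κ y₁, z₂}
    have hK : ∀ c : K₁, κ c ∈ IntermediateField.adjoin k {κ x₁, κ y₁, z₂} := by
      have : IntermediateField.adjoin k {x₁, y₁} ≤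
          (IntermediateField.adjoin k {κ x₁, κ y₁, z₂}).comap κ := by
        rw [IntermediateField.adjoin_le_iff]
        rintro t (ht | ht) <;> rw [ht]
        · exact hsub (by simp)
        · exact hsub (by simp)
      rw [htop₁] at this
      exact fun c => this IntermediateField.mem_top
    obtain ⟨q, rfl⟩ := AdjoinRoot.mk_surjective b
    induction q using Polynomial.induction_on' with
      | add q r hq hr =>
        rw [RingHom.map_add (AdjoinRoot.mk _)]
        exact add_mem (hq trivial) (hr trivial)
      | monomial n c =>
        rw [← C_mul_X_pow_eq_monomial, map_mul, map_pow, AdjoinRoot.mk_C, AdjoinRoot.mk_X]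
        exact mul_mem (hK c) (pow_mem (hsub (by simp [z₂])) n)
  · intro a b hab j hj
    refine hind₁ _ _ (adjoinRoot_sum_eq_zero (q := (X ^ (m + 1) - C h₁ : K₁[X])) (n := m)
      (by rw [natDegree_X_pow_sub_C])
      (fun j => aeval x₁ (a j) + aeval x₁ (b j) * y₁) ?_ j hj)
    rw [← hab]
    refine Finset.sum_congr rfl fun j _ => ?_
    rw [Polynomial.aeval_algHom_apply, Polynomial.aeval_algHom_apply, ← map_mul, ← map_add]
    rfl

end Existence

end GenusFour

namespace GenusFour

open KaehlerDifferential Polynomial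
open scoped IntermediateField.algebraAdjoinAdjoin

/-! ### The function field of a tower and its places. -/

section FunctionField

universe u

variable {k : Type*} {F : Type*} [Field k] [Field F] [Algebra k F] {f p l : k[X]} {m : ℕ}
  {x y z : F}

namespace IsTower

theorem transcendental (h : IsTower f p l m x y z) : Transcendental k x := by
  rw [transcendental_iff]
  intro q hq
  exact (h.indep (fun j => if j = 0 then q else 0) 0 (by
    simp [towerSum, Finset.sum_range_succ', hq]) 0 m.zero_le).1

theorem essFiniteType (h : IsTower f p l m x y z) : Algebra.EssFiniteType k F := by
  rw [← IntermediateField.fg_top_iff]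
  classical
  exact ⟨{x, y, z}, by simpa using h.adjoin_eq_top⟩

theorem isAlgebraic_adjoin (h : IsTower f p l m x y z) :
    Algebra.IsAlgebraic (Algebra.adjoin k {x}) F := by
  let L := IntermediateField.adjoin k {x}
  have hx : x ∈ L := IntermediateField.subset_adjoin k {x} rfl
  have hL : ∀ c ∈ L, c ∈ algebraicClosure L F := fun c hc =>
    mem_algebraicClosure_iff.2 (isAlgebraic_algebraMap (⟨c, hc⟩ : L))
  have hpol : ∀ q : k[X], aeval x q ∈ algebraicClosure L F := fun q =>
    hL _ (aeval_mem_subalgebra (S := L.toSubalgebra) hx q)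
  have hroot : ∀ (n : ℕ) (c : F), c ^ (n + 1) ∈ algebraicClosure L F →
      c ∈ algebraicClosure L F := fun n c hc => by
    rw [mem_algebraicClosure_iff'] at hc ⊢
    exact IsIntegral.of_pow n.succ_pos hc
  have hy : y ∈ algebraicClosure L F := hroot 1 y (h.sq_eq ▸ hpol f)
  have hz : z ∈ algebraicClosure L F :=
    hroot m z (h.pow_eq ▸ add_mem (hpol p) (mul_mem (hpol l) hy))
  have htop : (⊤ : IntermediateField k F) ≤ (algebraicClosure L F).restrictScalars k := by
    rw [← h.adjoin_eq_top, IntermediateField.adjoin_le_iff]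
    rintro t (ht | ht | ht) <;> rw [ht]
    · exact hL x hx
    · exact hy
    · exact hz
  have : Algebra.IsAlgebraic L F := ⟨fun c => mem_algebraicClosure_iff.1 (htop trivial)⟩
  exact (IsFractionRing.comap_isAlgebraic_iff (A := Algebra.adjoin k {x}) (K := L)).2 this

theorem isCurveFunctionField (h : IsTower f p l m x y z)
    (hc : ∀ a : F, IsAlgebraic k a → a ∈ Set.range (algebraMap k F)) :
    IsCurveFunctionField k F := by
  refine ⟨?_, ?_, hc⟩
  · rw [IntermediateField.fg_top_iff]
    exact h.essFiniteType
  · have := h.isAlgebraic_adjoin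
    refine le_antisymm ((Algebra.IsAlgebraic.trdeg_le_cardinalMk k {x}).trans (by simp)) ?_
    have : Algebra.Transcendental k F := ⟨x, h.transcendental⟩
    exact Cardinal.one_le_iff_pos.2 (trdeg_pos k F)

theorem kaehler_nontrivial [PerfectField k] (h : IsTower f p l m x y z) :
    Nontrivial Ω[F⁄k] := by
  have := h.essFiniteType
  exact GenusFour.kaehler_nontrivial fun ha => h.transcendental (ha.isAlgebraic x)

theorem x_ne_zero (h : IsTower f p l m x y z) : x ≠ 0 := by
  intro h0
  exact h.transcendental (h0 ▸ isAlgebraic_zero)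

theorem aeval_ne_zero (h : IsTower f p l m x y z) {q : k[X]} (hq : q ≠ 0) : aeval x q ≠ 0 :=
  fun h0 => hq ((transcendental_iff.1 h.transcendental) q h0)

theorem z_ne_zero (h : IsTower f p l m x y z) (hm : 1 ≤ m) : z ≠ 0 := by
  intro h0
  have := (h.indep 0 (fun j => if j = 1 then 1 else 0) (by
    refine Finset.sum_eq_zero fun j _ => ?_
    by_cases hj : j = 0
    · simp [hj]
    · simp [h0, hj]) 1 hm).2
  simp at this

/-- `y` and `z` are integral over `k[x]`, so a place lies on the affine curve as soon as `x` is
finite. -/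
theorem mem_places_affine (h : IsTower f p l m x y z) {P : Place k F} (hx : x ∈ P.ring) :
    y ∈ P.ring ∧ z ∈ P.ring := by
  have hpol : ∀ q : k[X], aeval x q ∈ P.ring := fun q => by
    let S : Subalgebra k F := { P.ring.toSubring with algebraMap_mem' := P.algebraMap_mem }
    exact aeval_mem_subalgebra (S := S) hx q
  have hroot : ∀ (n : ℕ) (c : F), c ^ (n + 1) ∈ P.ring → c ∈ P.ring := fun n c hc => by
    rw [← P.ring.valuation_le_one_iff] at hc ⊢
    rw [map_pow] at hc
    exact (pow_le_one_iff n.succ_ne_zero).1 hc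
  have hy : y ∈ P.ring := hroot 1 y (h.sq_eq ▸ hpol f)
  exact ⟨hy, hroot m z (h.pow_eq ▸ add_mem (hpol p) (mul_mem (hpol l) hy))⟩

end IsTower

/-- A transcendental element has a pole. -/
theorem exists_place_not_mem (hx : Transcendental k x) : ∃ P : Place k F, x ∉ P.ring := by
  have hx' : x ∉ (integralClosure k F).toSubring := fun h => hx (IsIntegral.isAlgebraic h)
  have : IsIntegrallyClosedIn (integralClosure k F).toSubring F :=
    inferInstanceAs (IsIntegrallyClosedIn (integralClosure k F) F)
  obtain ⟨V, hV, hxV⟩ := Subring.exists_le_valuationSubring_of_isIntegrallyClosedIn hx'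
  refine ⟨⟨V, fun c => hV ((integralClosure k F).algebraMap_mem c), ?_⟩, hxV⟩
  rintro rfl
  exact hxV (ValuationSubring.mem_top _)

/-- The image of a place under an automorphism. -/
def Place.comap (P : Place k F) (σ : F ≃ₐ[k] F) : Place k F where
  ring := P.ring.comap (σ : F →+* F)
  algebraMap_mem c := by
    show σ (algebraMap k F c) ∈ P.ring
    rw [σ.commutes]
    exact P.algebraMap_mem c
  ne_top htop := P.ne_top (SetLike.ext fun b => by
    refine ⟨fun _ => trivial, fun _ => ?_⟩
    have h1 : σ.symm b ∈ P.ring.comap (σ : F →+* F) := htop ▸ ValuationSubring.mem_top _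
    have h2 : σ (σ.symm b) ∈ P.ring := h1
    rwa [σ.apply_symm_apply] at h2)

theorem Place.mem_comap {P : Place k F} {σ : F ≃ₐ[k] F} {b : F} :
    b ∈ (P.comap σ).ring ↔ σ b ∈ P.ring := Iff.rfl

theorem Place.aeval_mem (P : Place k F) (hx : x ∈ P.ring) (q : k[X]) : aeval x q ∈ P.ring := by
  let S : Subalgebra k F := { P.ring.toSubring with algebraMap_mem' := P.algebraMap_mem }
  exact aeval_mem_subalgebra (S := S) hx q

theorem Place.valuation_aeval_eq_one (P : Place k F) {s : F} (hs : P.ring.valuation s < 1)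
    {q : k[X]} (hq : q.coeff 0 ≠ 0) : P.ring.valuation (aeval s q) = 1 := by
  have h1 : aeval s q = algebraMap k F (q.coeff 0) + s * aeval s q.divX := by
    conv_lhs => rw [← Polynomial.X_mul_divX_add q]
    rw [map_add, map_mul, aeval_X, aeval_C, add_comm]
  have h2 : P.ring.valuation (s * aeval s q.divX) < 1 := by
    rw [map_mul]
    exact mul_lt_one_of_lt_of_le hs ((P.valuation_le_one_iff _).2
      (P.aeval_mem ((P.valuation_le_one_iff _).1 hs.le) _))
  rw [h1, ← P.valuation_algebraMap hq]
  exact Valuation.map_add_eq_of_lt_left _ (by rwa [P.valuation_algebraMap hq])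

theorem Place.valuation_inv_lt_one {P : Place k F} (hx : x ∉ P.ring) :
    P.ring.valuation x⁻¹ < 1 := by
  rw [← P.ring.mem_nonunits_iff, P.ring.inv_mem_nonunits_iff]
  exact Or.inr hx

/-- Write `q(x)` as `x ^ deg q` times the reversed polynomial at `1/x`, which is a unit because its
constant term is the leading coefficient of `q`. -/
theorem Place.valuation_aeval {P : Place k F} (hx : x ∉ P.ring) {q : k[X]} (hq : q ≠ 0) :
    P.ring.valuation (aeval x q) = P.ring.valuation x ^ q.natDegree := by
  have hx0 : x ≠ 0 := by rintro rfl; exact hx P.ring.zero_mem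
  have h1 : aeval x q = aeval x⁻¹ q.reverse * x ^ q.natDegree := by
    let _ := invertibleOfNonzero hx0
    have h3 := Polynomial.eval₂_reverse_mul_pow (algebraMap k F) x q
    rw [invOf_eq_inv] at h3
    exact h3.symm
  rw [h1, map_mul, map_pow, P.valuation_aeval_eq_one (Place.valuation_inv_lt_one hx) (by
    rwa [Polynomial.coeff_zero_reverse, Ne, Polynomial.leadingCoeff_eq_zero]), one_mul]

end FunctionField

end GenusFour

namespace GenusFour

open KaehlerDifferential Polynomial

/-! ### Orders at infinity. -/

section Infinity

variable {k : Type*} {F : Type*} [Field k] [Field F] [Algebra k F] {f p l φ G₀ G₁ : k[X]}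
  {m g i j : ℕ} {x y z : F}

theorem Place.inv_mem {P : Place k F} (hx : x ∉ P.ring) : x⁻¹ ∈ P.ring :=
  (P.valuation_le_one_iff _).1 (Place.valuation_inv_lt_one hx).le

/-- Coordinates `σ = 1 / x`, `τ = x ^ g / y`, `w = z τⁱ σʲ` around infinity for a tower with
`deg f = 2 g + 1`, where `φ` is the reverse of `f`. -/
structure IsTowerAtInfinity (φ G₀ G₁ : k[X]) (g i j m : ℕ) (x y z τ w : F) : Prop where
  tau_mul : τ * y = x ^ g
  w_eq : w = z * τ ^ i * x⁻¹ ^ j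
  inv_eq : x⁻¹ = τ ^ 2 * aeval x⁻¹ φ
  w_pow : w ^ (m + 1) * aeval x⁻¹ φ = aeval x⁻¹ G₀ + τ * aeval x⁻¹ G₁
  phi_coeff : φ.coeff 0 ≠ 0
  G_coeff : G₀.coeff 0 ≠ 0

namespace IsTowerAtInfinity

variable {τ w : F} (h : IsTowerAtInfinity φ G₀ G₁ g i j m x y z τ w) {P : Place k F}
  (hx : x ∉ P.ring)

include h hx

theorem valuation_phi : P.ring.valuation (aeval x⁻¹ φ) = 1 :=
  P.valuation_aeval_eq_one (Place.valuation_inv_lt_one hx) h.phi_coeff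

/-- From here on `τ` measures orders at infinity: `x`, `y`, `z` turn out to have the valuations of
`τ⁻²`, `τ ^ -(2 g + 1)` and `τ ^ -(i + 2 j)`. -/
theorem valuation_tau_sq : P.ring.valuation τ ^ 2 = (P.ring.valuation x)⁻¹ := by
  have h1 := congrArg P.ring.valuation h.inv_eq
  rw [map_mul, map_pow, h.valuation_phi hx, mul_one, map_inv₀] at h1
  exact h1.symm

theorem valuation_tau_lt_one : P.ring.valuation τ < 1 := by
  have h1 := h.valuation_tau_sq hx
  have h2 : P.ring.valuation τ ^ 2 < 1 := by
    rw [h1, ← map_inv₀]; exact Place.valuation_inv_lt_one hx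
  exact (pow_lt_one_iff two_ne_zero).1 h2

theorem tau_mem : τ ∈ P.ring :=
  (P.valuation_le_one_iff _).1 (h.valuation_tau_lt_one hx).le

theorem tau_ne_zero : τ ≠ 0 := by
  rintro rfl
  have h0 := h.inv_eq
  rw [zero_pow two_ne_zero, zero_mul, inv_eq_zero] at h0
  exact hx (h0 ▸ P.ring.zero_mem)

/-- At infinity the equation becomes `w ^ (m + 1) φ(0) = G₀(0)` with both constants nonzero. -/
theorem valuation_w : P.ring.valuation w = 1 := by
  have h1 := congrArg P.ring.valuation h.w_pow
  have h2 : P.ring.valuation (τ * aeval x⁻¹ G₁) < 1 := by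
    rw [map_mul]
    exact mul_lt_one_of_lt_of_le (h.valuation_tau_lt_one hx)
      ((P.valuation_le_one_iff _).2 (P.aeval_mem (Place.inv_mem hx) _))
  have h3 := P.valuation_aeval_eq_one (Place.valuation_inv_lt_one hx) h.G_coeff
  rw [map_mul, h.valuation_phi hx, mul_one, map_pow,
    Valuation.map_add_eq_of_lt_left _ (by rwa [h3]), h3] at h1
  exact (pow_eq_one_iff.1 h1).resolve_right m.succ_ne_zero

theorem w_mem : w ∈ P.ring := (P.valuation_le_one_iff _).1 (h.valuation_w hx).le

theorem valuation_x : P.ring.valuation x = (P.ring.valuation τ)⁻¹ ^ 2 := by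
  rw [inv_pow, h.valuation_tau_sq hx, inv_inv]

theorem valuation_y : P.ring.valuation y = (P.ring.valuation τ)⁻¹ ^ (2 * g + 1) := by
  have h1 := congrArg P.ring.valuation h.tau_mul
  have h0 : P.ring.valuation τ ≠ 0 := (Valuation.ne_zero_iff _).2 (h.tau_ne_zero hx)
  rw [map_mul, map_pow, h.valuation_x hx, ← pow_mul] at h1
  rw [pow_succ, ← h1]
  field_simp

theorem valuation_z : P.ring.valuation z = (P.ring.valuation τ)⁻¹ ^ (i + 2 * j) := by
  have h1 := congrArg P.ring.valuation h.w_eq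
  have h0 : P.ring.valuation τ ≠ 0 := (Valuation.ne_zero_iff _).2 (h.tau_ne_zero hx)
  rw [h.valuation_w hx, map_mul, map_mul, map_pow, map_pow, map_inv₀,
    ← h.valuation_tau_sq hx, ← pow_mul, mul_assoc, ← pow_add] at h1
  rw [inv_pow]
  exact eq_inv_of_mul_eq_one_left h1.symm

theorem one_lt_inv_valuation_tau : 1 < (P.ring.valuation τ)⁻¹ := by
  rw [one_lt_inv₀ (zero_lt_iff.2 ((Valuation.ne_zero_iff _).2 (h.tau_ne_zero hx)))]
  exact h.valuation_tau_lt_one hx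

theorem valuation_aeval {q : k[X]} (hq : q ≠ 0) :
    P.ring.valuation (aeval x q) = (P.ring.valuation τ)⁻¹ ^ (2 * q.natDegree) := by
  rw [Place.valuation_aeval hx hq, h.valuation_x hx, pow_mul]

/-- The order at infinity of `a(x) + b(x) y`. -/
theorem valuation_add_le {a b : k[X]} {N : ℕ}
    (hab : P.ring.valuation (aeval x a + aeval x b * y) ≤ (P.ring.valuation τ)⁻¹ ^ N) :
    (a = 0 ∨ 2 * a.natDegree ≤ N) ∧ (b = 0 ∨ 2 * b.natDegree + (2 * g + 1) ≤ N) := by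
  have hT := h.one_lt_inv_valuation_tau hx
  have hb' : b ≠ 0 → P.ring.valuation (aeval x b * y) =
      (P.ring.valuation τ)⁻¹ ^ (2 * b.natDegree + (2 * g + 1)) := fun hb => by
    rw [map_mul, h.valuation_aeval hx hb, h.valuation_y hx, ← pow_add]
  rcases eq_or_ne a 0 with rfl | ha
  · refine ⟨Or.inl rfl, or_iff_not_imp_left.2 fun hb => ?_⟩
    rw [map_zero, zero_add, hb' hb] at hab
    exact (pow_le_pow_iff_right₀ hT).1 hab
  rcases eq_or_ne b 0 with rfl | hb
  · refine ⟨Or.inr ?_, Or.inl rfl⟩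
    rw [map_zero, zero_mul, add_zero, h.valuation_aeval hx ha] at hab
    exact (pow_le_pow_iff_right₀ hT).1 hab
  have h1 := h.valuation_aeval hx ha
  have h2 := hb' hb
  -- The orders are even for `a(x)` and odd for `b(x) y`, so the two terms cannot cancel.
  have hne : P.ring.valuation (aeval x a) ≠ P.ring.valuation (aeval x b * y) := by
    rw [h1, h2]
    intro he
    have := pow_right_injective₀ (zero_lt_one.trans hT) hT.ne' he
    omega
  rw [Valuation.map_add_of_distinct_val _ hne, max_le_iff, h1, h2,
    pow_le_pow_iff_right₀ hT, pow_le_pow_iff_right₀ hT] at hab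
  exact ⟨Or.inr hab.1, Or.inr hab.2⟩

end IsTowerAtInfinity

end Infinity

end GenusFour

namespace GenusFour

open KaehlerDifferential Polynomial

/-! ### The chart around infinity and regular differentials there. -/

section

variable {k : Type*} {F : Type*} [Field k] [Field F] [Algebra k F] {f p l φ G₀ G₁ : k[X]}
  {m g i j : ℕ} {x y z : F}

theorem D_mul_mem {A : Type*} [CommRing A] [Algebra k A] {N : Submodule A Ω[A⁄k]} {a b : A}
    (ha : D k A a ∈ N) (hb : D k A b ∈ N) : D k A (a * b) ∈ N := by
  rw [Derivation.leibniz]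
  exact add_mem (N.smul_mem _ hb) (N.smul_mem _ ha)

theorem D_pow_mem {A : Type*} [CommRing A] [Algebra k A] {N : Submodule A Ω[A⁄k]} {a : A}
    (ha : D k A a ∈ N) (n : ℕ) : D k A (a ^ n) ∈ N := by
  rw [Derivation.leibniz_pow]
  exact nsmul_mem (N.smul_mem _ ha) n

theorem Place.smul_mem_span_singleton (P : Place k F) {η : Ω[F⁄k]} (hη : η ≠ 0) {d : F} :
    d • η ∈ Submodule.span P.ring {η} ↔ d ∈ P.ring := by
  rw [Submodule.mem_span_singleton]
  constructor
  · rintro ⟨c, hc⟩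
    have : (c : F) = d := smul_left_injective F hη hc
    exact this ▸ c.2
  · exact fun hd => ⟨⟨d, hd⟩, rfl⟩

theorem ne_zero_of_span_eq_top [Nontrivial Ω[F⁄k]] {η : Ω[F⁄k]}
    (h : Submodule.span F {η} = ⊤) : η ≠ 0 := by
  rintro rfl
  rw [Submodule.span_singleton_eq_bot.2 rfl] at h
  exact bot_ne_top h

namespace IsTowerAtInfinity

variable {τ w : F}

/-- Generators of a coordinate ring around infinity. -/
def chart (φ : k[X]) (x τ w : F) : Set F :=
  {x⁻¹, τ, w, ((1 - τ ^ 2 * aeval x⁻¹ (derivative φ)) * (w * aeval x⁻¹ φ))⁻¹}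

theorem valuation_denom (h : IsTowerAtInfinity φ G₀ G₁ g i j m x y z τ w) {P : Place k F}
    (hx : x ∉ P.ring) : P.ring.valuation (1 - τ ^ 2 * aeval x⁻¹ (derivative φ)) = 1 := by
  have h1 : P.ring.valuation (τ ^ 2 * aeval x⁻¹ (derivative φ)) < 1 := by
    rw [map_mul, map_pow]
    exact mul_lt_one_of_lt_of_le ((pow_lt_one_iff two_ne_zero).2 (h.valuation_tau_lt_one hx))
      ((P.valuation_le_one_iff _).2 (P.aeval_mem (Place.inv_mem hx) _))
  have := Valuation.map_one_sub_of_lt P.ring.valuation h1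
  exact this

theorem chart_le (h : IsTowerAtInfinity φ G₀ G₁ g i j m x y z τ w) {P : Place k F}
    (hx : x ∉ P.ring) (a : Algebra.adjoin k (chart φ x τ w)) : (a : F) ∈ P.ring := by
  let S : Subalgebra k F := { P.ring.toSubring with algebraMap_mem' := P.algebraMap_mem }
  have : Algebra.adjoin k (chart φ x τ w) ≤ S := by
    rw [Algebra.adjoin_le_iff]
    rintro t (ht | ht | ht | ht) <;> rw [ht]
    · exact Place.inv_mem hx
    · exact h.tau_mem hx
    · exact h.w_mem hx
    · show _ ∈ P.ring
      rw [← P.valuation_le_one_iff, map_inv₀, map_mul, map_mul, h.valuation_denom hx,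
        h.valuation_w hx, h.valuation_phi hx, mul_one, mul_one, inv_one]
  exact this a.2

theorem denom_ne_zero (h : IsTowerAtInfinity φ G₀ G₁ g i j m x y z τ w) (hx : Transcendental k x) :
    (1 - τ ^ 2 * aeval x⁻¹ (derivative φ)) * (w * aeval x⁻¹ φ) ≠ 0 := by
  obtain ⟨P, hP⟩ := exists_place_not_mem hx
  rw [← Valuation.ne_zero_iff P.ring.valuation, map_mul, map_mul, h.valuation_denom hP,
        h.valuation_w hP, h.valuation_phi hP]
  simp

theorem chart_finiteType : Algebra.FiniteType k (Algebra.adjoin k (chart φ x τ w)) :=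
  Subalgebra.fg_iff_finiteType _ |>.1 <| Subalgebra.fg_def.2
    ⟨_, by unfold chart; exact Set.toFinite _, rfl⟩

theorem chart_isFractionRing (h : IsTowerAtInfinity φ G₀ G₁ g i j m x y z τ w)
    (ht : IsTower f p l m x y z) : IsFractionRing (Algebra.adjoin k (chart φ x τ w)) F := by
  refine isFractionRing_of_adjoin_eq_top (S := chart φ x τ w) ?_ _ Algebra.subset_adjoin
  rw [← top_le_iff, ← ht.adjoin_eq_top, IntermediateField.adjoin_le_iff]
  have hsub := IntermediateField.subset_adjoin k (chart φ x τ w)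
  obtain ⟨P, hP⟩ := exists_place_not_mem ht.transcendental
  have hτ := h.tau_ne_zero hP
  have hx : x ∈ IntermediateField.adjoin k (chart φ x τ w) := by
    have := inv_mem (hsub (show x⁻¹ ∈ chart φ x τ w by simp [chart]))
    rwa [inv_inv] at this
  have hτm := hsub (show τ ∈ chart φ x τ w by simp [chart])
  have hwm := hsub (show w ∈ chart φ x τ w by simp [chart])
  rintro t (ht' | ht' | ht') <;> rw [ht']
  · exact hx
  · have : y = x ^ g / τ := by rw [← h.tau_mul, mul_div_cancel_left₀ _ hτ]
    rw [this]
    exact div_mem (pow_mem hx g) hτm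
  · have : z = w / (τ ^ i * x⁻¹ ^ j) := by
      rw [h.w_eq, mul_assoc, mul_div_cancel_right₀ _ (mul_ne_zero (pow_ne_zero _ hτ)
        (pow_ne_zero _ (inv_ne_zero ht.x_ne_zero)))]
    rw [this]
    exact div_mem hwm (mul_mem (pow_mem hτm i) (pow_mem (inv_mem hx) j))

/-- Implicit differentiation of `s = t² φ(s)`; the factor on the left is inverted in `chart`. -/
theorem denom_smul_D {A : Type*} [CommRing A]
    [Algebra k A] {s t : A} (hs : s = t ^ 2 * aeval s φ) :
    (1 - t ^ 2 * aeval s (derivative φ)) • D k A s = (2 * t * aeval s φ) • D k A t := by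
  have h1 := congrArg (D k A) hs
  rw [Derivation.leibniz, Derivation.map_aeval, pow_two, Derivation.leibniz] at h1
  rw [sub_smul, one_smul]
  nth_rewrite 1 [h1]
  module

/-- The inverted generator makes `1 - τ² φ'(1/x)`, `w` and `φ(1/x)` units. Then `d(1/x)` is a
multiple of `dτ` by implicit differentiation, and so is `dw` by differentiating the equation for `w
^ (m + 1)`, because `(m + 1) wᵐ φ(1/x)` is a unit. -/
theorem chart_span (h : IsTowerAtInfinity φ G₀ G₁ g i j m x y z τ w) (hx : Transcendental k x)
    (hm : ((m + 1 : ℕ) : k) ≠ 0) :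
    Submodule.span (Algebra.adjoin k (chart φ x τ w))
      {D k (Algebra.adjoin k (chart φ x τ w)) ⟨τ, Algebra.subset_adjoin (by simp [chart])⟩} = ⊤ := by
  set A := Algebra.adjoin k (chart φ x τ w) with hA
  let s : A := ⟨x⁻¹, Algebra.subset_adjoin (by simp [chart])⟩
  let t : A := ⟨τ, Algebra.subset_adjoin (by simp [chart])⟩
  let r : A := ⟨w, Algebra.subset_adjoin (by simp [chart])⟩
  let d : A := ⟨((1 - τ ^ 2 * aeval x⁻¹ (derivative φ)) * (w * aeval x⁻¹ φ))⁻¹,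
    Algebra.subset_adjoin (by simp [chart])⟩
  have hae : ∀ q : k[X], ((aeval s q : A) : F) = aeval x⁻¹ q := fun q =>
    (Polynomial.aeval_algHom_apply A.val s q).symm
  have hst : s = t ^ 2 * aeval s φ := by
    apply Subtype.ext
    rw [Subalgebra.coe_mul, hae, Subalgebra.coe_pow]
    exact h.inv_eq
  have hr : r ^ (m + 1) * aeval s φ = aeval s G₀ + t * aeval s G₁ := by
    apply Subtype.ext
    rw [Subalgebra.coe_mul, hae, Subalgebra.coe_pow, Subalgebra.coe_add, Subalgebra.coe_mul, hae,
      hae]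
    exact h.w_pow
  have hd : ((1 - t ^ 2 * aeval s (derivative φ)) * (r * aeval s φ)) * d = 1 := by
    apply Subtype.ext
    rw [Subalgebra.coe_mul, Subalgebra.coe_mul, Subalgebra.coe_mul, hae, Subalgebra.coe_sub,
      Subalgebra.coe_mul, hae, Subalgebra.coe_pow]
    exact mul_inv_cancel₀ (h.denom_ne_zero hx)
  have hDt : D k A t ∈ Submodule.span A {D k A t} := Submodule.mem_span_singleton_self _
  have hDs : D k A s ∈ Submodule.span A {D k A t} := by
    refine mem_span_of_smul_mem (s := 1 - t ^ 2 * aeval s (derivative φ))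
      (t := r * aeval s φ * d) (by linear_combination hd) ?_
    rw [denom_smul_D (k := k) hst]
    exact Submodule.smul_mem _ _ hDt
  have hDφ : ∀ q : k[X], D k A (aeval s q) ∈ Submodule.span A {D k A t} := fun q =>
    D_aeval_mem_span q hDs
  have hDr : D k A r ∈ Submodule.span A {D k A t} := by
    have h1 := congrArg (D k A) hr
    have h3 : D k A (aeval s G₀ + t * aeval s G₁) ∈ Submodule.span A {D k A t} := by
      rw [map_add]
      exact add_mem (hDφ _) (D_mul_mem hDt (hDφ _))
    rw [← h1, Derivation.leibniz, Derivation.leibniz_pow] at h3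
    have h4 := (Submodule.add_mem_iff_right _ (Submodule.smul_mem _ (r ^ (m + 1)) (hDφ φ))).1 h3
    rw [Nat.add_sub_cancel, ← Nat.cast_smul_eq_nsmul A, smul_smul, smul_smul] at h4
    refine mem_span_of_smul_mem (t := algebraMap k A ((m + 1 : ℕ) : k)⁻¹ *
      ((1 - t ^ 2 * aeval s (derivative φ)) * r * d) *
      ((1 - t ^ 2 * aeval s (derivative φ)) * aeval s φ * d) ^ m) ?_ h4
    have h5 : ((1 - t ^ 2 * aeval s (derivative φ)) * (r * aeval s φ) * d) ^ (m + 1) = 1 := by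
      rw [hd, one_pow]
    have h6 := natCast_mul_inv (A := A) hm
    generalize (1 - t ^ 2 * aeval s (derivative φ)) = e at h5 ⊢
    calc _ = (((m + 1 : ℕ) : A) * algebraMap k A ((m + 1 : ℕ) : k)⁻¹) *
        (e * (r * aeval s φ) * d) ^ (m + 1) := by ring
      _ = 1 := by rw [h5, h6, one_mul]
  apply span_kaehler_adjoin_eq_top
  intro v hv
  rcases hv with hv | hv | hv | hv
  · subst hv; exact hDs
  · subst hv; exact hDt
  · subst hv; exact hDr
  · subst hv
    refine D_mem_span_of_mul_eq_one hd (D_mul_mem ?_ (D_mul_mem hDr (hDφ _)))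
    rw [map_sub, Derivation.map_one_eq_zero, zero_sub]
    exact neg_mem (D_mul_mem (D_pow_mem hDt 2) (hDφ _))

/-- Regularity of `c dx / (y zᵐ)` at the places at infinity. -/
theorem mem_span_iff [PerfectField k] (h : IsTowerAtInfinity φ G₀ G₁ g i j m x y z τ w)
    (ht : IsTower f p l m x y z) (h2 : (2 : k) ≠ 0) (hm : ((m + 1 : ℕ) : k) ≠ 0)
    {N : ℕ} (hN : N + 2 = 2 * g + (i + 2 * j) * m) {ω : Ω[F⁄k]}
    (hω : D k F x = (y * z ^ m) • ω) {P : Place k F} (hx : x ∉ P.ring) (c : F) :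
    c • ω ∈ Submodule.span P.ring (Set.range fun b : P.ring => D k F (b : F)) ↔
      P.ring.valuation c ≤ (P.ring.valuation τ)⁻¹ ^ N := by
  have := h.chart_isFractionRing ht
  have : Algebra.FiniteType k (Algebra.adjoin k (chart φ x τ w)) := chart_finiteType
  have := ht.kaehler_nontrivial
  have hspan := h.chart_span ht.transcendental hm
  rw [Place.span_eq _ hspan P (h.chart_le hx), KaehlerDifferential.map_D]
  have hne := ne_zero_of_span_eq_top (span_map_eq_top _ hspan)
  rw [KaehlerDifferential.map_D] at hne
  change D k F τ ≠ 0 at hne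
  change c • ω ∈ Submodule.span P.ring {D k F τ} ↔ _
  have hx0 := ht.x_ne_zero
  have hτ0 := h.tau_ne_zero hx
  set E : F := 1 - τ ^ 2 * aeval x⁻¹ (derivative φ) with hE
  have hE1 : P.ring.valuation E = 1 := h.valuation_denom hx
  have hE0 : E ≠ 0 := by rw [← Valuation.ne_zero_iff P.ring.valuation, hE1]; exact one_ne_zero
  have hvy := h.valuation_y hx
  have hvz := h.valuation_z hx
  have hT := h.one_lt_inv_valuation_tau hx
  have hT0 : (P.ring.valuation τ)⁻¹ ≠ 0 := (zero_lt_one.trans hT).ne'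
  have hy0 : y ≠ 0 := by
    rw [← Valuation.ne_zero_iff P.ring.valuation, hvy]; exact pow_ne_zero _ hT0
  have hz0 : z ≠ 0 := by
    rw [← Valuation.ne_zero_iff P.ring.valuation, hvz]; exact pow_ne_zero _ hT0
  -- This combines `dx = -x² d(1/x)` with `E d(1/x) = 2 τ φ(1/x) dτ` and `τ φ(1/x) = 1 / (x τ)`.
  have hDx : D k F x = (-(2 * x * τ⁻¹ * E⁻¹)) • D k F τ := by
    have h1 := denom_smul_D (k := k) (A := F) h.inv_eq
    have h3 : D k F x = -(x ^ 2) • D k F x⁻¹ := by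
      rw [Derivation.leibniz_inv, smul_smul]
      rw [show -x ^ 2 * -x⁻¹ ^ 2 = 1 by field_simp, one_smul]
    have h4 : D k F x⁻¹ = E⁻¹ • (2 * τ * aeval x⁻¹ φ) • D k F τ := by
      rw [eq_inv_smul_iff₀ hE0]
      exact h1
    rw [h3, h4, smul_smul, smul_smul]
    congr 1
    have h5 : τ * aeval x⁻¹ φ = x⁻¹ * τ⁻¹ := by
      rw [eq_mul_inv_iff_mul_eq₀ hτ0]
      conv_rhs => rw [h.inv_eq]
      ring
    rw [mul_assoc 2, h5]
    field_simp
  have hω' : ω = (-(2 * x * τ⁻¹ * E⁻¹) / (y * z ^ m)) • D k F τ := by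
    rw [div_eq_inv_mul, mul_smul, ← hDx, hω, inv_smul_smul₀ (mul_ne_zero hy0 (pow_ne_zero _ hz0))]
  rw [hω', smul_smul, P.smul_mem_span_singleton hne, ← P.valuation_le_one_iff]
  have hv2 : P.ring.valuation (2 : F) = 1 := by
    have := P.valuation_algebraMap h2
    rwa [map_ofNat] at this
  rw [map_mul, map_div₀, Valuation.map_neg, map_mul, map_mul, map_mul, map_mul, map_pow, hv2,
    map_inv₀ _ E, hE1, hvy, hvz, h.valuation_x hx, map_inv₀]
  set T := (P.ring.valuation τ)⁻¹ with hTdef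
  -- Relative to `dτ`, `dx` has a pole of order `3` and `y zᵐ` one of order `2 g + 1 + (i + 2 j) m =
  -- N + 3`, so `ω` is `τ ^ N dτ` up to a unit.
  have h6 : 1 * T ^ 2 * T * 1⁻¹ / (T ^ (2 * g + 1) * (T ^ (i + 2 * j)) ^ m) = (T ^ N)⁻¹ := by
    rw [← pow_mul, ← pow_add, show 2 * g + 1 + (i + 2 * j) * m = N + 3 by omega, pow_add]
    field_simp
  rw [h6, ← div_eq_mul_inv, div_le_one₀ (pow_pos (zero_lt_one.trans hT) N)]

end IsTowerAtInfinity

end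

end GenusFour

namespace GenusFour

open KaehlerDifferential Polynomial

/-! ### Functions with bounded poles, and smooth affine charts. -/

section

variable {k : Type*} {F : Type*} [Field k] [Field F] [Algebra k F] {f p l φ G₀ G₁ : k[X]}
  {m g i j : ℕ} {x y z : F}

/-- An integrally closed subalgebra is an intersection of local rings of places. -/
theorem mem_of_forall_place (A : Subalgebra k F) [IsIntegrallyClosed A] [IsFractionRing A F]
    {c : F} (h : ∀ P : Place k F, (∀ a : A, (a : F) ∈ P.ring) → c ∈ P.ring) : c ∈ A := by
  by_contra hc
  have : IsIntegrallyClosedIn A.toSubring F :=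
    inferInstanceAs (IsIntegrallyClosedIn A F)
  obtain ⟨V, hV, hcV⟩ := Subring.exists_le_valuationSubring_of_isIntegrallyClosedIn
    (R := A.toSubring) hc
  refine hcV (h ⟨V, fun c => hV (A.algebraMap_mem c), ?_⟩ fun a => hV a.2)
  rintro rfl
  exact hcV (ValuationSubring.mem_top _)

/-- The components of an element of a subspace stable under `z ↦ ζ z` are in the subspace. -/
theorem IsTower.component_mem (ht : IsTower f p l m x y z) (hm : ((m + 1 : ℕ) : k) ≠ 0) {ζ : k}
    (hζ : IsPrimitiveRoot ζ (m + 1)) (S : Submodule k F)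
    (hS : ∀ (σ : F ≃ₐ[k] F) (ξ : k), ξ ≠ 0 → σ x = x → σ y = y → σ z = algebraMap k F ξ * z →
      ∀ c ∈ S, σ c ∈ S) {a b : ℕ → k[X]} (hab : towerSum m x y z a b ∈ S) {j : ℕ} (hj : j ≤ m) :
    (aeval x (a j) + aeval x (b j) * y) * z ^ j ∈ S := by
  have hζ0 : ζ ≠ 0 := hζ.ne_zero m.succ_ne_zero
  have hz1 : ∀ n : ℕ, (ζ ^ n) ^ (m + 1) = 1 := fun n => by
    rw [← pow_mul, mul_comm, pow_mul, hζ.pow_eq_one, one_pow]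
  choose σ hx hy hz using fun n : ℕ => ht.exists_algEquiv (hz1 n)
  have h1 : ∀ n, σ n (towerSum m x y z a b) = ∑ r ∈ Finset.range (m + 1),
      (ζ ^ r) ^ n • ((aeval x (a r) + aeval x (b r) * y) * z ^ r) := fun n => by
    have := towerSum_map (m := m) (σ n : F →ₐ[k] F) x y z a b
    change σ n (towerSum m x y z a b) = towerSum m (σ n x) (σ n y) (σ n z) a b at this
    rw [this, hx, hy, hz]
    refine Finset.sum_congr rfl fun r _ => ?_
    rw [Algebra.smul_def, mul_pow, ← map_pow, ← pow_mul, ← pow_mul, mul_comm n r]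
    ring
  -- Fourier inversion on the cyclic group: summing the conjugates against the character `n ↦ ζ ^
  -- (-j n)` isolates `m + 1` times the component at `zʲ`. The exponent `m + 1 - j` stands for `-j`.
  have h2 : ∑ n ∈ Finset.range (m + 1), (ζ ^ (m + 1 - j)) ^ n • σ n (towerSum m x y z a b) ∈ S :=
    Submodule.sum_mem _ fun n _ => S.smul_mem _
      (hS _ _ (pow_ne_zero n hζ0) (hx n) (hy n) (hz n) _ hab)
  have h3 : ∑ n ∈ Finset.range (m + 1), (ζ ^ (m + 1 - j)) ^ n • σ n (towerSum m x y z a b) =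
      ((m + 1 : ℕ) : k) • ((aeval x (a j) + aeval x (b j) * y) * z ^ j) := by
    simp_rw [h1, Finset.smul_sum, smul_smul, ← mul_pow, ← pow_add]
    rw [Finset.sum_comm]
    simp_rw [← Finset.sum_smul]
    rw [Finset.sum_eq_single j]
    · congr 1
      rw [show m + 1 - j + j = m + 1 by omega, hζ.pow_eq_one]
      simp
    · intro r hr hrj
      rw [Finset.mem_range] at hr
      have hne : ζ ^ (m + 1 - j + r) ≠ 1 := by
        rw [Ne, hζ.pow_eq_one_iff_dvd]
        rintro ⟨q, hq⟩
        have hq1 : q < 2 := by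
          by_contra hq2
          have : (m + 1) * 2 ≤ (m + 1) * q := Nat.mul_le_mul_left _ (by omega)
          omega
        interval_cases q <;> omega
      have := geom_sum_mul (ζ ^ (m + 1 - j + r)) (m + 1)
      rw [hz1, sub_self] at this
      rw [(mul_eq_zero.1 this).resolve_right (sub_ne_zero.2 hne), zero_smul]
    · intro hj'
      exact absurd (Finset.mem_range.2 (by omega)) hj'
  rw [h3] at h2
  have := S.smul_mem ((m + 1 : ℕ) : k)⁻¹ h2
  rwa [smul_smul, inv_mul_cancel₀ hm, one_smul] at this

/-- Membership in the local ring, unlike a comparison of valuations, is directly transported by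
`Place.comap`. -/
theorem Place.sq_le_iff (P : Place k F) (hx : x ≠ 0) (c : F) (N : ℕ) :
    P.ring.valuation c ^ 2 ≤ P.ring.valuation x ^ N ↔ c ^ 2 / x ^ N ∈ P.ring := by
  have h0 : P.ring.valuation x ≠ 0 := (Valuation.ne_zero_iff _).2 hx
  rw [← P.ring.valuation_le_one_iff, map_div₀, map_pow, map_pow,
    div_le_one₀ (pow_pos (zero_lt_iff.2 h0) N)]

/-- Functions that are regular where `x` is, and whose order at a pole of `x` is at most `N / 2`
times the order of the pole of `x`. -/
def polesLE (k : Type*) {F : Type*} [Field k] [Field F] [Algebra k F] (x : F) (N : ℕ) :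
    Submodule k F where
  carrier := {c | (∀ P : Place k F, x ∈ P.ring → c ∈ P.ring) ∧
    ∀ P : Place k F, x ∉ P.ring → P.ring.valuation c ^ 2 ≤ P.ring.valuation x ^ N}
  zero_mem' := ⟨fun P _ => P.ring.zero_mem, fun P _ => by simp⟩
  add_mem' := by
    rintro c d ⟨hc, hc'⟩ ⟨hd, hd'⟩
    refine ⟨fun P hP => add_mem (hc P hP) (hd P hP), fun P hP => ?_⟩
    rcases le_max_iff.1 (P.ring.valuation.map_add c d) with h | h
    · exact (pow_le_pow_left₀ zero_le h 2).trans (hc' P hP)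
    · exact (pow_le_pow_left₀ zero_le h 2).trans (hd' P hP)
  smul_mem' := by
    rintro r c ⟨hc, hc'⟩
    refine ⟨fun P hP => ?_, fun P hP => ?_⟩
    · rw [Algebra.smul_def]
      exact mul_mem (P.algebraMap_mem r) (hc P hP)
    · rw [Algebra.smul_def, map_mul, mul_pow]
      refine le_trans (mul_le_of_le_one_left' (pow_le_one' ?_ 2)) (hc' P hP)
      exact (P.valuation_le_one_iff _).2 (P.algebraMap_mem r)

theorem map_mem_polesLE (hx : x ≠ 0) {N : ℕ} {σ : F ≃ₐ[k] F} (hσ : σ x = x) {c : F}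
    (hc : c ∈ polesLE k x N) : σ c ∈ polesLE k x N := by
  refine ⟨fun P hP => ?_, fun P hP => ?_⟩
  · exact hc.1 (P.comap σ) (by rwa [Place.mem_comap, hσ])
  · have h1 := hc.2 (P.comap σ) (by rwa [Place.mem_comap, hσ])
    rw [Place.sq_le_iff _ hx, Place.mem_comap, map_div₀, map_pow, map_pow, hσ] at h1
    exact (P.sq_le_iff hx _ _).2 h1

theorem IsTowerAtInfinity.valuation_le_iff {τ w : F}
    (h : IsTowerAtInfinity φ G₀ G₁ g i j m x y z τ w) {P : Place k F} (hx : x ∉ P.ring) (c : F)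
    (N : ℕ) : P.ring.valuation c ^ 2 ≤ P.ring.valuation x ^ N ↔
      P.ring.valuation c ≤ (P.ring.valuation τ)⁻¹ ^ N := by
  rw [h.valuation_x hx, ← pow_mul, mul_comm, pow_mul]
  exact pow_le_pow_iff_left₀ zero_le zero_le two_ne_zero

/-- The order at infinity of the components of a function. -/
theorem IsTowerAtInfinity.degree_le {τ w : F} (h : IsTowerAtInfinity φ G₀ G₁ g i j m x y z τ w)
    (ht : IsTower f p l m x y z) {a b : k[X]} {r N e : ℕ}
    (hab : (aeval x a + aeval x b * y) * z ^ r ∈ polesLE k x N) (hN : N ≤ (i + 2 * j) * r + e) :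
    (a = 0 ∨ 2 * a.natDegree ≤ e) ∧ (b = 0 ∨ 2 * b.natDegree + (2 * g + 1) ≤ e) := by
  obtain ⟨P, hP⟩ := exists_place_not_mem ht.transcendental
  have hT := h.one_lt_inv_valuation_tau hP
  apply h.valuation_add_le hP
  have h1 := (h.valuation_le_iff hP _ _).1 (hab.2 P hP)
  rw [map_mul, map_pow, h.valuation_z hP, ← pow_mul] at h1
  have h2 := h1.trans ((pow_le_pow_iff_right₀ hT).2 hN)
  rw [add_comm ((i + 2 * j) * r), pow_add] at h2
  exact le_of_mul_le_mul_right h2 (pow_pos (zero_lt_one.trans hT) _)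

/-- Generators of the coordinate ring of the part of the affine curve where `u(x) ≠ 0`. -/
def affineChart (u : k[X]) (x y z : F) : Set F := {x, y, z, (aeval x u)⁻¹}

theorem affineChart_finiteType (u : k[X]) :
    Algebra.FiniteType k (Algebra.adjoin k (affineChart u x y z)) :=
  Subalgebra.fg_iff_finiteType _ |>.1 <| Subalgebra.fg_def.2
    ⟨_, by unfold affineChart; exact Set.toFinite _, rfl⟩

theorem IsTower.affineChart_isFractionRing (ht : IsTower f p l m x y z) (u : k[X]) :
    IsFractionRing (Algebra.adjoin k (affineChart u x y z)) F := by
  refine isFractionRing_of_adjoin_eq_top ht.adjoin_eq_top _ ?_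
  rintro t (ht' | ht' | ht') <;> rw [ht'] <;>
    exact Algebra.subset_adjoin (by simp [affineChart])

theorem IsTower.affineChart_le (ht : IsTower f p l m x y z) {u : k[X]} {P : Place k F}
    (hx : x ∈ P.ring) (hu : P.ring.valuation (aeval x u) = 1)
    (a : Algebra.adjoin k (affineChart u x y z)) : (a : F) ∈ P.ring := by
  let S : Subalgebra k F := { P.ring.toSubring with algebraMap_mem' := P.algebraMap_mem }
  have : Algebra.adjoin k (affineChart u x y z) ≤ S := by
    rw [Algebra.adjoin_le_iff]
    rintro t (ht' | ht' | ht' | ht') <;> rw [ht']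
    · exact hx
    · exact (ht.mem_places_affine hx).1
    · exact (ht.mem_places_affine hx).2
    · show _ ∈ P.ring
      rw [← P.valuation_le_one_iff, map_inv₀, hu, inv_one]
  exact this a.2

/-- Certificates for smoothness of the part of the affine curve where `u(x) ≠ 0`. -/
structure IsSmoothAway (f p l u : k[X]) : Prop where
  base : ∃ α β : k[X], α * f + β * derivative f = 1
  top : ∃ (a b c d : k[X]) (N : ℕ),
    a * p + b * l * f + c * (2 * derivative l * f + l * derivative f) +
      2 * d * derivative p * f = u ^ N ∧
    a * l + b * p + 2 * c * derivative p + d * (2 * derivative l * f + l * derivative f) = 0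

/-- The differential `dx / (y zᵐ)` generates the differentials of a smooth affine curve. -/
theorem IsTower.exists_affineChart_span (ht : IsTower f p l m x y z) {u : k[X]} (hu : u ≠ 0)
    (h2 : (2 : k) ≠ 0) (hm : ((m + 1 : ℕ) : k) ≠ 0) (hs : IsSmoothAway f p l u) :
    ∃ ω : Ω[Algebra.adjoin k (affineChart u x y z)⁄k],
      Submodule.span (Algebra.adjoin k (affineChart u x y z)) {ω} = ⊤ ∧
      D k F x = (y * z ^ m) • KaehlerDifferential.map k k _ F ω := by
  set A := Algebra.adjoin k (affineChart u x y z) with hA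
  let x' : A := ⟨x, Algebra.subset_adjoin (by simp [affineChart])⟩
  let y' : A := ⟨y, Algebra.subset_adjoin (by simp [affineChart])⟩
  let z' : A := ⟨z, Algebra.subset_adjoin (by simp [affineChart])⟩
  let v' : A := ⟨(aeval x u)⁻¹, Algebra.subset_adjoin (by simp [affineChart])⟩
  have hae : ∀ q : k[X], ((aeval x' q : A) : F) = aeval x q := fun q =>
    (Polynomial.aeval_algHom_apply A.val x' q).symm
  have hy : y' ^ 2 = aeval x' f := by
    apply Subtype.ext
    rw [hae, Subalgebra.coe_pow]
    exact ht.sq_eq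
  have hz : z' ^ (m + 1) = aeval x' p + aeval x' l * y' := by
    apply Subtype.ext
    rw [Subalgebra.coe_add, Subalgebra.coe_mul, hae, hae, Subalgebra.coe_pow]
    exact ht.pow_eq
  have hv : aeval x' u * v' = 1 := by
    apply Subtype.ext
    rw [Subalgebra.coe_mul, hae]
    exact mul_inv_cancel₀ (ht.aeval_ne_zero hu)
  obtain ⟨α, β, hαβ⟩ := hs.base
  obtain ⟨a, b, c, d, N, e1, e2⟩ := hs.top
  obtain ⟨η, hx, hdy⟩ := exists_dx_div_y (k := k) hy hαβ
  -- The two identities are the parts without and with `y` of `(a + b y) h + (c + d y) jac = u ^ N`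
  -- after reduction by `y² = f`; so `h` and `jac` have no common zero where `u ≠ 0`.
  have e1' := congrArg (aeval x') e1
  have e2' := congrArg (aeval x') e2
  simp only [map_add, map_mul, map_pow, map_zero, map_ofNat] at e1' e2'
  obtain ⟨ω, hη, hdz⟩ := exists_dx_div_y_mul_pow (k := k) hx hdy hz
    (c := aeval x' a + aeval x' b * y') (d := aeval x' c + aeval x' d * y') (e := v' ^ N) (by
      have h3 : aeval x' u ^ N * v' ^ N = 1 := by rw [← mul_pow, hv, one_pow]
      rw [← h3, ← e1', jac]
      linear_combination v' ^ N * y' * e2' + v' ^ N * (aeval x' b * aeval x' l +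
        2 * aeval x' c * aeval x' (derivative l) + 2 * aeval x' d * aeval x' (derivative p) +
        2 * y' * aeval x' d * aeval x' (derivative l)) * hy)
  have hηm : η ∈ Submodule.span A {ω} := Submodule.mem_span_singleton.2 ⟨_, hη.symm⟩
  have hxm : D k A x' ∈ Submodule.span A {ω} := by
    rw [hx]
    exact Submodule.smul_mem _ _ hηm
  refine ⟨ω, ?_, ?_⟩
  · apply span_kaehler_adjoin_eq_top
    intro t ht'
    rcases ht' with ht' | ht' | ht' | ht' <;> subst ht'
    · exact hxm
    · refine mem_span_of_smul_mem (two_mul_inv h2) ?_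
      exact hdy ▸ Submodule.smul_mem _ _ hηm
    · refine mem_span_of_smul_mem (s := (2 * (m + 1) : A))
        (t := algebraMap k A 2⁻¹ * algebraMap k A ((m + 1 : ℕ) : k)⁻¹) ?_
        (Submodule.mem_span_singleton.2 ⟨_, hdz.symm⟩)
      have h3 := two_mul_inv (A := A) h2
      have h4 := natCast_mul_inv (A := A) hm
      push_cast at h4 ⊢
      linear_combination (((m : A) + 1) * (algebraMap k A) ((m : k) + 1)⁻¹) * h3 + h4
    · exact D_mem_span_of_mul_eq_one hv (D_aeval_mem_span _ hxm)
  · have h3 := congrArg (KaehlerDifferential.map k k A F) hx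
    rw [KaehlerDifferential.map_D, hη, smul_smul, map_smul] at h3
    exact h3

end

end GenusFour

namespace GenusFour

open KaehlerDifferential Polynomial

/-! ### The genus when the affine model is smooth. -/

section

variable {k : Type*} {F : Type*} [Field k] [Field F] [Algebra k F] {f p l φ G₀ G₁ : k[X]}
  {m g i j : ℕ} {x y z : F}

theorem IsTower.exists_differential [PerfectField k] (ht : IsTower f p l m x y z) {u : k[X]}
    (hu : u ≠ 0) (h2 : (2 : k) ≠ 0) (hm : ((m + 1 : ℕ) : k) ≠ 0) (hs : IsSmoothAway f p l u) :
    ∃ ω : Ω[F⁄k], D k F x = (y * z ^ m) • ω ∧ Submodule.span F {ω} = ⊤ ∧ ω ≠ 0 ∧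
      ∀ P : Place k F, x ∈ P.ring → P.ring.valuation (aeval x u) = 1 → ∀ c : F,
        c • ω ∈ Submodule.span P.ring (Set.range fun b : P.ring => D k F (b : F)) ↔
          c ∈ P.ring := by
  obtain ⟨ω, hω, hx⟩ := ht.exists_affineChart_span hu h2 hm hs
  have := ht.affineChart_isFractionRing u
  have : Algebra.FiniteType k (Algebra.adjoin k (affineChart u x y z)) := affineChart_finiteType u
  have := ht.kaehler_nontrivial
  have hspan := span_map_eq_top _ hω
  have hne := ne_zero_of_span_eq_top hspan
  refine ⟨_, hx, hspan, hne, fun P hP hu c => ?_⟩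
  rw [Place.span_eq _ hω P (ht.affineChart_le hP hu), P.smul_mem_span_singleton hne]

theorem IsTower.isIntegrallyClosed_affineChart [PerfectField k] (ht : IsTower f p l m x y z)
    {u : k[X]} (hu : u ≠ 0) (h2 : (2 : k) ≠ 0) (hm : ((m + 1 : ℕ) : k) ≠ 0)
    (hs : IsSmoothAway f p l u) :
    IsIntegrallyClosed (Algebra.adjoin k (affineChart u x y z)) := by
  obtain ⟨ω, hω, -⟩ := ht.exists_affineChart_span hu h2 hm hs
  have : Algebra.FiniteType k (Algebra.adjoin k (affineChart u x y z)) := affineChart_finiteType u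
  exact isIntegrallyClosed_of_kaehler hω

theorem mem_regularDifferentials_iff {ω : Ω[F⁄k]} :
    ω ∈ regularDifferentials k F ↔ ∀ P : Place k F,
      ω ∈ Submodule.span P.ring (Set.range fun b : P.ring => D k F (b : F)) := by
  simp [regularDifferentials, Submodule.mem_iInf]

/-- All differentials are multiples of `ω`, so the regular ones are identified with their
coefficients. -/
theorem genus_eq_finrank {ω : Ω[F⁄k]} (hspan : Submodule.span F {ω} = ⊤) (hne : ω ≠ 0)
    (L : Submodule k F) (hL : ∀ c : F, c • ω ∈ regularDifferentials k F ↔ c ∈ L) :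
    genus k F = Module.finrank k L := by
  let T : L →ₗ[k] regularDifferentials k F :=
    { toFun := fun c => ⟨(c : F) • ω, (hL c).2 c.2⟩
      map_add' := fun c d => Subtype.ext (add_smul _ _ _)
      map_smul' := fun r c => Subtype.ext (smul_assoc r (c : F) ω) }
  refine (LinearEquiv.finrank_eq (LinearEquiv.ofBijective T ⟨fun c d h => ?_, fun η => ?_⟩)).symm
  · exact Subtype.ext (smul_left_injective F hne (congrArg Subtype.val h))
  · obtain ⟨c, hc⟩ := Submodule.mem_span_singleton.1
      (hspan ▸ Submodule.mem_top : (η : Ω[F⁄k]) ∈ Submodule.span F {ω})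
    exact ⟨⟨c, (hL c).1 (hc ▸ η.2)⟩, Subtype.ext hc⟩

/-- With `u = 1` the whole affine curve is smooth and `dx / (y zᵐ)` has neither zeros nor poles on
it; at infinity it is `τ ^ N dτ` up to a unit. -/
theorem IsTower.genus_eq_finrank_polesLE [PerfectField k] {τ w : F}
    (ht : IsTower f p l m x y z) (h : IsTowerAtInfinity φ G₀ G₁ g i j m x y z τ w)
    (h2 : (2 : k) ≠ 0) (hm : ((m + 1 : ℕ) : k) ≠ 0) (hs : IsSmoothAway f p l 1)
    {N : ℕ} (hN : N + 2 = 2 * g + (i + 2 * j) * m) :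
    genus k F = Module.finrank k (polesLE k x N) := by
  obtain ⟨ω, hx, hspan, hne, hω⟩ := ht.exists_differential one_ne_zero h2 hm hs
  refine genus_eq_finrank hspan hne _ fun c => ?_
  rw [mem_regularDifferentials_iff]
  constructor
  · refine fun hc => ⟨fun P hP => (hω P hP (by simp) c).1 (hc P), fun P hP => ?_⟩
    exact (h.valuation_le_iff hP c N).2 ((h.mem_span_iff ht h2 hm hN hx hP c).1 (hc P))
  · rintro ⟨h1, h3⟩ P
    by_cases hP : x ∈ P.ring
    · exact (hω P hP (by simp) c).2 (h1 P hP)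
    · exact (h.mem_span_iff ht h2 hm hN hx hP c).2 ((h.valuation_le_iff hP c N).1 (h3 P hP))

/-- The affine coordinate ring is integrally closed, hence the intersection of the local rings at
the finite places. -/
theorem IsTower.exists_towerSum [PerfectField k] (ht : IsTower f p l m x y z)
    (h2 : (2 : k) ≠ 0) (hm : ((m + 1 : ℕ) : k) ≠ 0) (hs : IsSmoothAway f p l 1) {c : F}
    (hc : ∀ P : Place k F, x ∈ P.ring → c ∈ P.ring) : ∃ a b : ℕ → k[X], c = towerSum m x y z a b := by
  have := ht.isIntegrallyClosed_affineChart (one_ne_zero (α := k[X])) h2 hm hs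
  have := ht.affineChart_isFractionRing (1 : k[X])
  have hmem : c ∈ Algebra.adjoin k (affineChart (1 : k[X]) x y z) := 
    mem_of_forall_place (k := k) _ fun P hP =>
    hc P (hP ⟨x, Algebra.subset_adjoin (by simp [affineChart])⟩)
  refine exists_eq_towerSum ht.sq_eq ht.pow_eq ?_
  refine (Algebra.adjoin_le ?_ : Algebra.adjoin k (affineChart (1 : k[X]) x y z) ≤ _) hmem
  rintro t (ht' | ht' | ht' | ht') <;> rw [ht']
  · exact Algebra.subset_adjoin (by simp)
  · exact Algebra.subset_adjoin (by simp)
  · exact Algebra.subset_adjoin (by simp)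
  · simp

theorem IsTower.component_mem_polesLE (ht : IsTower f p l m x y z) (hm : ((m + 1 : ℕ) : k) ≠ 0)
    {ζ : k} (hζ : IsPrimitiveRoot ζ (m + 1)) {N : ℕ} {a b : ℕ → k[X]}
    (hab : towerSum m x y z a b ∈ polesLE k x N) {r : ℕ} (hr : r ≤ m) :
    (aeval x (a r) + aeval x (b r) * y) * z ^ r ∈ polesLE k x N :=
  ht.component_mem hm hζ _ (fun _ _ _ hx _ _ _ hc => map_mem_polesLE ht.x_ne_zero hx hc) hab hr

theorem aeval_eq_of_natDegree_eq_zero {a : k[X]} (h : a.natDegree = 0) :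
    aeval x a = a.coeff 0 • (1 : F) := by
  conv_lhs => rw [Polynomial.eq_C_of_natDegree_eq_zero h]
  rw [aeval_C, Algebra.smul_def, mul_one]

theorem aeval_eq_of_natDegree_le_one {a : k[X]} (h : a.natDegree ≤ 1) :
    aeval x a = a.coeff 0 • (1 : F) + a.coeff 1 • x := by
  conv_lhs => rw [Polynomial.eq_X_add_C_of_natDegree_le_one h]
  rw [map_add, map_mul, aeval_C, aeval_C, aeval_X, Algebra.smul_def, Algebra.smul_def, mul_one,
    add_comm]

theorem natDegree_le_of_or {a : k[X]} {n e : ℕ} (h : a = 0 ∨ 2 * a.natDegree ≤ e)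
    (he : e < 2 * (n + 1)) : a.natDegree ≤ n := by
  rcases h with rfl | h
  · simp
  · omega

theorem IsTower.mem_polesLE (ht : IsTower f p l m x y z) {τ w : F}
    (h : IsTowerAtInfinity φ G₀ G₁ g i j m x y z τ w) {c : F} {N n : ℕ} (hn : n ≤ N)
    (hc : c ∈ Algebra.adjoin k {x, y, z})
    (hv : ∀ P : Place k F, x ∉ P.ring → P.ring.valuation c = (P.ring.valuation τ)⁻¹ ^ n) :
    c ∈ polesLE k x N := by
  refine ⟨fun P hP => ?_, fun P hP => ?_⟩
  · let S : Subalgebra k F := { P.ring.toSubring with algebraMap_mem' := P.algebraMap_mem }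
    refine (Algebra.adjoin_le (S := S) ?_) hc
    rintro t (ht' | ht' | ht') <;> rw [ht']
    · exact hP
    · exact (ht.mem_places_affine hP).1
    · exact (ht.mem_places_affine hP).2
  · rw [h.valuation_le_iff hP, hv P hP]
    exact pow_le_pow_right₀ (h.one_lt_inv_valuation_tau hP).le hn

theorem isPrimitiveRoot_neg_one (h2 : (2 : k) ≠ 0) : IsPrimitiveRoot (-1 : k) 2 := by
  refine IsPrimitiveRoot.iff_def _ _ |>.2 ⟨by norm_num, fun n hn => ?_⟩
  rcases Nat.even_or_odd n with he | ho
  · exact he.two_dvd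
  · rw [ho.neg_one_pow] at hn
    exact absurd (by linear_combination -hn : (2 : k) = 0) h2

/-- A double cover of an elliptic curve with `h` of order six at infinity. -/
theorem finrank_polesLE_three [PerfectField k] {τ w : F} (ht : IsTower f p l 1 x y z)
    (h : IsTowerAtInfinity φ G₀ G₁ 1 i j 1 x y z τ w) (hij : i + 2 * j = 3)
    (h2 : (2 : k) ≠ 0) (hs : IsSmoothAway f p l 1) :
    Module.finrank k (polesLE k x 3) = 4 := by
  have hm : ((1 + 1 : ℕ) : k) ≠ 0 := by exact_mod_cast h2
  have hζ := isPrimitiveRoot_neg_one h2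
  have hind : LinearIndependent k ![1, x, y, z] := by
    rw [Fintype.linearIndependent_iff]
    intro c hc
    have h1 := ht.indep (fun r => if r = 0 then C (c 0) + C (c 1) * X else C (c 3))
      (fun r => if r = 0 then C (c 2) else 0) (by
        rw [← hc]
        simp [towerSum, Finset.sum_range_succ, Fin.sum_univ_four, Algebra.smul_def])
    have h3 := h1 0 (by norm_num)
    have h4 := h1 1 le_rfl
    simp only [if_true, one_ne_zero, if_false, C_eq_zero] at h3 h4
    have h5 := congrArg (fun q => coeff q 0) h3.1
    have h6 := congrArg (fun q => coeff q 1) h3.1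
    simp at h5 h6
    intro r
    fin_cases r
    · exact h5
    · exact h6
    · exact h3.2
    · exact h4.1
  have heq : polesLE k x 3 = Submodule.span k (Set.range ![1, x, y, z]) := by
    apply le_antisymm
    · intro c hc
      obtain ⟨a, b, rfl⟩ := ht.exists_towerSum h2 hm hs hc.1
      have hc0 := ht.component_mem_polesLE hm hζ hc (r := 0) (by norm_num)
      have hc1 := ht.component_mem_polesLE hm hζ hc (r := 1) le_rfl
      -- `e` is the pole order left for the coefficient of `z ^ r`: all of `3` for `r = 0`, and
      -- nothing for `r = 1` because `z` has order `3`. As `x` has order `2` and `y` order `3`, only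
      -- `1, x, y` and `z` remain.
      obtain ⟨ha0, hb0⟩ := h.degree_le ht hc0 (e := 3) (by omega)
      obtain ⟨ha1, hb1⟩ := h.degree_le ht hc1 (e := 0) (by omega)
      have hb0' : (b 0).natDegree = 0 := by
        rcases hb0 with hb | hb
        · rw [hb]; simp
        · omega
      have hb1' : b 1 = 0 := hb1.resolve_right (by omega)
      rw [towerSum, Finset.sum_range_succ, Finset.sum_range_one,
        aeval_eq_of_natDegree_le_one (natDegree_le_of_or ha0 (by norm_num)),
        aeval_eq_of_natDegree_eq_zero hb0',
        aeval_eq_of_natDegree_eq_zero (Nat.le_zero.1 (natDegree_le_of_or ha1 (by norm_num))), hb1']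
      have hsub := Submodule.subset_span (R := k) (s := Set.range ![1, x, y, z])
      have e0 := hsub ⟨0, rfl⟩
      have e1 := hsub ⟨1, rfl⟩
      have e2 := hsub ⟨2, rfl⟩
      have e3 := hsub ⟨3, rfl⟩
      simp only [pow_zero, mul_one, pow_one, map_zero, zero_mul, add_zero, smul_mul_assoc, one_mul]
      exact add_mem (add_mem (add_mem (Submodule.smul_mem _ _ e0) (Submodule.smul_mem _ _ e1))
        (Submodule.smul_mem _ _ e2)) (Submodule.smul_mem _ _ e3)
    · rw [Submodule.span_le]
      have hsub := Algebra.subset_adjoin (R := k) (s := {x, y, z})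
      rintro _ ⟨r, rfl⟩
      fin_cases r
      · exact ht.mem_polesLE h (n := 0) (by norm_num) (one_mem _) fun P _ => by simp
      · exact ht.mem_polesLE h (n := 2) (by norm_num) (hsub (by simp)) fun P hP => h.valuation_x hP
      · exact ht.mem_polesLE h (n := 3) (by norm_num) (hsub (by simp)) fun P hP => h.valuation_y hP
      · exact ht.mem_polesLE h (n := 3) (by norm_num) (hsub (by simp)) fun P hP =>
          hij ▸ h.valuation_z hP
  rw [heq, finrank_span_eq_card hind, Fintype.card_fin]

/-- A cyclic cubic cover of an elliptic curve with `h` of order three at infinity. -/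
theorem finrank_polesLE_two [PerfectField k] {τ w : F} (ht : IsTower f p l 2 x y z)
    (h : IsTowerAtInfinity φ G₀ G₁ 1 i j 2 x y z τ w) (hij : i + 2 * j = 1)
    (h2 : (2 : k) ≠ 0) (h3 : (3 : k) ≠ 0) {ζ : k} (hζ : IsPrimitiveRoot ζ 3)
    (hs : IsSmoothAway f p l 1) : Module.finrank k (polesLE k x 2) = 4 := by
  have hm : ((2 + 1 : ℕ) : k) ≠ 0 := by exact_mod_cast h3
  have hind : LinearIndependent k ![1, x, z, z ^ 2] := by
    rw [Fintype.linearIndependent_iff]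
    intro c hc
    have h1 := ht.indep (fun r => if r = 0 then C (c 0) + C (c 1) * X else
        if r = 1 then C (c 2) else C (c 3)) 0 (by
        rw [← hc]
        simp [towerSum, Finset.sum_range_succ, Fin.sum_univ_four, Algebra.smul_def])
    have h3 := (h1 0 (by norm_num)).1
    have h4 := (h1 1 (by norm_num)).1
    have h4' := (h1 2 le_rfl).1
    simp only [if_true, one_ne_zero, if_false, C_eq_zero, OfNat.ofNat_ne_zero,
      OfNat.ofNat_ne_one] at h3 h4 h4'
    have h5 := congrArg (fun q => coeff q 0) h3
    have h6 := congrArg (fun q => coeff q 1) h3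
    simp at h5 h6
    intro r
    fin_cases r
    · exact h5
    · exact h6
    · exact h4
    · exact h4'
  have heq : polesLE k x 2 = Submodule.span k (Set.range ![1, x, z, z ^ 2]) := by
    apply le_antisymm
    · intro c hc
      obtain ⟨a, b, rfl⟩ := ht.exists_towerSum h2 hm hs hc.1
      have hc0 := ht.component_mem_polesLE hm hζ hc (r := 0) (by norm_num)
      have hc1 := ht.component_mem_polesLE hm hζ hc (r := 1) (by norm_num)
      have hc2 := ht.component_mem_polesLE hm hζ hc (r := 2) le_rfl
      -- Here `z` has order `1`, which leaves orders `2, 1, 0` for the coefficients of `1, z, z²`;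
      -- `y` has order `3` and cannot occur.
      obtain ⟨ha0, hb0⟩ := h.degree_le ht hc0 (e := 2) (by omega)
      obtain ⟨ha1, hb1⟩ := h.degree_le ht hc1 (e := 1) (by omega)
      obtain ⟨ha2, hb2⟩ := h.degree_le ht hc2 (e := 0) (by omega)
      have hb0' : b 0 = 0 := hb0.resolve_right (by omega)
      have hb1' : b 1 = 0 := hb1.resolve_right (by omega)
      have hb2' : b 2 = 0 := hb2.resolve_right (by omega)
      rw [towerSum, Finset.sum_range_succ, Finset.sum_range_succ, Finset.sum_range_one,
        aeval_eq_of_natDegree_le_one (natDegree_le_of_or ha0 (by norm_num)),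
        aeval_eq_of_natDegree_eq_zero (Nat.le_zero.1 (natDegree_le_of_or ha1 (by norm_num))),
        aeval_eq_of_natDegree_eq_zero (Nat.le_zero.1 (natDegree_le_of_or ha2 (by norm_num))),
        hb0', hb1', hb2']
      have hsub := Submodule.subset_span (R := k) (s := Set.range ![1, x, z, z ^ 2])
      have e0 := hsub ⟨0, rfl⟩
      have e1 := hsub ⟨1, rfl⟩
      have e2 := hsub ⟨2, rfl⟩
      have e3 := hsub ⟨3, rfl⟩
      simp only [pow_zero, mul_one, pow_one, map_zero, zero_mul, add_zero, smul_mul_assoc, one_mul]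
      exact add_mem (add_mem (add_mem (Submodule.smul_mem _ _ e0) (Submodule.smul_mem _ _ e1))
        (Submodule.smul_mem _ _ e2)) (Submodule.smul_mem _ _ e3)
    · rw [Submodule.span_le]
      have hsub := Algebra.subset_adjoin (R := k) (s := {x, y, z})
      rintro _ ⟨r, rfl⟩
      fin_cases r
      · exact ht.mem_polesLE h (n := 0) (by norm_num) (one_mem _) fun P _ => by simp
      · exact ht.mem_polesLE h (n := 2) (by norm_num) (hsub (by simp)) fun P hP => h.valuation_x hP
      · exact ht.mem_polesLE h (n := 1) (by norm_num) (hsub (by simp)) fun P hP =>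
          hij ▸ h.valuation_z hP
      · exact ht.mem_polesLE h (n := 2) (by norm_num) (pow_mem (hsub (by simp)) 2) fun P hP => by
          show P.ring.valuation (z ^ 2) = _
          rw [map_pow, h.valuation_z hP, hij, pow_one]
  rw [heq, finrank_span_eq_card hind, Fintype.card_fin]

end

end GenusFour

namespace GenusFour

open KaehlerDifferential Polynomial

/-! ### Places of degree one. -/

section

variable {k : Type*} {F : Type*} [Field k] [Field F] [Algebra k F]

theorem Place.surjective_algebraMap_iff {P : Place k F} :
    Function.Surjective (algebraMap k (IsLocalRing.ResidueField P.ring)) ↔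
      ∀ b ∈ P.ring, ∃ c : k, P.ring.valuation (b - algebraMap k F c) < 1 := by
  have key : ∀ (b : P.ring) (c : k), algebraMap k (IsLocalRing.ResidueField P.ring) c =
      IsLocalRing.residue P.ring b ↔ P.ring.valuation ((b : F) - algebraMap k F c) < 1 := by
    intro b c
    rw [IsScalarTower.algebraMap_apply k P.ring (IsLocalRing.ResidueField P.ring), eq_comm]
    change IsLocalRing.residue P.ring b = IsLocalRing.residue P.ring _ ↔ _
    rw [← sub_eq_zero, ← map_sub, IsLocalRing.residue_eq_zero_iff,
      ValuationSubring.valuation_lt_one_iff]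
    rfl
  constructor
  · intro h b hb
    obtain ⟨c, hc⟩ := h (IsLocalRing.residue P.ring ⟨b, hb⟩)
    exact ⟨c, (key ⟨b, hb⟩ c).1 hc⟩
  · intro h r
    obtain ⟨b, rfl⟩ := IsLocalRing.residue_surjective r
    obtain ⟨c, hc⟩ := h b b.2
    exact ⟨c, (key b c).2 hc⟩

theorem Place.mem_of_valuation_sub_lt {P : Place k F} {b : F} {c : k}
    (h : P.ring.valuation (b - algebraMap k F c) < 1) : b ∈ P.ring := by
  have := add_mem ((P.valuation_le_one_iff _).1 h.le) (P.algebraMap_mem c)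
  rwa [sub_add_cancel] at this

theorem Place.valuation_eq_one_iff_of_sub_lt {P : Place k F} {b : F} {c : k}
    (h : P.ring.valuation (b - algebraMap k F c) < 1) : P.ring.valuation b = 1 ↔ c ≠ 0 := by
  constructor
  · rintro hb rfl
    rw [map_zero, sub_zero, hb] at h
    exact lt_irrefl _ h
  · intro hc
    rw [← P.valuation_algebraMap hc]
    exact Valuation.map_eq_of_sub_lt _ (by rwa [P.valuation_algebraMap hc])

theorem Place.eq_of_valuation_sub_lt {P : Place k F} {b : F} {c d : k}
    (hc : P.ring.valuation (b - algebraMap k F c) < 1)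
    (hd : P.ring.valuation (b - algebraMap k F d) < 1) : c = d := by
  by_contra hne
  have h1 := Valuation.map_sub_lt _ hd hc
  rw [sub_sub_sub_cancel_left, ← map_sub, P.valuation_algebraMap (sub_ne_zero.2 hne)] at h1
  exact lt_irrefl _ h1

/-- At a place of degree one every algebraic element is constant. -/
theorem Place.constants {P : Place k F}
    (hP : Function.Surjective (algebraMap k (IsLocalRing.ResidueField P.ring))) {a : F}
    (ha : IsAlgebraic k a) : a ∈ Set.range (algebraMap k F) := by
  have hmem : ∀ b : F, IsAlgebraic k b → b ∈ P.ring := fun b hb => by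
    let S : Subalgebra k F := { P.ring.toSubring with algebraMap_mem' := P.algebraMap_mem }
    have : IsIntegral P.ring b := hb.isIntegral.tower_top
    obtain ⟨c, hc⟩ := IsIntegrallyClosed.isIntegral_iff.1 this
    exact hc ▸ c.2
  obtain ⟨c, hc⟩ := Place.surjective_algebraMap_iff.1 hP a (hmem a ha)
  refine ⟨c, ?_⟩
  by_contra hne
  have h0 : a - algebraMap k F c ≠ 0 := sub_ne_zero.2 (Ne.symm hne)
  have h1 := (P.valuation_le_one_iff _).2 (hmem _ (ha.sub (isAlgebraic_algebraMap c)).inv)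
  rw [map_inv₀, inv_le_one₀ (zero_lt_iff.2 ((Valuation.ne_zero_iff _).2 h0))] at h1
  exact absurd hc h1.not_gt

/-- The functions that take the same value, lying in `k`, at two places. -/
def Place.agree (P Q : Place k F) : Subalgebra k F where
  carrier := {b | ∃ c : k, P.ring.valuation (b - algebraMap k F c) < 1 ∧
    Q.ring.valuation (b - algebraMap k F c) < 1}
  algebraMap_mem' c := ⟨c, by simp, by simp⟩
  add_mem' := by
    rintro a b ⟨c, h1, h2⟩ ⟨d, h3, h4⟩
    refine ⟨c + d, ?_, ?_⟩ <;> rw [map_add, add_sub_add_comm]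
    · exact Valuation.map_add_lt _ h1 h3
    · exact Valuation.map_add_lt _ h2 h4
  mul_mem' := by
    have key : ∀ (R : Place k F) (a b : F) (c d : k),
        R.ring.valuation (a - algebraMap k F c) < 1 →
        R.ring.valuation (b - algebraMap k F d) < 1 →
        R.ring.valuation (a * b - algebraMap k F (c * d)) < 1 := by
      intro R a b c d h1 h2
      have : a * b - algebraMap k F (c * d) =
          a * (b - algebraMap k F d) + algebraMap k F d * (a - algebraMap k F c) := by
        rw [map_mul]; ring
      rw [this]
      refine Valuation.map_add_lt _ ?_ ?_ <;> rw [map_mul, mul_comm]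
      · exact mul_lt_one_of_lt_of_le h2 ((R.valuation_le_one_iff _).2
          (Place.mem_of_valuation_sub_lt h1))
      · exact mul_lt_one_of_lt_of_le h1 ((R.valuation_le_one_iff _).2 (R.algebraMap_mem d))
    rintro a b ⟨c, h1, h2⟩ ⟨d, h3, h4⟩
    exact ⟨c * d, key P a b c d h1 h3, key Q a b c d h2 h4⟩

theorem Place.inv_mem_agree {P Q : Place k F} {b : F} (hb : b ∈ P.agree Q)
    (h1 : P.ring.valuation b = 1) : b⁻¹ ∈ P.agree Q := by
  obtain ⟨c, hP, hQ⟩ := hb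
  have hc := (Place.valuation_eq_one_iff_of_sub_lt hP).1 h1
  have h2 := (Place.valuation_eq_one_iff_of_sub_lt hQ).2 hc
  have hc' : algebraMap k F c ≠ 0 := (_root_.map_ne_zero _).2 hc
  have hb' : b ≠ 0 := (Valuation.ne_zero_iff _).1 (h1 ▸ one_ne_zero)
  have key : b⁻¹ - algebraMap k F c⁻¹ =
      -(b⁻¹ * (algebraMap k F c)⁻¹ * (b - algebraMap k F c)) := by
    rw [map_inv₀]; field_simp; ring
  refine ⟨c⁻¹, ?_, ?_⟩ <;> rw [key, Valuation.map_neg, map_mul, map_mul, map_inv₀, map_inv₀]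
  · rwa [h1, P.valuation_algebraMap hc, inv_one, one_mul, one_mul]
  · rwa [h2, Q.valuation_algebraMap hc, inv_one, one_mul, one_mul]

theorem Place.valuation_aeval_sub_lt {P : Place k F} {b : F} {c : k}
    (hP : P.ring.valuation (b - algebraMap k F c) < 1) (q : k[X]) :
    P.ring.valuation (aeval b q - algebraMap k F (q.eval c)) < 1 := by
  obtain ⟨r, hr⟩ := Polynomial.X_sub_C_dvd_sub_C_eval (a := c) (p := q)
  have h1 := congrArg (aeval b) hr
  rw [map_sub, map_mul, map_sub, aeval_X, aeval_C, aeval_C] at h1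
  rw [h1, map_mul]
  exact mul_lt_one_of_lt_of_le hP
    ((P.valuation_le_one_iff _).2 (P.aeval_mem (Place.mem_of_valuation_sub_lt hP) _))

section Chart

variable [PerfectField k] {S : Set F} [Algebra.FiniteType k (Algebra.adjoin k S)]
  [IsFractionRing (Algebra.adjoin k S) F] {ω : Ω[Algebra.adjoin k S⁄k]}

/-- If the generators of a chart have the same values in `k` at both places, so has every element of
the chart, and the same elements are units. -/
theorem Place.eq_of_subset_agree (hω : Submodule.span (Algebra.adjoin k S) {ω} = ⊤)
    {P Q : Place k F} (h : S ⊆ P.agree Q) : P = Q := by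
  have hA := Algebra.adjoin_le h
  refine Place.eq_of_chart _ hω (fun a => ?_) (fun a => ?_) (fun a => ?_) <;>
    obtain ⟨c, hP, hQ⟩ := hA a.2
  · exact Place.mem_of_valuation_sub_lt hP
  · exact Place.mem_of_valuation_sub_lt hQ
  · rw [Place.valuation_eq_one_iff_of_sub_lt hP, Place.valuation_eq_one_iff_of_sub_lt hQ]

/-- `P.agree P` consists of the functions with a value in `k` at `P`. It contains the chart and is
closed under inverting units, so it contains the local ring. -/
theorem Place.surjective_of_subset_agree (hω : Submodule.span (Algebra.adjoin k S) {ω} = ⊤)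
    {P : Place k F} (h : S ⊆ P.agree P) :
    Function.Surjective (algebraMap k (IsLocalRing.ResidueField P.ring)) := by
  have hA := Algebra.adjoin_le h
  rw [Place.surjective_algebraMap_iff]
  intro b hb
  obtain ⟨a, s, hs, hbs⟩ := exists_div_of_mem_place _ hω P (fun a => by
    obtain ⟨c, hP, -⟩ := hA a.2
    exact Place.mem_of_valuation_sub_lt hP) hb
  have hs0 : (s : F) ≠ 0 := (Valuation.ne_zero_iff _).1 (hs ▸ one_ne_zero)
  have hb' : b = a * (s : F)⁻¹ := by rw [← hbs, mul_inv_cancel_right₀ hs0]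
  obtain ⟨c, hc, -⟩ := hb' ▸ mul_mem (hA a.2) (Place.inv_mem_agree (hA s.2) hs)
  exact ⟨c, hc⟩

end Chart

end

end GenusFour

namespace GenusFour

open KaehlerDifferential Polynomial

/-! ### Rational places and rational points. -/

section

variable {k : Type*} {F : Type*} [Field k] [Field F] [Algebra k F] {f p l φ G₀ G₁ u : k[X]}
  {m g i j : ℕ} {x y z τ w : F}

/-- The rational points of the affine curve. -/
abbrev AffinePoint {k : Type*} [Field k] (f p l : k[X]) (m : ℕ) : Type _ :=
  {s : k × k × k // s.2.1 ^ 2 = f.eval s.1 ∧ s.2.2 ^ (m + 1) = p.eval s.1 + l.eval s.1 * s.2.1}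

/-- The place `P` lies over the point with coordinates `s`. -/
def Place.LiesOver (P : Place k F) (x y z : F) (s : k × k × k) : Prop :=
  P.ring.valuation (x - algebraMap k F s.1) < 1 ∧
    P.ring.valuation (y - algebraMap k F s.2.1) < 1 ∧
    P.ring.valuation (z - algebraMap k F s.2.2) < 1

theorem Place.valuation_pow_sub_lt {P : Place k F} {b : F} {c : k}
    (h : P.ring.valuation (b - algebraMap k F c) < 1) (n : ℕ) :
    P.ring.valuation (b ^ n - algebraMap k F (c ^ n)) < 1 := by
  simpa using Place.valuation_aeval_sub_lt h (X ^ n)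

theorem Place.valuation_mul_sub_lt {P : Place k F} {a b : F} {c d : k}
    (h1 : P.ring.valuation (a - algebraMap k F c) < 1)
    (h2 : P.ring.valuation (b - algebraMap k F d) < 1) :
    P.ring.valuation (a * b - algebraMap k F (c * d)) < 1 := by
  have e : a * b - algebraMap k F (c * d) =
      a * (b - algebraMap k F d) + algebraMap k F d * (a - algebraMap k F c) := by
    rw [map_mul]; ring
  rw [e]
  refine Valuation.map_add_lt _ ?_ ?_ <;> rw [map_mul, mul_comm]
  · exact mul_lt_one_of_lt_of_le h2 ((P.valuation_le_one_iff _).2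
      (Place.mem_of_valuation_sub_lt h1))
  · exact mul_lt_one_of_lt_of_le h1 ((P.valuation_le_one_iff _).2 (P.algebraMap_mem d))

theorem Place.valuation_add_sub_lt {P : Place k F} {a b : F} {c d : k}
    (h1 : P.ring.valuation (a - algebraMap k F c) < 1)
    (h2 : P.ring.valuation (b - algebraMap k F d) < 1) :
    P.ring.valuation (a + b - algebraMap k F (c + d)) < 1 := by
  rw [map_add, add_sub_add_comm]
  exact Valuation.map_add_lt _ h1 h2

/-- A rational place where `x` is finite lies over a rational point. -/
theorem IsTower.exists_liesOver (ht : IsTower f p l m x y z) {P : Place k F} (hx : x ∈ P.ring)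
    (hP : Function.Surjective (algebraMap k (IsLocalRing.ResidueField P.ring))) :
    ∃ s : AffinePoint f p l m, P.LiesOver x y z s.1 := by
  rw [Place.surjective_algebraMap_iff] at hP
  obtain ⟨a, ha⟩ := hP x hx
  obtain ⟨b, hb⟩ := hP y (ht.mem_places_affine hx).1
  obtain ⟨c, hc⟩ := hP z (ht.mem_places_affine hx).2
  refine ⟨⟨(a, b, c), ?_, ?_⟩, ha, hb, hc⟩
  · exact Place.eq_of_valuation_sub_lt (Place.valuation_pow_sub_lt hb 2)
      (ht.sq_eq ▸ Place.valuation_aeval_sub_lt ha f)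
  · exact Place.eq_of_valuation_sub_lt (Place.valuation_pow_sub_lt hc (m + 1))
      (ht.pow_eq ▸ Place.valuation_add_sub_lt (Place.valuation_aeval_sub_lt ha p)
        (Place.valuation_mul_sub_lt (Place.valuation_aeval_sub_lt ha l) hb))

theorem Place.LiesOver.unique {P : Place k F} {s t : k × k × k} (hs : P.LiesOver x y z s)
    (ht : P.LiesOver x y z t) : s = t :=
  Prod.ext (Place.eq_of_valuation_sub_lt hs.1 ht.1) (Prod.ext
    (Place.eq_of_valuation_sub_lt hs.2.1 ht.2.1) (Place.eq_of_valuation_sub_lt hs.2.2 ht.2.2))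

theorem Place.LiesOver.subset_agree {P Q : Place k F} {s : k × k × k}
    (hP : P.LiesOver x y z s) (hQ : Q.LiesOver x y z s) (hu : u.eval s.1 ≠ 0) :
    affineChart u x y z ⊆ P.agree Q := by
  rintro t (h | h | h | h) <;> rw [h]
  · exact ⟨_, hP.1, hQ.1⟩
  · exact ⟨_, hP.2.1, hQ.2.1⟩
  · exact ⟨_, hP.2.2, hQ.2.2⟩
  · refine Place.inv_mem_agree
      ⟨_, Place.valuation_aeval_sub_lt hP.1 u, Place.valuation_aeval_sub_lt hQ.1 u⟩ ?_
    rwa [Place.valuation_eq_one_iff_of_sub_lt (Place.valuation_aeval_sub_lt hP.1 u)]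

/-- Every algebraic point of the affine curve is dominated by a place. -/
theorem IsTower.exists_place_of_point (ht : IsTower f p l m x y z) {K : Type*} [Field K]
    [Algebra k K] {a b c : K} (ha : IsAlgebraic k a) (hb : b ^ 2 = aeval a f)
    (hc : c ^ (m + 1) = aeval a p + aeval a l * b) :
    ∃ P : Place k F, x ∈ P.ring ∧ ∀ q : MvPolynomial (Fin 3) k,
      MvPolynomial.aeval ![a, b, c] q = 0 →
        P.ring.valuation (MvPolynomial.aeval ![x, y, z] q) < 1 := by
  let π : MvPolynomial (Fin 3) k →ₐ[k] F := MvPolynomial.aeval ![x, y, z]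
  let π' : MvPolynomial (Fin 3) k →+* π.range := π.rangeRestrict.toRingHom
  let e : MvPolynomial (Fin 3) k →ₐ[k] K := MvPolynomial.aeval ![a, b, c]
  have hsurj : Function.Surjective π' := π.rangeRestrict_surjective
  -- The relations among `x, y, z` generate `towerIdeal` and hold at `(a, b, c)`, so the point
  -- defines a homomorphism on the coordinate ring. Its kernel is nonzero because `a` is algebraic
  -- while `x` is transcendental.
  have hker : RingHom.ker π' ≤ RingHom.ker e.toRingHom := by
    intro q hq
    have h1 : π q = 0 := congrArg Subtype.val ((RingHom.mem_ker).1 hq)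
    have h2 : q ∈ towerIdeal f p l m := by
      rw [← ht.ker_aeval]; exact h1
    exact towerIdeal_le_ker hb hc h2
  let ψ : π.range →+* K := (RingHom.liftOfSurjective _ hsurj) ⟨_, hker⟩
  have hψ : ∀ q, ψ (π.rangeRestrict q) = e q :=
    fun q => RingHom.liftOfSurjective_comp_apply _ hsurj ⟨_, hker⟩ q
  have hmem : ∀ q : MvPolynomial (Fin 3) k, e q = 0 →
      π.rangeRestrict q ∈ RingHom.ker ψ := fun q hq => by rw [RingHom.mem_ker, hψ, hq]
  have hXe : e (.X 0) = a := by simp [e]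
  have hXπ : π (.X 0) = x := by simp [π]
  obtain ⟨q, hq0, hq⟩ := ha
  have h1 := hmem (aeval (.X 0) q) (by rw [← Polynomial.aeval_algHom_apply, hXe, hq])
  obtain ⟨P, hP', hP⟩ := exists_place π.range (RingHom.ker ψ) (RingHom.ker_ne_top _) (by
    intro h0
    rw [h0, Ideal.mem_bot] at h1
    have h2 : π (aeval (.X 0) q) = 0 := congrArg Subtype.val h1
    rw [← Polynomial.aeval_algHom_apply, hXπ] at h2
    exact ht.aeval_ne_zero hq0 h2)
  refine ⟨P, ?_, fun q hq => hP _ (hmem q hq)⟩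
  have := hP' (π.rangeRestrict (.X 0))
  rwa [← hXπ]

/-- Every rational point of the affine curve lies under a place. -/
theorem IsTower.exists_place_liesOver (ht : IsTower f p l m x y z) (s : AffinePoint f p l m) :
    ∃ P : Place k F, P.LiesOver x y z s.1 := by
  obtain ⟨⟨a, b, c⟩, hb, hc⟩ := s
  obtain ⟨P, -, hP⟩ := ht.exists_place_of_point (K := k) (a := a) (b := b) (c := c)
    (isAlgebraic_algebraMap a) (by simpa using hb) (by simpa using hc)
  refine ⟨P, ?_, ?_, ?_⟩
  · simpa using hP (.X 0 - .C a) (by simp)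
  · simpa using hP (.X 1 - .C b) (by simp)
  · simpa using hP (.X 2 - .C c) (by simp)

/-- The rational points at infinity. -/
abbrev InfinitePoint {k : Type*} [Field k] (φ G₀ : k[X]) (m : ℕ) : Type _ :=
  {s : k // s ^ (m + 1) * φ.coeff 0 = G₀.coeff 0}

theorem Place.valuation_inv_sub_lt {P : Place k F} (hx : x ∉ P.ring) :
    P.ring.valuation (x⁻¹ - algebraMap k F 0) < 1 := by
  simpa using Place.valuation_inv_lt_one hx

theorem IsTowerAtInfinity.valuation_pow_sub_lt
    (h : IsTowerAtInfinity φ G₀ G₁ g i j m x y z τ w) {P : Place k F} (hx : x ∉ P.ring) :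
    P.ring.valuation (w ^ (m + 1) * aeval x⁻¹ φ - algebraMap k F (G₀.coeff 0)) < 1 := by
  have h1 := Place.valuation_aeval_sub_lt (Place.valuation_inv_sub_lt hx) G₀
  have h2 : P.ring.valuation (τ * aeval x⁻¹ G₁ - algebraMap k F 0) < 1 := by
    rw [map_zero, sub_zero, map_mul]
    exact mul_lt_one_of_lt_of_le (h.valuation_tau_lt_one hx)
      ((P.valuation_le_one_iff _).2 (P.aeval_mem (Place.inv_mem hx) _))
  have h3 := Place.valuation_add_sub_lt h1 h2
  rwa [add_zero, ← coeff_zero_eq_eval_zero, ← h.w_pow] at h3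

theorem IsTowerAtInfinity.exists_infinitePoint
    (h : IsTowerAtInfinity φ G₀ G₁ g i j m x y z τ w) {P : Place k F} (hx : x ∉ P.ring)
    (hP : Function.Surjective (algebraMap k (IsLocalRing.ResidueField P.ring))) :
    ∃ s : InfinitePoint φ G₀ m, P.ring.valuation (w - algebraMap k F s.1) < 1 := by
  rw [Place.surjective_algebraMap_iff] at hP
  obtain ⟨c, hc⟩ := hP w (h.w_mem hx)
  refine ⟨⟨c, ?_⟩, hc⟩
  have h1 := Place.valuation_mul_sub_lt (Place.valuation_pow_sub_lt hc (m + 1))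
    (Place.valuation_aeval_sub_lt (Place.valuation_inv_sub_lt hx) φ)
  rw [← coeff_zero_eq_eval_zero] at h1
  exact Place.eq_of_valuation_sub_lt h1 (h.valuation_pow_sub_lt hx)

theorem IsTowerAtInfinity.subset_agree (h : IsTowerAtInfinity φ G₀ G₁ g i j m x y z τ w)
    {P Q : Place k F} (hP : x ∉ P.ring) (hQ : x ∉ Q.ring) {c : k}
    (hcP : P.ring.valuation (w - algebraMap k F c) < 1)
    (hcQ : Q.ring.valuation (w - algebraMap k F c) < 1) : chart φ x τ w ⊆ P.agree Q := by
  have hx : x⁻¹ ∈ P.agree Q := ⟨0, Place.valuation_inv_sub_lt hP, Place.valuation_inv_sub_lt hQ⟩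
  have hτ : τ ∈ P.agree Q := ⟨0, by simpa using h.valuation_tau_lt_one hP,
    by simpa using h.valuation_tau_lt_one hQ⟩
  have hw : w ∈ P.agree Q := ⟨c, hcP, hcQ⟩
  rintro t (h' | h' | h' | h') <;> rw [h']
  · exact hx
  · exact hτ
  · exact hw
  · refine Place.inv_mem_agree (mul_mem (sub_mem (one_mem _) (mul_mem (pow_mem hτ 2)
      (aeval_mem_subalgebra hx _))) (mul_mem hw (aeval_mem_subalgebra hx _))) ?_
    rw [map_mul, map_mul, h.valuation_denom hP, h.valuation_w hP, h.valuation_phi hP]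
    simp

theorem Place.valuation_comap_lt_one {P : Place k F} {σ : F ≃ₐ[k] F} {b : F} :
    (P.comap σ).ring.valuation b < 1 ↔ P.ring.valuation (σ b) < 1 := by
  rw [← ValuationSubring.mem_nonunits_iff, ← ValuationSubring.mem_nonunits_iff,
    ValuationSubring.mem_nonunits_iff_or, ValuationSubring.mem_nonunits_iff_or,
    Place.mem_comap, map_inv₀, EmbeddingLike.map_eq_zero_iff]

/-- Take any pole of `x`. There `w ^ (m + 1)` and `c ^ (m + 1)` agree, and factoring the difference
over the roots of unity gives `w ≡ ξ c` for some `ξ`. Moving the place by the inverse of `z ↦ ξ z`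
changes the value of `w` into `c`. -/
theorem IsTowerAtInfinity.exists_place_of_infinitePoint
    (h : IsTowerAtInfinity φ G₀ G₁ g i j m x y z τ w) (ht : IsTower f p l m x y z) {ζ : k}
    (hζ : IsPrimitiveRoot ζ (m + 1)) (s : InfinitePoint φ G₀ m) :
    ∃ P : Place k F, x ∉ P.ring ∧ P.ring.valuation (w - algebraMap k F s.1) < 1 := by
  obtain ⟨c, hc⟩ := s
  obtain ⟨P, hP⟩ := exists_place_not_mem ht.transcendental
  have h1 : P.ring.valuation (w ^ (m + 1) - (algebraMap k F c) ^ (m + 1)) < 1 := by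
    have h2 := Place.valuation_aeval_sub_lt (Place.valuation_inv_sub_lt hP) φ
    rw [← coeff_zero_eq_eval_zero] at h2
    have h3 := h.valuation_pow_sub_lt hP
    have h4 : P.ring.valuation (w ^ (m + 1)) ≤ 1 := by rw [map_pow, h.valuation_w hP, one_pow]
    have h5 : (w ^ (m + 1) - (algebraMap k F c) ^ (m + 1)) * algebraMap k F (φ.coeff 0) =
        (w ^ (m + 1) * aeval x⁻¹ φ - algebraMap k F (G₀.coeff 0)) -
          (aeval x⁻¹ φ - algebraMap k F (φ.coeff 0)) * w ^ (m + 1) := by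
      rw [← hc, map_mul, map_pow]; ring
    have h6 := Valuation.map_sub_lt P.ring.valuation h3
      ((map_mul P.ring.valuation _ _).trans_lt (mul_lt_one_of_lt_of_le h2 h4))
    rwa [← h5, map_mul, P.valuation_algebraMap h.phi_coeff, mul_one] at h6
  obtain ⟨ξ, hξ, hlt⟩ : ∃ ξ : k, ξ ^ (m + 1) = 1 ∧
      P.ring.valuation (w - algebraMap k F (ξ * c)) < 1 := by
    by_contra hne
    push Not at hne
    have hζ' : IsPrimitiveRoot (algebraMap k F ζ) (m + 1) :=
      hζ.map_of_injective (algebraMap k F).injective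
    rw [hζ'.pow_sub_pow_eq_prod_sub_mul _ _ m.succ_pos, map_prod] at h1
    refine absurd h1 (not_lt.2 (Finset.one_le_prod' fun η hη => ?_))
    obtain ⟨e, -, rfl⟩ := hζ'.eq_pow_of_pow_eq_one
      ((Polynomial.mem_nthRootsFinset m.succ_pos _).1 hη)
    have := hne (ζ ^ e) (by rw [← pow_mul, mul_comm, pow_mul, hζ.pow_eq_one, one_pow])
    rwa [map_mul, map_pow] at this
  have hξ0 : ξ ≠ 0 := by rintro rfl; simp at hξ
  obtain ⟨σ, hσx, hσy, hσz⟩ := ht.exists_algEquiv hξ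
  have hy : y ≠ 0 := by
    rintro rfl
    have := h.tau_mul
    rw [mul_zero] at this
    exact pow_ne_zero g ht.x_ne_zero this.symm
  have hστ : σ τ = τ := by
    have := congrArg σ h.tau_mul
    rw [map_mul, map_pow, hσx, hσy, ← h.tau_mul] at this
    exact mul_right_cancel₀ hy this
  have hσw : σ w = algebraMap k F ξ * w := by
    rw [h.w_eq, map_mul, map_mul, map_pow, map_pow, map_inv₀, hσx, hστ, hσz]; ring
  refine ⟨P.comap σ.symm, ?_, ?_⟩
  · rw [Place.mem_comap, σ.symm_apply_eq.2 hσx.symm]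
    exact hP
  · rw [Place.valuation_comap_lt_one, map_sub, σ.symm.commutes]
    have : σ.symm w = (algebraMap k F ξ)⁻¹ * w := by
      rw [σ.symm_apply_eq, map_mul, map_inv₀, σ.commutes, hσw, inv_mul_cancel_left₀]
      exact (_root_.map_ne_zero _).2 hξ0
    rw [this]
    have h7 : (algebraMap k F ξ)⁻¹ * w - algebraMap k F c =
        algebraMap k F ξ⁻¹ * (w - algebraMap k F (ξ * c)) := by
      rw [map_inv₀, map_mul, mul_sub, inv_mul_cancel_left₀]
      exact (_root_.map_ne_zero _).2 hξ0
    rwa [h7, map_mul, P.valuation_algebraMap (inv_ne_zero hξ0), one_mul]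

/-- The number of rational points of a tower. -/
theorem IsTower.card_rationalPoint [Finite k] (ht : IsTower f p l m x y z)
    (h : IsTowerAtInfinity φ G₀ G₁ g i j m x y z τ w) (h2 : (2 : k) ≠ 0)
    (hm : ((m + 1 : ℕ) : k) ≠ 0) {ζ : k} (hζ : IsPrimitiveRoot ζ (m + 1))
    (hs : IsSmoothAway f p l u) (hu : ∀ a, u.eval a ≠ 0) :
    Nat.card (RationalPoint k F) =
      Nat.card (AffinePoint f p l m) + Nat.card (InfinitePoint φ G₀ m) := by
  have hu0 : u ≠ 0 := by rintro rfl; exact hu 0 eval_zero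
  obtain ⟨ω, hω, -⟩ := ht.exists_affineChart_span hu0 h2 hm hs
  have := ht.affineChart_isFractionRing u
  have : Algebra.FiniteType k (Algebra.adjoin k (affineChart u x y z)) := affineChart_finiteType u
  have hω' := h.chart_span ht.transcendental hm
  have := h.chart_isFractionRing ht
  have : Algebra.FiniteType k (Algebra.adjoin k (IsTowerAtInfinity.chart φ x τ w)) :=
    IsTowerAtInfinity.chart_finiteType
  -- Since `u` has no zero in `k`, each rational affine point lies in the smooth chart and carries
  -- exactly one place; the chart at infinity does the same for the remaining points.
  let R : Place k F → AffinePoint f p l m ⊕ InfinitePoint φ G₀ m → Prop := fun P s =>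
    s.elim (fun s => P.LiesOver x y z s.1)
      (fun s => x ∉ P.ring ∧ P.ring.valuation (w - algebraMap k F s.1) < 1)
  have hex : ∀ s, ∃ P : RationalPoint k F, R P.1 s := by
    rintro (s | s)
    · obtain ⟨P, hP⟩ := ht.exists_place_liesOver s
      exact ⟨⟨P, Place.surjective_of_subset_agree hω (hP.subset_agree hP (hu _))⟩, hP⟩
    · obtain ⟨P, hP, hc⟩ := h.exists_place_of_infinitePoint ht hζ s
      exact ⟨⟨P, Place.surjective_of_subset_agree hω' (h.subset_agree hP hP hc hc)⟩, hP, hc⟩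
  choose G hG using hex
  rw [← Nat.card_sum]
  refine (Nat.card_eq_of_bijective G ⟨fun s t hst => ?_, fun P => ?_⟩).symm
  · have h1 := hG s
    have h3 := hG t
    rw [hst] at h1
    rcases s with s | s <;> rcases t with t | t
    · exact congrArg _ (Subtype.ext (Place.LiesOver.unique h1 h3))
    · exact absurd (Place.mem_of_valuation_sub_lt h1.1) h3.1
    · exact absurd (Place.mem_of_valuation_sub_lt h3.1) h1.1
    · exact congrArg _ (Subtype.ext (Place.eq_of_valuation_sub_lt h1.2 h3.2))
  · by_cases hx : x ∈ P.1.ring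
    · obtain ⟨s, hs⟩ := ht.exists_liesOver hx P.2
      refine ⟨Sum.inl s, Subtype.ext ?_⟩
      have h1 : (G (Sum.inl s)).1.LiesOver x y z s.1 := hG (Sum.inl s)
      exact Place.eq_of_subset_agree hω (h1.subset_agree hs (hu _))
    · obtain ⟨s, hs⟩ := h.exists_infinitePoint hx P.2
      have h1 := hG (Sum.inr s)
      exact ⟨Sum.inr s, Subtype.ext
        (Place.eq_of_subset_agree hω' (h.subset_agree h1.1 hx h1.2 hs))⟩

end

end GenusFour

namespace GenusFour

open KaehlerDifferential Polynomial

/-! ### Double covers whose affine model has double points. -/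

section

variable {k : Type*} {F : Type*} [Field k] [Field F] [Algebra k F] {f p l φ G₀ G₁ u v : k[X]}
  {m g i j : ℕ} {x y z τ w : F}

/-- On the part of a double cover where `z ≠ 0`, the differential `dx / y` is a generator. -/
theorem exists_span_of_isUnit (h2 : (2 : k) ≠ 0) (hf : ∃ α β : k[X], α * f + β * derivative f = 1)
    (hy : y ^ 2 = aeval x f) (hz : z ^ 2 = aeval x p + aeval x l * y) (hz0 : z ≠ 0) :
    ∃ ω : Ω[Algebra.adjoin k {x, y, z, z⁻¹}⁄k],
      Submodule.span (Algebra.adjoin k {x, y, z, z⁻¹}) {ω} = ⊤ ∧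
      D k F x = y • KaehlerDifferential.map k k _ F ω := by
  set A := Algebra.adjoin k {x, y, z, z⁻¹} with hA
  let x' : A := ⟨x, Algebra.subset_adjoin (by simp)⟩
  let y' : A := ⟨y, Algebra.subset_adjoin (by simp)⟩
  let z' : A := ⟨z, Algebra.subset_adjoin (by simp)⟩
  let s' : A := ⟨z⁻¹, Algebra.subset_adjoin (by simp)⟩
  have hae : ∀ q : k[X], ((aeval x' q : A) : F) = aeval x q := fun q =>
    (Polynomial.aeval_algHom_apply A.val x' q).symm
  have hy : y' ^ 2 = aeval x' f := by
    apply Subtype.ext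
    rw [hae, Subalgebra.coe_pow]
    exact hy
  have hz : z' ^ (1 + 1) = aeval x' p + aeval x' l * y' := by
    apply Subtype.ext
    rw [Subalgebra.coe_add, Subalgebra.coe_mul, hae, hae, Subalgebra.coe_pow]
    exact hz
  have hs : z' * s' = 1 := Subtype.ext (mul_inv_cancel₀ hz0)
  obtain ⟨α, β, hαβ⟩ := hf
  obtain ⟨η, hx, hdy⟩ := exists_dx_div_y (k := k) hy hαβ
  have hdz := smul_D_z (k := k) hx hdy hz
  have hηm : η ∈ Submodule.span A {η} := Submodule.mem_span_singleton_self η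
  have hxm : D k A x' ∈ Submodule.span A {η} := hx ▸ Submodule.smul_mem _ _ hηm
  have h4 := two_mul_inv (A := A) h2
  have hzm : D k A z' ∈ Submodule.span A {η} := by
    refine mem_span_of_smul_mem (s := 2 * ((1 : ℕ) + 1) * z' ^ 1)
      (t := algebraMap k A 2⁻¹ * algebraMap k A 2⁻¹ * s') ?_ (hdz ▸ Submodule.smul_mem _ _ hηm)
    push_cast
    linear_combination (4 * algebraMap k A 2⁻¹ * algebraMap k A 2⁻¹) * hs +
      (2 * algebraMap k A 2⁻¹ + 1) * h4
  refine ⟨η, ?_, ?_⟩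
  · apply span_kaehler_adjoin_eq_top
    intro t ht'
    rcases ht' with ht' | ht' | ht' | ht' <;> subst ht'
    · exact hxm
    · refine mem_span_of_smul_mem (two_mul_inv h2) ?_
      exact hdy ▸ Submodule.smul_mem _ _ hηm
    · exact hzm
    · exact D_mem_span_of_mul_eq_one hs hzm
  · have h3 := congrArg (KaehlerDifferential.map k k A F) hx
    rw [KaehlerDifferential.map_D, map_smul] at h3
    exact h3

/-- No tower is assumed, so that the lemma also applies to another generator in place of `z`, as is
needed at a double point. -/
theorem Place.mem_span_iff_of_isUnit [PerfectField k] [Nontrivial Ω[F⁄k]] (h2 : (2 : k) ≠ 0)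
    (hf : ∃ α β : k[X], α * f + β * derivative f = 1) (hy : y ^ 2 = aeval x f)
    (hz : z ^ 2 = aeval x p + aeval x l * y) (htop : IntermediateField.adjoin k {x, y, z} = ⊤)
    {P : Place k F} (hxP : x ∈ P.ring) (hyP : y ∈ P.ring) (hzP : P.ring.valuation z = 1) :
    ∃ η : Ω[F⁄k], D k F x = y • η ∧ ∀ c : F,
      c • η ∈ Submodule.span P.ring (Set.range fun b : P.ring => D k F (b : F)) ↔ c ∈ P.ring := by
  have hz0 : z ≠ 0 := (Valuation.ne_zero_iff _).1 (hzP ▸ one_ne_zero)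
  obtain ⟨ω, hω, hx⟩ := exists_span_of_isUnit h2 hf hy hz hz0
  have : Algebra.FiniteType k (Algebra.adjoin k {x, y, z, z⁻¹}) :=
    Subalgebra.fg_iff_finiteType _ |>.1 <| Subalgebra.fg_def.2 ⟨_, Set.toFinite _, rfl⟩
  have : IsFractionRing (Algebra.adjoin k {x, y, z, z⁻¹}) F := by
    refine isFractionRing_of_adjoin_eq_top htop _ ?_
    rintro t (ht' | ht' | ht') <;> rw [ht'] <;> exact Algebra.subset_adjoin (by simp)
  have hne := ne_zero_of_span_eq_top (span_map_eq_top _ hω)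
  refine ⟨_, hx, fun c => ?_⟩
  rw [Place.span_eq _ hω P, P.smul_mem_span_singleton hne]
  let S : Subalgebra k F := { P.ring.toSubring with algebraMap_mem' := P.algebraMap_mem }
  refine fun a => (Algebra.adjoin_le (S := S) ?_) a.2
  rintro t (ht | ht | ht | ht) <;> rw [ht]
  · exact hxP
  · exact hyP
  · exact (P.valuation_le_one_iff _).1 hzP.le
  · refine (P.valuation_le_one_iff _).1 ?_
    rw [map_inv₀, hzP, inv_one]

/-- The double cover `z² = p(x) + y` of `y² = f(x)` has double points at the zeros of `u`. -/
structure IsNodal (f p u v : k[X]) : Prop where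
  smooth : IsSmoothAway f p 1 u
  norm_eq : p ^ 2 - f = u ^ 2 * v
  coprime : IsCoprime u (2 * p * v)
  irreducible : Irreducible u

theorem Place.valuation_eq_one_of_isCoprime {P : Place k F} (hx : x ∈ P.ring)
    (hu : P.ring.valuation (aeval x u) < 1) (h : IsCoprime u v) :
    P.ring.valuation (aeval x v) = 1 := by
  obtain ⟨a, b, hab⟩ := h
  refine le_antisymm ((P.valuation_le_one_iff _).2 (P.aeval_mem hx v)) ?_
  by_contra hv
  rw [not_le] at hv
  have h1 := congrArg (fun q => P.ring.valuation (aeval x q)) hab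
  simp only [map_add, map_mul, map_one] at h1
  refine absurd h1 (ne_of_lt (Valuation.map_add_lt _ ?_ ?_)) <;> rw [map_mul, mul_comm]
  · exact mul_lt_one_of_lt_of_le hu ((P.valuation_le_one_iff _).2 (P.aeval_mem hx a))
  · exact mul_lt_one_of_lt_of_le hv ((P.valuation_le_one_iff _).2 (P.aeval_mem hx b))

theorem IsTower.norm_eq (ht : IsTower f p 1 1 x y z) (hn : IsNodal f p u v) :
    z ^ 2 * (aeval x p - y) = aeval x u ^ 2 * aeval x v := by
  have h1 := congrArg (aeval x) hn.norm_eq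
  simp only [map_sub, map_mul, map_pow] at h1
  have h3 := ht.pow_eq
  rw [map_one, one_mul] at h3
  rw [← h1, ← ht.sq_eq, h3]; ring

theorem IsTower.y_ne_zero (ht : IsTower f p l m x y z) : y ≠ 0 := by
  rintro rfl
  have := ht.indep 0 (fun r => if r = 0 then 1 else 0) (by simp [towerSum]) 0 (Nat.zero_le _)
  simpa using this.2

theorem IsTower.v_ne_zero (ht : IsTower f p 1 1 x y z) (hn : IsNodal f p u v) : v ≠ 0 := by
  rintro rfl
  have h1 := ht.norm_eq hn
  rw [map_zero, mul_zero] at h1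
  rcases mul_eq_zero.1 h1 with h2 | h2
  · exact ht.z_ne_zero le_rfl (pow_eq_zero_iff two_ne_zero |>.1 h2)
  · have := ht.indep (fun r => if r = 0 then p else 0) (fun r => if r = 0 then -1 else 0)
      (by simpa [towerSum, Finset.sum_range_succ, sub_eq_add_neg] using h2) 0 (by norm_num)
    simpa using this.2

/-- Regularity of a differential at a double point of the plane model. -/
theorem IsTower.mem_span_iff_of_isNodal [PerfectField k] (ht : IsTower f p 1 1 x y z)
    (hn : IsNodal f p u v) (h2 : (2 : k) ≠ 0) {ω : Ω[F⁄k]} (hω : D k F x = (y * z) • ω)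
    {P : Place k F} (hx : x ∈ P.ring) (hu : P.ring.valuation (aeval x u) < 1) (c : F) :
    c • ω ∈ Submodule.span P.ring (Set.range fun b : P.ring => D k F (b : F)) ↔
      c / z ∈ P.ring := by
  have := ht.kaehler_nontrivial
  have hz0 := ht.z_ne_zero le_rfl
  have hz : z ^ 2 = aeval x p + aeval x 1 * y := ht.pow_eq
  have hy0 := ht.y_ne_zero
  have hv0 : aeval x v ≠ 0 := ht.aeval_ne_zero (ht.v_ne_zero hn)
  have hu0 : aeval x u ≠ 0 := ht.aeval_ne_zero hn.irreducible.ne_zero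
  obtain ⟨hyP, hzP⟩ := ht.mem_places_affine hx
  have key : ∃ η : Ω[F⁄k], D k F x = y • η ∧ ∀ c : F,
      c • η ∈ Submodule.span P.ring (Set.range fun b : P.ring => D k F (b : F)) ↔
        c ∈ P.ring := by
    rcases eq_or_lt_of_le ((P.valuation_le_one_iff _).2 hzP) with h1 | h1
    · exact Place.mem_span_iff_of_isUnit h2 hn.smooth.base ht.sq_eq hz ht.adjoin_eq_top hx hyP h1
    -- Where `z` vanishes, `u v / z` replaces it. Its square is `v (p - y)`, a unit, because `p - y
    -- = 2 p - z²` and both `v` and `2 p` are prime to `u`.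
    · have hs : (aeval x u * aeval x v / z) ^ 2 = aeval x (v * p) + aeval x (-v) * y := by
        rw [div_pow, div_eq_iff (pow_ne_zero 2 hz0), map_mul, map_neg]
        linear_combination -aeval x v * ht.norm_eq hn
      refine Place.mem_span_iff_of_isUnit h2 hn.smooth.base ht.sq_eq hs ?_ hx hyP ?_
      · rw [← top_le_iff, ← ht.adjoin_eq_top, IntermediateField.adjoin_le_iff]
        have hsub := IntermediateField.subset_adjoin k {x, y, aeval x u * aeval x v / z}
        have hxm := hsub (show x ∈ _ by simp)
        have hae : ∀ q : k[X], aeval x q ∈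
            IntermediateField.adjoin k {x, y, aeval x u * aeval x v / z} := fun q =>
          aeval_mem_subalgebra (S := (IntermediateField.adjoin k
            {x, y, aeval x u * aeval x v / z}).toSubalgebra) hxm q
        rintro t (ht' | ht' | ht') <;> rw [ht']
        · exact hxm
        · exact hsub (by simp)
        · have h3 := div_mem (mul_mem (hae u) (hae v))
            (hsub (show aeval x u * aeval x v / z ∈ _ by simp))
          rwa [div_div_cancel₀ (mul_ne_zero hu0 hv0)] at h3
      · have h3 : P.ring.valuation (aeval x (2 * p)) = 1 := by
          refine Place.valuation_eq_one_of_isCoprime hx hu ?_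
          exact hn.coprime.of_mul_right_left
        have h4 : P.ring.valuation (aeval x v) = 1 :=
          Place.valuation_eq_one_of_isCoprime hx hu hn.coprime.of_mul_right_right
        have h5 : aeval x p - y = aeval x (2 * p) - z ^ 2 := by
          rw [hz, map_mul, map_ofNat, map_one]; ring
        have h6 : P.ring.valuation (aeval x p - y) = 1 := by
          have h9 : P.ring.valuation (z ^ 2) < 1 := by
            rw [map_pow]
            exact (pow_lt_one_iff two_ne_zero).2 h1
          rw [h5, Valuation.map_sub_eq_of_lt_left _ (by rwa [h3]), h3]
        have h7 : (aeval x u * aeval x v / z) ^ 2 = aeval x v * (aeval x p - y) := by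
          rw [hs, map_mul, map_neg]; ring
        have h8 := congrArg P.ring.valuation h7
        rw [map_pow, map_mul, h4, h6, one_mul] at h8
        exact (pow_eq_one_iff.1 h8).resolve_right two_ne_zero
  obtain ⟨η, hη, hmem⟩ := key
  -- `η = dx / y` generates the regular differentials at `P` and `ω = η / z`, so the condition on
  -- `c` becomes one on `c / z`.
  have h1 : η = z • ω := by
    rw [hω, mul_smul] at hη
    exact (smul_right_injective _ hy0 hη).symm
  rw [← hmem, h1, smul_smul, div_mul_cancel₀ _ hz0]

end

end GenusFour

namespace GenusFour

open KaehlerDifferential Polynomial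

section

variable {k : Type*} {F : Type*} [Field k] [Field F] [Algebra k F] {f p l φ G₀ G₁ u v : k[X]}
  {m g i j : ℕ} {x y z τ w : F}

/-- An integral closure is an intersection of valuation rings. The fraction field of `k[x, y]` need
not be `F` here. -/
theorem isIntegral_of_forall_place {c : F} (h : ∀ P : Place k F, x ∈ P.ring → c ∈ P.ring) :
    IsIntegral (Algebra.adjoin k {x, y}) c := by
  by_contra hc
  have hc' : c ∉ (integralClosure (Algebra.adjoin k {x, y}) F).toSubring := hc
  have : IsIntegrallyClosedIn (integralClosure (Algebra.adjoin k {x, y}) F).toSubring F :=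
    inferInstanceAs (IsIntegrallyClosedIn (integralClosure (Algebra.adjoin k {x, y}) F) F)
  obtain ⟨V, hV, hcV⟩ := Subring.exists_le_valuationSubring_of_isIntegrallyClosedIn hc'
  have hA : ∀ a ∈ Algebra.adjoin k {x, y}, a ∈ V := fun a ha =>
    hV ((integralClosure (Algebra.adjoin k {x, y}) F).algebraMap_mem ⟨a, ha⟩)
  refine hcV (h ⟨V, fun c => hA _ (Subalgebra.algebraMap_mem _ c), ?_⟩
    (hA x (Algebra.subset_adjoin (by simp))))
  rintro rfl
  exact hcV (ValuationSubring.mem_top _)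

theorem exists_pow_mul_mem_adjoin (hu : aeval x u ≠ 0) {c : F}
    (hc : c ∈ Algebra.adjoin k (affineChart u x y z)) :
    ∃ n : ℕ, aeval x u ^ n * c ∈ Algebra.adjoin k {x, y, z} := by
  have hxm : x ∈ Algebra.adjoin k {x, y, z} := Algebra.subset_adjoin (by simp)
  have hum : aeval x u ∈ Algebra.adjoin k {x, y, z} := aeval_mem_subalgebra hxm u
  induction hc using Algebra.adjoin_induction with
  | mem s hs =>
    rcases hs with hs | hs | hs | hs
    · exact ⟨0, by rw [hs]; simpa using hxm⟩
    · exact ⟨0, by rw [hs, pow_zero, one_mul]; exact Algebra.subset_adjoin (by simp)⟩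
    · exact ⟨0, by rw [hs, pow_zero, one_mul]; exact Algebra.subset_adjoin (by simp)⟩
    · exact ⟨1, by rw [hs, pow_one, mul_inv_cancel₀ hu]; exact one_mem _⟩
  | algebraMap r => exact ⟨0, by simp⟩
  | add s t _ _ hs ht =>
    obtain ⟨a, ha⟩ := hs
    obtain ⟨b, hb⟩ := ht
    refine ⟨a + b, ?_⟩
    have : aeval x u ^ (a + b) * (s + t) =
        aeval x u ^ b * (aeval x u ^ a * s) + aeval x u ^ a * (aeval x u ^ b * t) := by ring
    rw [this]
    exact add_mem (mul_mem (pow_mem hum _) ha) (mul_mem (pow_mem hum _) hb)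
  | mul s t _ _ hs ht =>
    obtain ⟨a, ha⟩ := hs
    obtain ⟨b, hb⟩ := ht
    refine ⟨a + b, ?_⟩
    have : aeval x u ^ (a + b) * (s * t) = (aeval x u ^ a * s) * (aeval x u ^ b * t) := by ring
    rw [this]
    exact mul_mem ha hb

/-- The functions `c` in `polesLE` such that `c / z` is regular at the zeros of `u`. -/
def nodalLE (k : Type*) {F : Type*} [Field k] [Field F] [Algebra k F] (u : k[X]) (x z : F)
    (N : ℕ) : Submodule k F where
  carrier := {c | c ∈ polesLE k x N ∧
    ∀ P : Place k F, x ∈ P.ring → P.ring.valuation (aeval x u) < 1 → c / z ∈ P.ring}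
  zero_mem' := ⟨zero_mem _, fun P _ _ => by simp⟩
  add_mem' := by
    rintro c d ⟨hc, hc'⟩ ⟨hd, hd'⟩
    exact ⟨add_mem hc hd, fun P hP hu => by
      rw [add_div]; exact add_mem (hc' P hP hu) (hd' P hP hu)⟩
  smul_mem' := by
    rintro r c ⟨hc, hc'⟩
    exact ⟨Submodule.smul_mem _ _ hc, fun P hP hu => by
      rw [Algebra.smul_def, mul_div_assoc]
      exact mul_mem (P.algebraMap_mem r) (hc' P hP hu)⟩

/-- Away from the zeros of `u` the coefficient of `dx / (y z)` behaves as in the smooth case; over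
these zeros `dx / y` is a generator, which accounts for the condition on `c / z`. -/
theorem IsTower.genus_eq_finrank_nodalLE [PerfectField k]
    (ht : IsTower f p 1 1 x y z) (h : IsTowerAtInfinity φ G₀ G₁ g i j 1 x y z τ w)
    (h2 : (2 : k) ≠ 0) (hn : IsNodal f p u v)
    {N : ℕ} (hN : N + 2 = 2 * g + (i + 2 * j) * 1) :
    genus k F = Module.finrank k (nodalLE k u x z N) := by
  have hm : ((1 + 1 : ℕ) : k) ≠ 0 := by exact_mod_cast h2
  obtain ⟨ω, hx, hspan, hne, hω⟩ :=
    ht.exists_differential hn.irreducible.ne_zero h2 hm hn.smooth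
  rw [pow_one] at hx
  have hnode := fun (P : Place k F) (hP : x ∈ P.ring) (hu : P.ring.valuation (aeval x u) < 1)
    (c : F) => ht.mem_span_iff_of_isNodal hn h2 hx hP hu c
  have hinf := fun (P : Place k F) (hP : x ∉ P.ring) (c : F) =>
    h.mem_span_iff ht h2 hm hN (by rwa [pow_one]) hP c
  have hcase : ∀ P : Place k F, x ∈ P.ring →
      P.ring.valuation (aeval x u) = 1 ∨ P.ring.valuation (aeval x u) < 1 := fun P hP =>
    eq_or_lt_of_le ((P.valuation_le_one_iff _).2 (P.aeval_mem hP u))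
  refine genus_eq_finrank hspan hne _ fun c => ?_
  rw [mem_regularDifferentials_iff]
  constructor
  · refine fun hc => ⟨⟨fun P hP => ?_, fun P hP => ?_⟩, fun P hP hu => ?_⟩
    · rcases hcase P hP with hu | hu
      · exact (hω P hP hu c).1 (hc P)
      · have := mul_mem ((hnode P hP hu c).1 (hc P)) (ht.mem_places_affine hP).2
        rwa [div_mul_cancel₀ _ (ht.z_ne_zero le_rfl)] at this
    · exact (h.valuation_le_iff hP c N).2 ((hinf P hP c).1 (hc P))
    · exact (hnode P hP hu c).1 (hc P)
  · rintro ⟨⟨h1, h3⟩, h4⟩ P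
    by_cases hP : x ∈ P.ring
    · rcases hcase P hP with hu | hu
      · exact (hω P hP hu c).2 (h1 P hP)
      · exact (hnode P hP hu c).2 (h4 P hP hu)
    · exact (hinf P hP c).2 ((h.valuation_le_iff hP c N).1 (h3 P hP))

theorem map_mem_nodalLE (hx0 : x ≠ 0) {σ : F ≃ₐ[k] F} (hx : σ x = x) {ξ : k}
    (hξ : ξ ≠ 0) (hz : σ z = algebraMap k F ξ * z) {N : ℕ} {c : F} (hc : c ∈ nodalLE k u x z N) :
    σ c ∈ nodalLE k u x z N := by
  refine ⟨map_mem_polesLE hx0 hx hc.1, fun P hP hu => ?_⟩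
  have h1 := hc.2 (P.comap σ) (by rwa [Place.mem_comap, hx]) (by
    rwa [Place.valuation_comap_lt_one, ← AlgEquiv.coe_toAlgHom, ← Polynomial.aeval_algHom_apply,
      AlgEquiv.coe_toAlgHom, hx])
  rw [Place.mem_comap, map_div₀, hz] at h1
  have h2 := mul_mem (P.algebraMap_mem ξ) h1
  have h3 : algebraMap k F ξ ≠ 0 := (_root_.map_ne_zero _).2 hξ
  rwa [mul_div_assoc', mul_div_mul_left _ _ h3] at h2

/-- The two components of a function on a double cover. -/
theorem IsTower.exists_components [PerfectField k]
    (ht : IsTower f p 1 1 x y z) (h2 : (2 : k) ≠ 0) (hn : IsNodal f p u v) {N : ℕ} {c : F}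
    (hc : c ∈ nodalLE k u x z N) : ∃ a b a' b' : k[X],
      c = (aeval x a + aeval x b * y) + (aeval x a' + aeval x b' * y) * z ∧
      (aeval x a + aeval x b * y) ∈ nodalLE k u x z N ∧
      (aeval x a' + aeval x b' * y) * z ∈ nodalLE k u x z N := by
  have hm : ((1 + 1 : ℕ) : k) ≠ 0 := by exact_mod_cast h2
  have hu0 : aeval x u ≠ 0 := ht.aeval_ne_zero hn.irreducible.ne_zero
  have := ht.isIntegrallyClosed_affineChart hn.irreducible.ne_zero h2 hm hn.smooth
  have := ht.affineChart_isFractionRing u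
  have hmem : c ∈ Algebra.adjoin k (affineChart u x y z) :=
    mem_of_forall_place (k := k) _ fun P hP =>
      hc.1.1 P (hP ⟨x, Algebra.subset_adjoin (by simp [affineChart])⟩)
  obtain ⟨n, hmem'⟩ := exists_pow_mul_mem_adjoin hu0 hmem
  obtain ⟨a, b, hab⟩ := exists_eq_towerSum ht.sq_eq ht.pow_eq hmem'
  -- The denominators come from the inverse of `u` in the chart. They disappear at the end, since
  -- `α` and `β` lie in `k(x, y)`, are regular wherever `x` is, and `k[x, y]` is integrally closed.
  set α : F := (aeval x (a 0) + aeval x (b 0) * y) / aeval x u ^ n with hα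
  set β : F := (aeval x (a 1) + aeval x (b 1) * y) / aeval x u ^ n with hβ
  have hcαβ : c = α + β * z := by
    rw [hα, hβ]
    field_simp
    rw [mul_comm, hab, towerSum, Finset.sum_range_succ, Finset.sum_range_one]
    ring
  obtain ⟨σ, hσx, hσy, hσz⟩ := ht.exists_algEquiv (ζ := -1) (by norm_num)
  have hae : ∀ q : k[X], σ (aeval x q) = aeval x q := fun q => by
    rw [← AlgEquiv.coe_toAlgHom, ← Polynomial.aeval_algHom_apply, AlgEquiv.coe_toAlgHom, hσx]
  have hσc : σ c = α - β * z := by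
    rw [hcαβ, map_add, map_mul, hσz, hα, hβ]
    simp only [map_div₀, map_add, map_mul, map_pow, hae, hσy, map_neg, map_one]
    ring
  have hσm := map_mem_nodalLE ht.x_ne_zero hσx (neg_ne_zero.2 one_ne_zero) hσz hc
  have h2F : (2 : F) = algebraMap k F 2 := (map_ofNat _ 2).symm
  have h2F0 : (2 : F) ≠ 0 := h2F ▸ (_root_.map_ne_zero _).2 h2
  have hαm : α ∈ nodalLE k u x z N := by
    have h3 := Submodule.smul_mem _ (2⁻¹ : k) (add_mem hc hσm)
    have h4 : (2⁻¹ : k) • (c + σ c) = α := by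
      rw [hσc, hcαβ, Algebra.smul_def, map_inv₀, ← h2F]
      field_simp
      ring
    rwa [h4] at h3
  have hβm : β * z ∈ nodalLE k u x z N := by
    have h3 := sub_mem hc hαm
    rwa [hcαβ, add_sub_cancel_left] at h3
  have hK : ∀ r s : k[X], (aeval x r + aeval x s * y) / aeval x u ^ n ∈
      IntermediateField.adjoin k {x, y} := fun r s => by
    have hsub := IntermediateField.subset_adjoin k {x, y}
    have hq : ∀ q : k[X], aeval x q ∈ IntermediateField.adjoin k {x, y} := fun q =>
      aeval_mem_subalgebra (S := (IntermediateField.adjoin k {x, y}).toSubalgebra)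
        (hsub (by simp)) q
    exact div_mem (add_mem (hq r) (mul_mem (hq s) (hsub (by simp)))) (pow_mem (hq u) n)
  obtain ⟨e, e', hee⟩ := hn.smooth.base
  have hpoly : ∀ γ : F, γ ∈ IntermediateField.adjoin k {x, y} →
      (∀ P : Place k F, x ∈ P.ring → γ ∈ P.ring) →
      ∃ r s : k[X], γ = aeval x r + aeval x s * y := fun γ hγ hγP =>
    exists_eq_add_mul ht.sq_eq (mem_adjoin_of_isIntegral h2 ht.sq_eq hee
      (isIntegral_of_forall_place hγP) hγ)
  obtain ⟨r, s, hrs⟩ := hpoly α (hK _ _) hαm.1.1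
  obtain ⟨r', s', hrs'⟩ := hpoly β (hK _ _) fun P hP => by
    rcases eq_or_lt_of_le ((P.valuation_le_one_iff _).2 (P.aeval_mem hP u)) with hu | hu
    · rw [hβ, ← P.valuation_le_one_iff, map_div₀, map_pow, hu, one_pow, div_one,
        P.valuation_le_one_iff]
      exact add_mem (P.aeval_mem hP _) (mul_mem (P.aeval_mem hP _) (ht.mem_places_affine hP).1)
    -- Over a zero of `u` the membership in `nodalLE` says that `β z / z = β` is regular.
    · have := hβm.2 P hP hu
      rwa [mul_div_cancel_right₀ _ (ht.z_ne_zero le_rfl)] at this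
  exact ⟨r, s, r', s', by rw [← hrs, ← hrs', ← hcαβ], hrs ▸ hαm, hrs' ▸ hβm⟩

/-- There is a place over a double point at which `z` vanishes. -/
theorem IsTower.exists_place_node (ht : IsTower f p 1 1 x y z) (hn : IsNodal f p u v) :
    ∃ P : Place k F, x ∈ P.ring ∧ P.ring.valuation (aeval x u) < 1 ∧
      P.ring.valuation (aeval x p + y) < 1 ∧ P.ring.valuation z < 1 := by
  have := Fact.mk hn.irreducible
  have hu : aeval (AdjoinRoot.root u) u = 0 := by
    rw [AdjoinRoot.aeval_eq, AdjoinRoot.mk_self]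
  have h1 := congrArg (aeval (AdjoinRoot.root u)) hn.norm_eq
  simp only [map_sub, map_mul, map_pow, hu] at h1
  -- Over `k[X]/(u)` the point `(X, -p(X), 0)` lies on the curve, because `u` divides `p² - f` and
  -- `z² = p + y`.
  obtain ⟨P, hx, hP⟩ := ht.exists_place_of_point (K := AdjoinRoot u) (a := AdjoinRoot.root u)
    (b := -aeval (AdjoinRoot.root u) p) (c := 0) ⟨u, hn.irreducible.ne_zero, hu⟩
    (by linear_combination h1) (by simp)
  refine ⟨P, hx, ?_, ?_, ?_⟩
  · simpa [← Polynomial.aeval_algHom_apply] using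
      hP (aeval (.X 0) u) (by simp [← Polynomial.aeval_algHom_apply, hu])
  · simpa [← Polynomial.aeval_algHom_apply] using
      hP (aeval (.X 0) p + .X 1) (by simp [← Polynomial.aeval_algHom_apply])
  · simpa using hP (.X 2) (by simp)

end

end GenusFour

namespace GenusFour

open KaehlerDifferential Polynomial

section

variable {k : Type*} {F : Type*} [Field k] [Field F] [Algebra k F] {f p l φ G₀ G₁ u v : k[X]}
  {m g i j : ℕ} {x y z τ w : F}

/-- `(u / z)² = (p - y) / v` with `v` a unit at `P`. For the second function, `(p + y) / z = z`, and
`p` differs from its remainder by a multiple of `u`. -/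
theorem IsTower.div_mem_of_isNodal (ht : IsTower f p 1 1 x y z) (hn : IsNodal f p u v)
    {P : Place k F} (hx : x ∈ P.ring) (hu : P.ring.valuation (aeval x u) < 1) :
    aeval x u / z ∈ P.ring ∧ (aeval x (p %ₘ u) + y) / z ∈ P.ring := by
  have hz0 := ht.z_ne_zero le_rfl
  obtain ⟨hyP, hzP⟩ := ht.mem_places_affine hx
  have hv0 : aeval x v ≠ 0 := ht.aeval_ne_zero (ht.v_ne_zero hn)
  have h4 : P.ring.valuation (aeval x v) = 1 :=
    Place.valuation_eq_one_of_isCoprime hx hu hn.coprime.of_mul_right_right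
  have h5 : (aeval x u / z) ^ 2 = (aeval x p - y) / aeval x v := by
    rw [div_pow, div_eq_div_iff (pow_ne_zero 2 hz0) hv0, ← ht.norm_eq hn]; ring
  have h6 : aeval x u / z ∈ P.ring := by
    rw [← P.valuation_le_one_iff, ← pow_le_one_iff two_ne_zero, ← map_pow, h5, map_div₀, h4,
      div_one, P.valuation_le_one_iff]
    exact sub_mem (P.aeval_mem hx p) hyP
  refine ⟨h6, ?_⟩
  have h7 := congrArg (aeval x) (modByMonic_add_div p u)
  rw [map_add, map_mul] at h7
  have h8 := ht.pow_eq
  rw [map_one, one_mul] at h8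
  have h9 : (aeval x (p %ₘ u) + y) / z = z - (aeval x u / z) * aeval x (p /ₘ u) := by
    rw [div_eq_iff hz0, sub_mul, mul_right_comm, div_mul_cancel₀ _ hz0]
    linear_combination h7 - h8
  rw [h9]
  exact sub_mem hzP (mul_mem h6 (P.aeval_mem hx _))

/-- At a place where `z` vanishes over a zero of `u`, one has `y ≡ -p`, so `a + b y ≡ a - b p` must
vanish there. -/
theorem IsTower.dvd_of_mem_nodalLE (ht : IsTower f p 1 1 x y z) (hn : IsNodal f p u v) {N : ℕ}
    {a b : k[X]} (h : aeval x a + aeval x b * y ∈ nodalLE k u x z N) : u ∣ a - b * p := by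
  obtain ⟨P, hx, hu, hy, hz⟩ := ht.exists_place_node hn
  have h1 := h.2 P hx hu
  rw [← P.valuation_le_one_iff] at h1
  have h2 : P.ring.valuation (aeval x a + aeval x b * y) < 1 := by
    rw [← div_mul_cancel₀ (aeval x a + aeval x b * y) (ht.z_ne_zero le_rfl), map_mul, mul_comm]
    exact mul_lt_one_of_lt_of_le hz h1
  have h3 : P.ring.valuation (aeval x (a - b * p)) < 1 := by
    have e : aeval x (a - b * p) =
        (aeval x a + aeval x b * y) - (aeval x p + y) * aeval x b := by
      rw [map_sub, map_mul]; ring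
    rw [e]
    refine Valuation.map_sub_lt _ h2 ?_
    rw [map_mul]
    exact mul_lt_one_of_lt_of_le hy ((P.valuation_le_one_iff _).2 (P.aeval_mem hx _))
  by_contra hd
  exact h3.ne (Place.valuation_eq_one_of_isCoprime hx hu
    ((hn.irreducible.coprime_iff_not_dvd).2 hd))

/-- The canonical functions on a double cover of a genus two curve with two double points. -/
theorem IsTower.genus_eq_four_of_isNodal [PerfectField k] (ht : IsTower f p 1 1 x y z)
    (h : IsTowerAtInfinity φ G₀ G₁ 2 i j 1 x y z τ w) (hij : i + 2 * j = 3)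
    (h2 : (2 : k) ≠ 0) (hn : IsNodal f p u v) (hu : u.Monic) (hdeg : u.natDegree = 2) :
    genus k F = 4 := by
  rw [ht.genus_eq_finrank_nodalLE h h2 hn (N := 5) (by omega)]
  set q := p %ₘ u with hq
  have hq1 : q.natDegree ≤ 1 := by
    have := natDegree_modByMonic_lt p hu (by rintro rfl; simp at hdeg)
    rw [← hq] at this
    omega
  -- Order at most `5` at infinity allows `1, x, x², y, z, x z`. The condition `u ∣ a - b p` removes
  -- two dimensions from the part without `z`, leaving multiples of `u` and of `(p mod u) + y`.
  have hind : LinearIndependent k ![aeval x u, aeval x q + y, z, x * z] := by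
    rw [Fintype.linearIndependent_iff]
    intro c hc
    have h1 := ht.indep (fun r => if r = 0 then C (c 0) * u + C (c 1) * q else
        C (c 2) + C (c 3) * X) (fun r => if r = 0 then C (c 1) else 0) (by
        rw [← hc]
        simp [towerSum, Finset.sum_range_succ, Fin.sum_univ_four, Algebra.smul_def]
        ring)
    have h3 := h1 0 (by norm_num)
    have h4 := h1 1 le_rfl
    simp only [if_true, one_ne_zero, if_false, C_eq_zero] at h3 h4
    have h5 := congrArg (fun q => coeff q 0) h4.1
    have h6 := congrArg (fun q => coeff q 1) h4.1
    simp at h5 h6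
    have h7 := h3.1
    rw [h3.2, C_0, zero_mul, add_zero, mul_eq_zero, C_eq_zero] at h7
    intro r
    fin_cases r
    · exact h7.resolve_right hu.ne_zero
    · exact h3.2
    · exact h5
    · exact h6
  have heq : nodalLE k u x z 5 =
      Submodule.span k (Set.range ![aeval x u, aeval x q + y, z, x * z]) := by
    apply le_antisymm
    · intro c hc
      obtain ⟨a, b, a', b', rfl, h3, h4⟩ := ht.exists_components h2 hn hc
      obtain ⟨ha, hb⟩ := h.degree_le ht (r := 0) (e := 5) (by simpa using h3.1) (by omega)
      obtain ⟨ha', hb'⟩ := h.degree_le ht (r := 1) (e := 2) (by simpa using h4.1) (by omega)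
      have hb0 : b.natDegree = 0 := by
        rcases hb with hb | hb
        · rw [hb]; simp
        · omega
      have hb0' : b' = 0 := hb'.resolve_right (by omega)
      obtain ⟨s, hs⟩ := ht.dvd_of_mem_nodalLE hn h3
      have hdiv := modByMonic_add_div p u
      rw [← hq] at hdiv
      have hr : a = b * q + u * (b * (p /ₘ u) + s) := by
        linear_combination hs + b * hdiv.symm
      have hadeg : a.natDegree ≤ 2 := natDegree_le_of_or ha (by norm_num)
      have hr0 : (b * (p /ₘ u) + s).natDegree = 0 := by
        by_contra hne
        have hne0 : b * (p /ₘ u) + s ≠ 0 := by intro h0; simp [h0] at hne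
        have h5 : (u * (b * (p /ₘ u) + s)).natDegree = 2 + (b * (p /ₘ u) + s).natDegree := by
          rw [natDegree_mul hu.ne_zero hne0, hdeg]
        have h6 : (u * (b * (p /ₘ u) + s)).natDegree ≤ 2 := by
          have e : u * (b * (p /ₘ u) + s) = a - b * q := by rw [hr]; ring
          rw [e]
          refine (natDegree_sub_le _ _).trans (max_le hadeg ?_)
          exact natDegree_mul_le.trans (by omega)
        omega
      have hsub := Submodule.subset_span (R := k)
        (s := Set.range ![aeval x u, aeval x q + y, z, x * z])
      have e0 := hsub ⟨0, rfl⟩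
      have e1 := hsub ⟨1, rfl⟩
      have e2 := hsub ⟨2, rfl⟩
      have e3 := hsub ⟨3, rfl⟩
      have hfin : (aeval x a + aeval x b * y) + (aeval x a' + aeval x b' * y) * z =
          (b * (p /ₘ u) + s).coeff 0 • aeval x u + b.coeff 0 • (aeval x q + y) +
            (a'.coeff 0 • z + a'.coeff 1 • (x * z)) := by
        rw [hb0', map_zero, zero_mul, add_zero,
          aeval_eq_of_natDegree_le_one (natDegree_le_of_or ha' (by norm_num)), hr, map_add,
          map_mul, map_mul, aeval_eq_of_natDegree_eq_zero hb0, aeval_eq_of_natDegree_eq_zero hr0]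
        simp only [Algebra.smul_def]
        ring
      rw [hfin]
      exact add_mem (add_mem (Submodule.smul_mem _ _ e0) (Submodule.smul_mem _ _ e1))
        (add_mem (Submodule.smul_mem _ _ e2) (Submodule.smul_mem _ _ e3))
    · rw [Submodule.span_le]
      have hz0 := ht.z_ne_zero le_rfl
      have hsub := Algebra.subset_adjoin (R := k) (s := {x, y, z})
      have hxm : x ∈ Algebra.adjoin k {x, y, z} := hsub (by simp)
      have hy5 : y ∈ polesLE k x 5 :=
        ht.mem_polesLE h (n := 5) le_rfl (hsub (by simp)) fun P hP => h.valuation_y hP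
      have hx5 : x ∈ polesLE k x 5 :=
        ht.mem_polesLE h (n := 2) (by norm_num) hxm fun P hP => h.valuation_x hP
      have h15 : (1 : F) ∈ polesLE k x 5 :=
        ht.mem_polesLE h (n := 0) (by norm_num) (one_mem _) fun P _ => by simp
      have hq5 : aeval x q ∈ polesLE k x 5 := by
        rw [aeval_eq_of_natDegree_le_one hq1]
        exact add_mem (Submodule.smul_mem _ _ h15) (Submodule.smul_mem _ _ hx5)
      rintro _ ⟨r, rfl⟩
      fin_cases r
      · refine ⟨ht.mem_polesLE h (n := 4) (by norm_num) (aeval_mem_subalgebra hxm u)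
          fun P hP => ?_, fun P hP hu' => (ht.div_mem_of_isNodal hn hP hu').1⟩
        have := h.valuation_aeval hP hu.ne_zero
        rwa [hdeg] at this
      · exact ⟨add_mem hq5 hy5, fun P hP hu' => (ht.div_mem_of_isNodal hn hP hu').2⟩
      · refine ⟨ht.mem_polesLE h (n := 3) (by norm_num) (hsub (by simp))
          fun P hP => hij ▸ h.valuation_z hP, fun P hP hu' => ?_⟩
        show z / z ∈ _
        rw [div_self hz0]
        exact one_mem _
      · refine ⟨ht.mem_polesLE h (n := 5) le_rfl (mul_mem hxm (hsub (by simp)))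
          fun P hP => ?_, fun P hP hu' => ?_⟩
        · show P.ring.valuation (x * z) = _
          rw [map_mul, h.valuation_x hP, h.valuation_z hP, hij, ← pow_add]
        · show x * z / z ∈ _
          rwa [mul_div_cancel_right₀ _ hz0]
  rw [heq, finrank_span_eq_card hind, Fintype.card_fin]

end

end GenusFour

/-! ### Polynomials as lists of integers, and decidable certificates. -/

namespace GenusFour

open Polynomial

/-- The polynomial with the given list of coefficients, starting with the constant one. -/
noncomputable def ofList (k : Type*) [Field k] : List ℤ → k[X]
  | [] => 0
  | a :: L => C (a : k) + X * ofList k L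

/-- Sum of lists of coefficients. -/
def listAdd : List ℤ → List ℤ → List ℤ
  | [], M => M
  | a :: L, [] => a :: L
  | a :: L, b :: M => (a + b) :: listAdd L M

/-- Product of lists of coefficients. -/
def listMul : List ℤ → List ℤ → List ℤ
  | [], _ => []
  | a :: L, M => listAdd (M.map (a * ·)) (0 :: listMul L M)

/-- Derivative of a list of coefficients. -/
def listDeriv : List ℤ → List ℤ
  | [] => []
  | _ :: L => listAdd L (0 :: listDeriv L)

/-- Power of a list of coefficients. -/
def listPow (L : List ℤ) : ℕ → List ℤ
  | 0 => [1]
  | n + 1 => listMul (listPow L n) L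

section

variable (k : Type*) [Field k]

theorem ofList_add (L M : List ℤ) : ofList k (listAdd L M) = ofList k L + ofList k M := by
  induction L generalizing M with
  | nil => simp [listAdd, ofList]
  | cons a L ih =>
    cases M with
    | nil => simp [listAdd, ofList]
    | cons b M => simp only [listAdd, ofList, ih, Int.cast_add, C_add]; ring

theorem ofList_map (a : ℤ) (L : List ℤ) : ofList k (L.map (a * ·)) = C (a : k) * ofList k L := by
  induction L with
  | nil => simp [ofList]
  | cons b L ih => simp only [List.map_cons, ofList, ih, Int.cast_mul, C_mul]; ring

theorem ofList_mul (L M : List ℤ) : ofList k (listMul L M) = ofList k L * ofList k M := by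
  induction L with
  | nil => simp [listMul, ofList]
  | cons a L ih =>
    simp only [listMul, ofList_add, ofList_map, ofList, ih, Int.cast_zero, C_0]; ring

theorem ofList_deriv (L : List ℤ) : ofList k (listDeriv L) = derivative (ofList k L) := by
  induction L with
  | nil => simp [listDeriv, ofList]
  | cons a L ih =>
    simp only [listDeriv, ofList_add, ofList, ih, Int.cast_zero, C_0, derivative_add,
      derivative_C, derivative_mul, derivative_X]; ring

theorem ofList_pow (L : List ℤ) (n : ℕ) : ofList k (listPow L n) = ofList k L ^ n := by
  induction n with
  | zero => simp [listPow, ofList]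
  | succ n ih => rw [listPow, ofList_mul, ih, pow_succ]

theorem ofList_eq_zero {q : ℕ} [CharP k q] {L : List ℤ} (h : ∀ a ∈ L, (q : ℤ) ∣ a) :
    ofList k L = 0 := by
  induction L with
  | nil => rfl
  | cons a L ih =>
    rw [ofList, ih fun b hb => h b (List.mem_cons_of_mem _ hb),
      (CharP.intCast_eq_zero_iff k q a).2 (h a List.mem_cons_self)]
    simp

end

/-- Coefficients of the polynomials that certify smoothness. -/
structure SmoothCertificate where
  α : List ℤ
  β : List ℤ
  a : List ℤ
  b : List ℤ
  c : List ℤ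
  d : List ℤ
  N : ℕ

/-- The certificate is valid for `y² = f(x)`, `zⁿ = p(x) + l(x) y` modulo `q` where `u(x) ≠ 0`. -/
def SmoothCertificate.Valid (S : SmoothCertificate) (q : ℕ) (f p l u : List ℤ) : Prop :=
  (∀ t ∈ listAdd (listAdd (listMul S.α f) (listMul S.β (listDeriv f))) [-1], (q : ℤ) ∣ t) ∧
  (∀ t ∈ listAdd (listAdd (listAdd (listMul S.a p) (listMul (listMul S.b l) f))
    (listAdd (listMul S.c (listAdd (listMul (listMul [2] (listDeriv l)) f)
      (listMul l (listDeriv f)))) (listMul (listMul (listMul [2] S.d) (listDeriv p)) f)))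
    (listMul [-1] (listPow u S.N)), (q : ℤ) ∣ t) ∧
  ∀ t ∈ listAdd (listAdd (listMul S.a l) (listMul S.b p))
    (listAdd (listMul (listMul [2] S.c) (listDeriv p))
      (listMul S.d (listAdd (listMul (listMul [2] (listDeriv l)) f)
        (listMul l (listDeriv f))))), (q : ℤ) ∣ t

instance (S : SmoothCertificate) (q : ℕ) (f p l u : List ℤ) : Decidable (S.Valid q f p l u) := by
  unfold SmoothCertificate.Valid
  infer_instance

theorem SmoothCertificate.Valid.isSmoothAway {S : SmoothCertificate} {q : ℕ} {f p l u : List ℤ}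
    (h : S.Valid q f p l u) (k : Type*) [Field k] [CharP k q] :
    IsSmoothAway (ofList k f) (ofList k p) (ofList k l) (ofList k u) := by
  obtain ⟨h1, h2, h3⟩ := h
  have h1 := ofList_eq_zero k h1
  have h2 := ofList_eq_zero k h2
  have h3 := ofList_eq_zero k h3
  have e1 : ofList k [-1] = -1 := by simp [ofList]
  have e2 : ofList k [2] = 2 := by
    simp only [ofList, mul_zero, add_zero, Int.cast_ofNat]
    exact map_ofNat C 2
  simp only [ofList_add, ofList_mul, ofList_deriv, ofList_pow, e1, e2] at h1 h2 h3
  refine ⟨⟨ofList k S.α, ofList k S.β, by linear_combination h1⟩,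
    ⟨ofList k S.a, ofList k S.b, ofList k S.c, ofList k S.d, S.N, ?_, ?_⟩⟩
  · linear_combination h2
  · linear_combination h3

/-! ### Computable arithmetic in finite fields and point counts. -/

/-- Computable arithmetic on the natural numbers below `card`. -/
structure Arith where
  card : ℕ
  add : ℕ → ℕ → ℕ
  mul : ℕ → ℕ → ℕ
  int : ℤ → ℕ

namespace Arith

/-- Arithmetic modulo `q`. -/
def modulo (q : ℕ) : Arith where
  card := q
  add a b := (a + b) % q
  mul a b := a * b % q
  int c := (c % q).toNat

/-- Arithmetic on `a + b i`, written as `a + q b`, modulo `q`. -/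
def gaussian (q : ℕ) : Arith where
  card := q * q
  add a b := (a % q + b % q) % q + q * ((a / q + b / q) % q)
  -- The factor `q - 1` stands for `i² = -1`.
  mul a b := (a % q * (b % q) + (q - 1) * (a / q * (b / q))) % q +
    q * ((a % q * (b / q) + a / q * (b % q)) % q)
  int c := (c % q).toNat

variable (A : Arith)

/-- The value of a polynomial. -/
def eval (t : ℕ) : List ℤ → ℕ
  | [] => A.int 0
  | c :: L => A.add (A.int c) (A.mul t (eval t L))

def pow (t : ℕ) : ℕ → ℕ
  | 0 => A.int 1
  | n + 1 => A.mul (pow t n) t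

/-- The number of solutions of `y² = f(x)`, `zᵐ⁺¹ = p(x) + l(x) y`. -/
def affineCount (f p l : List ℤ) (m : ℕ) : ℕ :=
  ((List.range A.card).map fun a => ((List.range A.card).map fun b =>
    if A.mul b b = A.eval a f then ((List.range A.card).map fun c =>
      if A.pow c (m + 1) = A.add (A.eval a p) (A.mul (A.eval a l) b) then 1 else 0).sum
    else 0).sum).sum

/-- The number of solutions of `sᵐ⁺¹ = c`. -/
def rootCount (c : ℤ) (m : ℕ) : ℕ :=
  ((List.range A.card).map fun s => if A.pow s (m + 1) = A.int c then 1 else 0).sum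

/-- The field `k` is given by the arithmetic `A` by means of the enumeration `e`. -/
structure Represents {k : Type*} [Field k] (e : ℕ → k) : Prop where
  inj : ∀ a < A.card, ∀ b < A.card, e a = e b → a = b
  surj : ∀ t, ∃ a < A.card, e a = t
  add_lt : ∀ a b, A.add a b < A.card
  mul_lt : ∀ a b, A.mul a b < A.card
  int_lt : ∀ c, A.int c < A.card
  map_add : ∀ a b, e (A.add a b) = e a + e b
  map_mul : ∀ a b, e (A.mul a b) = e a * e b
  map_int : ∀ c, e (A.int c) = (c : k)

namespace Represents

variable {A} {k : Type*} [Field k] {e : ℕ → k} (h : A.Represents e)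

include h

theorem map_eval (t : ℕ) (L : List ℤ) : e (A.eval t L) = (ofList k L).eval (e t) := by
  induction L with
  | nil => simp [Arith.eval, ofList, h.map_int]
  | cons c L ih => simp [Arith.eval, ofList, h.map_add, h.map_int, h.map_mul, ih]

theorem map_pow (t n : ℕ) : e (A.pow t n) = e t ^ n := by
  induction n with
  | zero => simp [Arith.pow, h.map_int]
  | succ n ih => rw [Arith.pow, h.map_mul, ih, pow_succ]

theorem eval_lt (t : ℕ) (L : List ℤ) : A.eval t L < A.card := by
  cases L
  · exact h.int_lt 0
  · exact h.add_lt _ _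

theorem pow_lt (t n : ℕ) : A.pow t n < A.card := by
  cases n
  · exact h.int_lt 1
  · exact h.mul_lt _ _

theorem eq_iff {a b : ℕ} (ha : a < A.card) (hb : b < A.card) : e a = e b ↔ a = b :=
  ⟨h.inj a ha b hb, fun h => h ▸ rfl⟩

theorem bijective : Function.Bijective fun a : Fin A.card => e a :=
  ⟨fun a b hab => Fin.ext (h.inj a a.2 b b.2 hab), fun t => by
    obtain ⟨a, ha, rfl⟩ := h.surj t
    exact ⟨⟨a, ha⟩, rfl⟩⟩

omit h in
theorem sum_map_range (n : ℕ) (F : ℕ → ℕ) : ((List.range n).map F).sum = ∑ i : Fin n, F i := by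
  induction n with
  | zero => simp
  | succ n ih => simp [List.range_succ, Fin.sum_univ_castSucc, ih]

theorem card_affinePoint (f p l : List ℤ) (m : ℕ) :
    Nat.card (AffinePoint (ofList k f) (ofList k p) (ofList k l) m) = A.affineCount f p l m := by
  let E : Fin A.card ≃ k := Equiv.ofBijective _ h.bijective
  have hE : ∀ a, E a = e a := fun _ => rfl
  have h1 : Nat.card {s : Fin A.card × Fin A.card × Fin A.card //
      A.mul s.2.1 s.2.1 = A.eval s.1 f ∧
        A.pow s.2.2 (m + 1) = A.add (A.eval s.1 p) (A.mul (A.eval s.1 l) s.2.1)} =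
      Nat.card (AffinePoint (ofList k f) (ofList k p) (ofList k l) m) := by
    refine Nat.card_congr ((E.prodCongr (E.prodCongr E)).subtypeEquiv fun s => ?_)
    simp only [Equiv.prodCongr_apply, Prod.map_fst, Prod.map_snd, hE]
    rw [← h.eq_iff (h.mul_lt _ _) (h.eval_lt _ _), ← h.eq_iff (h.pow_lt _ _) (h.add_lt _ _),
      h.map_mul, h.map_pow, h.map_add, h.map_mul, h.map_eval, h.map_eval, h.map_eval, pow_two]
  rw [← h1, Nat.card_eq_fintype_card, Fintype.card_subtype, Finset.card_filter,
    Fintype.sum_prod_type, affineCount, sum_map_range]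
  refine Finset.sum_congr rfl fun a _ => ?_
  rw [Fintype.sum_prod_type, sum_map_range]
  refine Finset.sum_congr rfl fun b _ => ?_
  by_cases hb : A.mul b b = A.eval a f
  · simp only [hb, true_and, if_true, sum_map_range]
  · simp [hb]

theorem card_infinitePoint (φ G₀ : List ℤ) (c : ℤ) (m : ℕ) :
    Nat.card (InfinitePoint (ofList k (1 :: φ)) (ofList k (c :: G₀)) m) = A.rootCount c m := by
  let E : Fin A.card ≃ k := Equiv.ofBijective _ h.bijective
  have hE : ∀ a, E a = e a := fun _ => rfl
  have h1 : Nat.card {s : Fin A.card // A.pow s (m + 1) = A.int c} =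
      Nat.card (InfinitePoint (ofList k (1 :: φ)) (ofList k (c :: G₀)) m) := by
    refine Nat.card_congr (E.subtypeEquiv fun s => ?_)
    rw [← h.eq_iff (h.pow_lt _ _) (h.int_lt _), h.map_pow, h.map_int]
    simp [ofList, hE]
  rw [← h1, Nat.card_eq_fintype_card, Fintype.card_subtype, Finset.card_filter, rootCount,
    sum_map_range]

theorem pow_ne (p l : List ℤ) {m a b : ℕ}
    (hne : ∀ c < A.card, A.pow c (m + 1) ≠ A.add (A.eval a p) (A.mul (A.eval a l) b)) (c : k) :
    c ^ (m + 1) ≠ (ofList k p).eval (e a) + (ofList k l).eval (e a) * e b := by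
  obtain ⟨c, hc, rfl⟩ := h.surj c
  rw [← h.map_pow, ← h.map_eval, ← h.map_eval, ← h.map_mul, ← h.map_add, Ne,
    h.eq_iff (h.pow_lt _ _) (h.add_lt _ _)]
  exact hne c hc

end Represents

theorem modulo_represents {q : ℕ} [Fact q.Prime] {k : Type*} [Field k] (hk : Nat.card k = q) :
    (modulo q).Represents (Nat.cast : ℕ → k) := by
  have hq : 0 < q := (Fact.out : q.Prime).pos
  have : Finite k := Nat.finite_of_card_ne_zero (by omega)
  have := Fintype.ofFinite k
  have hk' : Fintype.card k = q := by rw [← Nat.card_eq_fintype_card, hk]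
  have : CharP k q := charP_of_card_eq_prime hk'
  have hmod : ∀ a : ℕ, ((a % q : ℕ) : k) = a := fun a => (CharP.natCast_eq_natCast_mod k q a).symm
  have hinj : ∀ a < q, ∀ b < q, (a : k) = b → a = b := fun a ha b hb hab => by
    have := (CharP.natCast_eq_natCast k q).1 hab
    rwa [Nat.ModEq, Nat.mod_eq_of_lt ha, Nat.mod_eq_of_lt hb] at this
  refine ⟨hinj, fun t => ?_, fun a b => Nat.mod_lt _ hq, fun a b => Nat.mod_lt _ hq, fun c => ?_,
    fun a b => ?_, fun a b => ?_, fun c => ?_⟩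
  · have hb : Function.Bijective fun a : Fin q => (a : k) :=
      (Fintype.bijective_iff_injective_and_card _).2
        ⟨fun a b hab => Fin.ext (hinj a a.2 b b.2 hab), by rw [Fintype.card_fin, hk']⟩
    obtain ⟨a, ha⟩ := hb.2 t
    exact ⟨a, a.2, ha⟩
  · show (c % q).toNat < q
    have := Int.emod_lt_of_pos c (by omega : (0 : ℤ) < q)
    omega
  · show (((a + b) % q : ℕ) : k) = _
    rw [hmod, Nat.cast_add]
  · show ((a * b % q : ℕ) : k) = _
    rw [hmod, Nat.cast_mul]
  · show (((c % q).toNat : ℕ) : k) = c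
    have h1 : (((c % q).toNat : ℕ) : ℤ) = c % q :=
      Int.toNat_of_nonneg (Int.emod_nonneg _ (by omega))
    have h2 := congrArg (Int.cast : ℤ → k) h1
    rw [Int.cast_natCast] at h2
    rw [h2]
    exact (CharP.intCast_eq_intCast k q).2 (Int.mod_modEq c q)

/-- For `q ≡ 3` modulo `4`, `-1` is a square in the field with `q²` elements but not in the prime
field. So `1` and a root `ι` of `-1` form a basis, and the base `q` digits of a number are its
coordinates. -/
theorem gaussian_represents {q : ℕ} [Fact q.Prime] (hq3 : q % 4 = 3) {k : Type*} [Field k]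
    (hk : Nat.card k = q ^ 2) : ∃ e : ℕ → k, (gaussian q).Represents e := by
  have hq : 0 < q := (Fact.out : q.Prime).pos
  have hqq : 0 < q * q := Nat.mul_pos hq hq
  rw [pow_two] at hk
  have : Finite k := Nat.finite_of_card_ne_zero (by omega)
  have := Fintype.ofFinite k
  have hk' : Fintype.card k = q * q := by rw [← Nat.card_eq_fintype_card, hk]
  have : CharP k q := charP_of_card_eq_prime_pow (hk'.trans (pow_two q).symm)
  have hmod : ∀ a : ℕ, ((a % q : ℕ) : k) = a := fun a => (CharP.natCast_eq_natCast_mod k q a).symm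
  obtain ⟨ι, hι⟩ : IsSquare (-1 : k) := by
    rw [FiniteField.isSquare_neg_one_iff, hk', Nat.mul_mod, hq3]
    norm_num
  have hinj : ∀ a b c d : ℕ, (a : k) + b * ι = c + d * ι → a % q = c % q ∧ b % q = d % q := by
    let φ : ZMod q →+* k := ZMod.castHom dvd_rfl k
    intro a b c d habcd
    have h1 : φ ((a : ZMod q) - c) + φ ((b : ZMod q) - d) * ι = 0 := by
      simp only [map_sub, map_natCast]
      linear_combination habcd
    have h2 : (b : ZMod q) - d = 0 := by
      by_contra hne
      have h3 : φ ((b : ZMod q) - d) ≠ 0 := (_root_.map_ne_zero _).2 hne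
      have h4 : φ (((a : ZMod q) - c) / (b - d)) = -ι := by
        rw [map_div₀, div_eq_iff h3]
        linear_combination h1
      have h5 : φ ((((a : ZMod q) - c) / (b - d)) * (((a : ZMod q) - c) / (b - d))) =
          φ (-1) := by
        rw [map_mul, h4, map_neg, map_one, hι]; ring
      exact ZMod.exists_sq_eq_neg_one_iff.1 ⟨_, (φ.injective h5).symm⟩ hq3
    rw [h2, map_zero, zero_mul, add_zero, map_eq_zero] at h1
    exact ⟨(ZMod.natCast_eq_natCast_iff _ _ _).1 (sub_eq_zero.1 h1),
      (ZMod.natCast_eq_natCast_iff _ _ _).1 (sub_eq_zero.1 h2)⟩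
  let e : ℕ → k := fun n => (n : k) + ((n / q : ℕ) : k) * ι
  have hdig : ∀ r s : ℕ, e (r % q + q * s) = r + s * ι := fun r s => by
    show ((r % q + q * s : ℕ) : k) + (((r % q + q * s) / q : ℕ) : k) * ι = _
    rw [Nat.add_mul_div_left _ _ hq, Nat.div_eq_of_lt (Nat.mod_lt r hq), zero_add, Nat.cast_add,
      Nat.cast_mul, hmod, CharP.cast_eq_zero k q, zero_mul, add_zero]
  have hlt : ∀ r s : ℕ, r % q + q * (s % q) < q * q := fun r s => by
    have h1 := Nat.mod_lt r hq
    have h2 := Nat.mul_le_mul_left q (Nat.succ_le_of_lt (Nat.mod_lt s hq))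
    rw [Nat.mul_succ] at h2
    omega
  have he : ∀ a < q * q, ∀ b < q * q, e a = e b → a = b := fun a ha b hb hab => by
    obtain ⟨h1, h2⟩ := hinj _ _ _ _ hab
    rw [Nat.mod_eq_of_lt (Nat.div_lt_of_lt_mul ha), Nat.mod_eq_of_lt (Nat.div_lt_of_lt_mul hb)]
      at h2
    rw [← Nat.mod_add_div a q, ← Nat.mod_add_div b q, h1, h2]
  have hint : ∀ c : ℤ, (c % q).toNat < q := fun c => by
    have := Int.emod_lt_of_pos c (by omega : (0 : ℤ) < q)
    omega
  refine ⟨e, he, fun t => ?_, fun a b => hlt _ _, fun a b => hlt _ _, fun c => ?_,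
    fun a b => ?_, fun a b => ?_, fun c => ?_⟩
  · have hb : Function.Bijective fun a : Fin (q * q) => e a :=
      (Fintype.bijective_iff_injective_and_card _).2
        ⟨fun a b hab => Fin.ext (he a a.2 b b.2 hab), by rw [Fintype.card_fin, hk']⟩
    obtain ⟨a, ha⟩ := hb.2 t
    exact ⟨a, a.2, ha⟩
  · exact (hint c).trans_le (Nat.le_mul_of_pos_left q hq)
  · refine (hdig _ _).trans ?_
    simp only [hmod, Nat.cast_add, e]
    ring
  · refine (hdig _ _).trans ?_
    have h1 : ((q - 1 : ℕ) : k) = -1 := by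
      rw [Nat.cast_sub (by omega), CharP.cast_eq_zero k q]; simp
    simp only [hmod, Nat.cast_add, Nat.cast_mul, h1, e]
    linear_combination (((a / q : ℕ) : k) * ((b / q : ℕ) : k)) * hι
  · show ((c % q).toNat : k) + (((c % q).toNat / q : ℕ) : k) * ι = c
    rw [Nat.div_eq_of_lt (hint c), Nat.cast_zero, zero_mul, add_zero]
    have h1 : (((c % q).toNat : ℕ) : ℤ) = c % q :=
      Int.toNat_of_nonneg (Int.emod_nonneg _ (by omega))
    have h2 := congrArg (Int.cast : ℤ → k) h1
    rw [Int.cast_natCast] at h2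
    rw [h2]
    exact (CharP.intCast_eq_intCast k q).2 (Int.mod_modEq c q)

end Arith

end GenusFour

/-! ### From certificates to curves of genus four. -/

namespace GenusFour

open Polynomial

/-- `y² = f(x)`, `zᵐ⁺¹ = p(x) + l(x) y` is a curve of genus four with `N` rational points. -/
structure IsGenusFourTower {k : Type} [Field k] (f p l : k[X]) (m N : ℕ) : Prop where
  exists_isTower : ∃ (F : Type) (_ : Field F) (_ : Algebra k F) (x y z : F), IsTower f p l m x y z
  genus_and_card : ∀ (F : Type) [Field F] [Algebra k F] (x y z : F), IsTower f p l m x y z →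
    IsCurveFunctionField k F ∧ genus k F = 4 ∧ Nat.card (RationalPoint k F) = N

section

variable {k : Type} [Field k] {A : Arith} {e : ℕ → k} {q : ℕ} [CharP k q]

/-- `(a, b)` is a point of the base curve at which `h` is not an `(m + 1)`-th power, which gives
existence. The count being nonzero yields a rational place, and with it the constants. -/
theorem isGenusFourTower_of_represents (hA : A.Represents e) {f p l u φ G₀ : List ℤ} {c : ℤ}
    {m g N a b : ℕ} (h2 : (2 : k) ≠ 0) (hm : ((m + 1 : ℕ) : k) ≠ 0) (hm' : (m + 1).Prime) {ζ : k}
    (hζ : IsPrimitiveRoot ζ (m + 1)) {S : SmoothCertificate} (hS : S.Valid q f p l u)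
    (hu : ∀ t, (ofList k u).eval t ≠ 0) (hdeg : (ofList k f).natDegree = 2 * g + 1)
    (hab : A.mul b b = A.eval a f)
    (hne : ∀ c < A.card, A.pow c (m + 1) ≠ A.add (A.eval a p) (A.mul (A.eval a l) b))
    (hcount : A.affineCount f p l m + A.rootCount c m = N) (hN : N ≠ 0)
    (h : ∀ (F : Type) [Field F] [Algebra k F] (x y z : F),
      IsTower (ofList k f) (ofList k p) (ofList k l) m x y z → genus k F = 4 ∧
        ∃ (G₁ : k[X]) (i j : ℕ) (τ w : F), IsTowerAtInfinity (ofList k (1 :: φ))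
          (ofList k (c :: G₀)) G₁ g i j m x y z τ w) :
    IsGenusFourTower (ofList k f) (ofList k p) (ofList k l) m N := by
  have : Finite k := Finite.of_surjective _ hA.bijective.2
  have hs := hS.isSmoothAway k
  obtain ⟨α, β, hαβ⟩ := hs.base
  refine ⟨exists_isTower h2 hdeg hαβ hm' (x₀ := e a) (y₀ := e b) ?_ (hA.pow_ne p l hne),
    fun F _ _ x y z ht => ?_⟩
  · rw [← hA.map_eval, ← hab, hA.map_mul, pow_two]
  obtain ⟨hg, G₁, i, j, τ, w, hinf⟩ := h F x y z ht
  have hcard : Nat.card (RationalPoint k F) = N := by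
    rw [ht.card_rationalPoint hinf h2 hm hζ hs hu, hA.card_affinePoint, hA.card_infinitePoint,
      hcount]
  refine ⟨ht.isCurveFunctionField ?_, hg, hcard⟩
  have hne : Nonempty (RationalPoint k F) := (Nat.card_pos_iff.1 (by omega)).1
  obtain ⟨P⟩ := hne
  exact fun a ha => Place.constants P.2 ha

variable {F : Type*} [Field F] [Algebra k F] {x y z : F}

theorem intCast_ne_zero_of_not_dvd {c : ℤ} (h : ¬ (q : ℤ) ∣ c) : (c : k) ≠ 0 :=
  fun h0 => h ((CharP.intCast_eq_zero_iff k q c).1 h0)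

/-- Here `w = z / y` and `w² φ(1/x) = h / x³`. The part `p / x³` is the reversed `p`, and `l y / x³
= τ (l / x) φ(1/x)`. The constant term `c` decides the points at infinity. -/
theorem IsTower.isTowerAtInfinity_two {a₀ a₁ a₂ p₀ p₁ p₂ c r s : ℤ}
    (ht : IsTower (ofList k [a₀, a₁, a₂, 1]) (ofList k [p₀, p₁, p₂, c]) (ofList k [r, s]) 1 x y z)
    (hc : ¬ (q : ℤ) ∣ c) :
    IsTowerAtInfinity (ofList k [1, a₂, a₁, a₀]) (ofList k [c, p₂, p₁, p₀])
      (ofList k (listMul [s, r] [1, a₂, a₁, a₀])) 1 1 1 1 x y z (x / y) (z * (x / y) * x⁻¹) := by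
  have hx := ht.x_ne_zero
  have hy := ht.y_ne_zero
  have h1 := ht.sq_eq
  have h2 := ht.pow_eq
  rw [ofList_mul]
  simp only [ofList, map_add, map_mul, aeval_X, map_intCast, mul_zero, add_zero,
    Int.cast_one, map_one] at h1 h2 ⊢
  refine ⟨by field_simp, by simp, ?_, ?_, ?_, ?_⟩
  · simp only [map_add, map_mul, aeval_X, map_intCast, map_one]
    field_simp
    linear_combination h1
  · simp only [map_add, map_mul, aeval_X, map_intCast, map_one]
    field_simp
    have h3 : x ^ 3 + (x ^ 2 * (a₂ : F) + (x * (a₁ : F) + (a₀ : F))) = y ^ 2 := by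
      rw [h1]; ring
    rw [h3, div_pow, h2]
    field_simp
    ring
  · simp
  · simpa using intCast_ne_zero_of_not_dvd hc

/-- Here `w = z τ` and `w³ φ(1/x) = z³ / y = 1 + p / y`, where `p / y = τ (p₁ + p₀ / x)`. -/
theorem IsTower.isTowerAtInfinity_three {a₀ a₁ a₂ p₀ p₁ : ℤ}
    (ht : IsTower (ofList k [a₀, a₁, a₂, 1]) (ofList k [p₀, p₁]) (ofList k [1]) 2 x y z) :
    IsTowerAtInfinity (ofList k [1, a₂, a₁, a₀]) (ofList k [1]) (ofList k [p₁, p₀])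
      1 1 0 2 x y z (x / y) (z * (x / y)) := by
  have hx := ht.x_ne_zero
  have hy := ht.y_ne_zero
  have h1 := ht.sq_eq
  have h2 := ht.pow_eq
  simp only [ofList, map_add, map_mul, aeval_X, map_intCast, mul_zero, add_zero,
    Int.cast_one, map_one] at h1 h2 ⊢
  refine ⟨by field_simp, by simp, ?_, ?_, ?_, ?_⟩
  · simp only [map_add, map_mul, aeval_X, map_intCast, map_one]
    field_simp
    linear_combination h1
  · simp only [map_add, map_mul, aeval_X, map_intCast, map_one]
    field_simp
    have h3 : x ^ 3 + (x ^ 2 * (a₂ : F) + (x * (a₁ : F) + (a₀ : F))) = y ^ 2 := by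
      rw [h1]; ring
    rw [h3, div_pow, mul_pow, h2]
    field_simp
    ring
  · simp
  · simp

/-- Here `w = z x / y` and `w² φ(1/x) = h / x³`, where `y / x³ = τ φ(1/x)`. -/
theorem IsTower.isTowerAtInfinity_five {a₀ a₁ a₂ a₃ a₄ p₀ p₁ p₂ c : ℤ}
    (ht : IsTower (ofList k [a₀, a₁, a₂, a₃, a₄, 1]) (ofList k [p₀, p₁, p₂, c]) (ofList k [1])
      1 x y z) (hc : ¬ (q : ℤ) ∣ c) :
    IsTowerAtInfinity (ofList k [1, a₄, a₃, a₂, a₁, a₀]) (ofList k [c, p₂, p₁, p₀])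
      (ofList k [1, a₄, a₃, a₂, a₁, a₀]) 2 1 1 1 x y z (x ^ 2 / y)
      (z * (x ^ 2 / y) * x⁻¹) := by
  have hx := ht.x_ne_zero
  have hy := ht.y_ne_zero
  have h1 := ht.sq_eq
  have h2 := ht.pow_eq
  simp only [ofList, map_add, map_mul, aeval_X, map_intCast, mul_zero, add_zero,
    Int.cast_one, map_one] at h1 h2 ⊢
  refine ⟨by field_simp, by simp, ?_, ?_, ?_, ?_⟩
  · simp only [map_add, map_mul, aeval_X, map_intCast, map_one]
    field_simp
    linear_combination h1
  · simp only [map_add, map_mul, aeval_X, map_intCast, map_one]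
    field_simp
    have h3 : x ^ 5 + (x ^ 4 * (a₄ : F) + (x ^ 3 * (a₃ : F) +
        (x ^ 2 * (a₂ : F) + (x * (a₁ : F) + (a₀ : F))))) = y ^ 2 := by
      rw [h1]; ring
    rw [h3, div_pow, mul_pow, h2]
    field_simp
    ring
  · simp
  · simpa using intCast_ne_zero_of_not_dvd hc

end

end GenusFour

namespace GenusFour

open Polynomial

section

variable {k : Type} [Field k] {A : Arith} {e : ℕ → k} {q : ℕ} [CharP k q]

theorem ofList_one : ofList k [1] = 1 := by simp [ofList]

theorem natDegree_ofList_cubic (a₀ a₁ a₂ : ℤ) : (ofList k [a₀, a₁, a₂, 1]).natDegree = 3 := by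
  simp only [ofList, Int.cast_one, map_one, mul_zero, add_zero, mul_one]
  compute_degree!

theorem natDegree_ofList_quintic (a₀ a₁ a₂ a₃ a₄ : ℤ) :
    (ofList k [a₀, a₁, a₂, a₃, a₄, 1]).natDegree = 5 := by
  simp only [ofList, Int.cast_one, map_one, mul_zero, add_zero, mul_one]
  compute_degree!

theorem two_ne_zero_of_not_dvd (h : ¬ (q : ℤ) ∣ 2) : (2 : k) ≠ 0 := by
  exact_mod_cast intCast_ne_zero_of_not_dvd (k := k) h

/-- Double covers of elliptic curves. -/
theorem isGenusFourTower_two (hA : A.Represents e) {a₀ a₁ a₂ p₀ p₁ p₂ c r s : ℤ}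
    {S : SmoothCertificate} {a b N : ℕ}
    (h : S.Valid q [a₀, a₁, a₂, 1] [p₀, p₁, p₂, c] [r, s] [1] ∧ ¬ (q : ℤ) ∣ 2 ∧ ¬ (q : ℤ) ∣ c ∧
      A.mul b b = A.eval a [a₀, a₁, a₂, 1] ∧
      (∀ t < A.card, A.pow t 2 ≠
        A.add (A.eval a [p₀, p₁, p₂, c]) (A.mul (A.eval a [r, s]) b)) ∧
      A.affineCount [a₀, a₁, a₂, 1] [p₀, p₁, p₂, c] [r, s] 1 + A.rootCount c 1 = N ∧ N ≠ 0) :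
    IsGenusFourTower (ofList k [a₀, a₁, a₂, 1]) (ofList k [p₀, p₁, p₂, c]) (ofList k [r, s]) 1 N := by
  obtain ⟨hS, h2, hc, hab, hne, hcount, hN⟩ := h
  have : Finite k := Finite.of_surjective _ hA.bijective.2
  have h2 := two_ne_zero_of_not_dvd (k := k) h2
  have hs := hS.isSmoothAway k
  rw [ofList_one] at hs
  refine isGenusFourTower_of_represents hA (φ := [a₂, a₁, a₀])
    (G₀ := [p₂, p₁, p₀]) (g := 1) h2 (by exact_mod_cast h2) Nat.prime_two
    (isPrimitiveRoot_neg_one h2) hS (fun t => by simp [ofList_one])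
    (natDegree_ofList_cubic _ _ _) hab hne hcount hN fun F _ _ x y z ht => ?_
  have hinf := ht.isTowerAtInfinity_two hc
  refine ⟨?_, _, _, _, _, _, hinf⟩
  rw [ht.genus_eq_finrank_polesLE hinf h2 (by exact_mod_cast h2) hs (N := 3) rfl]
  exact finrank_polesLE_three ht hinf rfl h2 hs

/-- Cyclic cubic covers of elliptic curves. -/
theorem isGenusFourTower_three (hA : A.Represents e) {a₀ a₁ a₂ p₀ p₁ : ℤ}
    {S : SmoothCertificate} {a b ζ N : ℕ}
    (h : S.Valid q [a₀, a₁, a₂, 1] [p₀, p₁] [1] [1] ∧ ¬ (q : ℤ) ∣ 2 ∧ ¬ (q : ℤ) ∣ 3 ∧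
      (ζ < A.card ∧ A.pow ζ 3 = A.int 1 ∧ ζ ≠ A.int 1) ∧
      A.mul b b = A.eval a [a₀, a₁, a₂, 1] ∧
      (∀ t < A.card, A.pow t 3 ≠ A.add (A.eval a [p₀, p₁]) (A.mul (A.eval a [1]) b)) ∧
      A.affineCount [a₀, a₁, a₂, 1] [p₀, p₁] [1] 2 + A.rootCount 1 2 = N ∧ N ≠ 0) :
    IsGenusFourTower (ofList k [a₀, a₁, a₂, 1]) (ofList k [p₀, p₁]) (ofList k [1]) 2 N := by
  obtain ⟨hS, h2, h3, ⟨hζ0, hζ3, hζ1⟩, hab, hne, hcount, hN⟩ := h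
  have : Finite k := Finite.of_surjective _ hA.bijective.2
  have h2 := two_ne_zero_of_not_dvd (k := k) h2
  have h3 : (3 : k) ≠ 0 := by exact_mod_cast intCast_ne_zero_of_not_dvd (k := k) h3
  have hs := hS.isSmoothAway k
  have hζ : IsPrimitiveRoot (e ζ) 3 := by
    have := Fact.mk Nat.prime_three
    refine IsPrimitiveRoot.iff_orderOf.2 (orderOf_eq_prime ?_ fun h1 => hζ1 ?_)
    · rw [← hA.map_pow, hζ3, hA.map_int, Int.cast_one]
    · rw [← hA.eq_iff hζ0 (hA.int_lt 1), h1, hA.map_int, Int.cast_one]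
  refine isGenusFourTower_of_represents hA (φ := [a₂, a₁, a₀])
    (G₀ := []) (g := 1) h2 (by exact_mod_cast h3) Nat.prime_three
    hζ hS (fun t => by simp [ofList_one])
    (natDegree_ofList_cubic _ _ _) hab hne hcount hN fun F _ _ x y z ht => ?_
  have hinf := ht.isTowerAtInfinity_three
  refine ⟨?_, _, _, _, _, _, hinf⟩
  rw [ofList_one] at hs ht
  rw [ht.genus_eq_finrank_polesLE hinf h2 (by exact_mod_cast h3) hs (N := 2) rfl]
  exact finrank_polesLE_two ht hinf rfl h2 h3 hζ hs

/-- Double covers of curves of genus two with two double points. -/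
theorem isGenusFourTower_nodal (hA : A.Represents e) {a₀ a₁ a₂ a₃ a₄ p₀ p₁ p₂ c u₀ u₁ : ℤ}
    {v s t : List ℤ} {S : SmoothCertificate} {a b N : ℕ}
    (h : S.Valid q [a₀, a₁, a₂, a₃, a₄, 1] [p₀, p₁, p₂, c] [1] [u₀, u₁, 1] ∧
      (∀ r ∈ listAdd (listAdd (listMul [p₀, p₁, p₂, c] [p₀, p₁, p₂, c])
        (listMul [-1] [a₀, a₁, a₂, a₃, a₄, 1]))
        (listMul [-1] (listMul (listMul [u₀, u₁, 1] [u₀, u₁, 1]) v)), (q : ℤ) ∣ r) ∧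
      (∀ r ∈ listAdd (listAdd (listMul s [u₀, u₁, 1])
        (listMul t (listMul (listMul [2] [p₀, p₁, p₂, c]) v))) [-1], (q : ℤ) ∣ r) ∧
      (∀ t < A.card, A.eval t [u₀, u₁, 1] ≠ A.int 0) ∧ ¬ (q : ℤ) ∣ 2 ∧ ¬ (q : ℤ) ∣ c ∧
      A.mul b b = A.eval a [a₀, a₁, a₂, a₃, a₄, 1] ∧
      (∀ t < A.card, A.pow t 2 ≠
        A.add (A.eval a [p₀, p₁, p₂, c]) (A.mul (A.eval a [1]) b)) ∧
      A.affineCount [a₀, a₁, a₂, a₃, a₄, 1] [p₀, p₁, p₂, c] [1] 1 + A.rootCount c 1 = N ∧ N ≠ 0) :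
    IsGenusFourTower (ofList k [a₀, a₁, a₂, a₃, a₄, 1]) (ofList k [p₀, p₁, p₂, c])
      (ofList k [1]) 1 N := by
  obtain ⟨hS, hnorm, hcop, hroot, h2, hc, hab, hne, hcount, hN⟩ := h
  have : Finite k := Finite.of_surjective _ hA.bijective.2
  have h2 := two_ne_zero_of_not_dvd (k := k) h2
  have hs := hS.isSmoothAway k
  have hnorm := ofList_eq_zero k hnorm
  have hcop := ofList_eq_zero k hcop
  have e1 : ofList k [-1] = -1 := by simp [ofList]
  have e2 : ofList k [2] = 2 := by
    simp only [ofList, mul_zero, add_zero, Int.cast_ofNat]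
    exact map_ofNat C 2
  simp only [ofList_add, ofList_mul, e1, e2] at hnorm hcop
  have hu : ∀ t, (ofList k [u₀, u₁, 1]).eval t ≠ 0 := fun t => by
    obtain ⟨t, ht, rfl⟩ := hA.surj t
    have h0 : e (A.int 0) = 0 := by rw [hA.map_int, Int.cast_zero]
    rw [← hA.map_eval, ← h0, Ne, hA.eq_iff (hA.eval_lt _ _) (hA.int_lt _)]
    exact hroot t ht
  have hudeg : (ofList k [u₀, u₁, 1]).natDegree = 2 := by
    simp only [ofList, Int.cast_one, map_one, mul_zero, add_zero, mul_one]
    compute_degree!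
  have humonic : (ofList k [u₀, u₁, 1]).Monic := by
    simp only [ofList, Int.cast_one, map_one, mul_zero, add_zero, mul_one]
    monicity!
  have hn : IsNodal (ofList k [a₀, a₁, a₂, a₃, a₄, 1]) (ofList k [p₀, p₁, p₂, c])
      (ofList k [u₀, u₁, 1]) (ofList k v) :=
    ⟨ofList_one (k := k) ▸ hs, by linear_combination hnorm,
      ⟨ofList k s, ofList k t, by linear_combination hcop⟩, by
      refine irreducible_of_degree_le_three_of_not_isRoot ?_ fun t => hu t
      rw [hudeg, Finset.mem_Icc]; omega⟩
  refine isGenusFourTower_of_represents hA (φ := [a₄, a₃, a₂, a₁, a₀])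
    (G₀ := [p₂, p₁, p₀]) (g := 2) h2 (by exact_mod_cast h2) Nat.prime_two
    (isPrimitiveRoot_neg_one h2) hS hu
    (natDegree_ofList_quintic _ _ _ _ _) hab hne hcount hN fun F _ _ x y z ht => ?_
  have hinf := ht.isTowerAtInfinity_five hc
  refine ⟨?_, _, _, _, _, _, hinf⟩
  rw [ofList_one] at ht
  exact ht.genus_eq_four_of_isNodal hinf rfl h2 hn humonic hudeg

end

/-! ### From towers to rows of the table. -/

/-- The value of the polynomial with the given coefficients. -/
def horner {R : Type*} [CommRing R] (t : R) : List ℤ → R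
  | [] => 0
  | a :: L => (a : R) + t * horner t L

theorem map_horner {R S : Type*} [CommRing R] [CommRing S] (φ : R →+* S) (t : R) (L : List ℤ) :
    φ (horner t L) = horner (φ t) L := by
  induction L with
  | nil => simp [horner]
  | cons a L ih => simp [horner, ih]

theorem aeval_ofList {k R : Type*} [Field k] [CommRing R] [Algebra k R] (t : R) (L : List ℤ) :
    aeval t (ofList k L) = horner t L := by
  induction L with
  | nil => simp [ofList, horner]
  | cons a L ih => simp [ofList, horner, ih]

theorem Row.ideal_eq {r : Row} {f p l : List ℤ} {m : ℕ} (h₁ : r.e₁ = y ^ 2 - horner x f)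
    (h₂ : r.e₂ = z ^ (m + 1) - (horner x p + horner x l * y)) (k : Type*) [Field k] :
    r.ideal k = towerIdeal (ofList k f) (ofList k p) (ofList k l) m := by
  rw [Row.ideal, towerIdeal, h₁, h₂]
  simp only [map_sub, map_add, map_mul, map_pow, map_horner, aeval_ofList, x, y, z,
    MvPolynomial.map_X]

theorem maxPoints_ge {k F : Type} [Field k] [Field F] [Algebra k F] {g N : ℕ}
    (hF : IsCurveFunctionField k F) (hg : genus k F = g)
    (hN : Nat.card (RationalPoint k F) = N) (hN0 : N ≠ 0) :
    (N : ℕ∞) ≤ maxPoints (Nat.card k) g := by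
  have : Finite (RationalPoint k F) := Nat.finite_of_card_ne_zero (hN ▸ hN0)
  rw [← hN, ← ENat.card_eq_coe_natCard]
  exact le_sSup ⟨k, F, _, _, _, rfl, hF, hg, rfl⟩

/-- One tower makes the ideal prime, and then every fraction field of the quotient is a tower. The
lower bound for `maxPoints` uses the Galois field with `q` elements and the fraction field over it.
-/
theorem Row.of_isGenusFourTower {r : Row} {f p l : List ℤ} {m ℓ n : ℕ} [Fact ℓ.Prime]
    (hn : n ≠ 0) (hq : r.q = ℓ ^ n) (hN : r.N ≠ 0) (h₁ : r.e₁ = y ^ 2 - horner x f)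
    (h₂ : r.e₂ = z ^ (m + 1) - (horner x p + horner x l * y))
    (h : ∀ (k : Type) [Field k], Nat.card k = r.q →
      IsGenusFourTower (ofList k f) (ofList k p) (ofList k l) m r.N) :
    (∀ (k : Type) [Field k], Nat.card k = r.q →
      (r.ideal k).IsPrime ∧
      ∀ (F : Type) [Field F] [Algebra k F] [Algebra (r.CoordRing k) F]
        [IsScalarTower k (r.CoordRing k) F] [IsFractionRing (r.CoordRing k) F],
        IsCurveFunctionField k F ∧ genus k F = 4 ∧ Nat.card (RationalPoint k F) = r.N) ∧
    (r.N : ℕ∞) ≤ maxPoints r.q 4 := by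
  have key : ∀ (k : Type) [Field k], Nat.card k = r.q →
      (r.ideal k).IsPrime ∧
      ∀ (F : Type) [Field F] [Algebra k F] [Algebra (r.CoordRing k) F]
        [IsScalarTower k (r.CoordRing k) F] [IsFractionRing (r.CoordRing k) F],
        IsCurveFunctionField k F ∧ genus k F = 4 ∧ Nat.card (RationalPoint k F) = r.N := by
    intro k _ hk
    have hI := Row.ideal_eq h₁ h₂ k
    obtain ⟨F₀, _, _, x₀, y₀, z₀, h₀⟩ := (h k hk).exists_isTower
    refine ⟨hI ▸ towerIdeal_isPrime h₀, fun F _ _ _ _ _ => ?_⟩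
    exact (h k hk).genus_and_card F _ _ _ (isTower_of_isFractionRing h₀ hI)
  refine ⟨key, ?_⟩
  have hcard : Nat.card (GaloisField ℓ n) = r.q := by rw [GaloisField.card ℓ n hn, hq]
  obtain ⟨hprime, hF⟩ := key (GaloisField ℓ n) hcard
  obtain ⟨h1, h2, h3⟩ := hF (FractionRing (r.CoordRing (GaloisField ℓ n)))
  rw [← hcard]
  exact maxPoints_ge h1 h2 h3 hN

/-- A row of the table with a prime field. -/
theorem Row.of_prime {r : Row} {f p l : List ℤ} {m : ℕ} (hq : r.q.Prime) (hN : r.N ≠ 0)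
    (h₁ : r.e₁ = y ^ 2 - horner x f) (h₂ : r.e₂ = z ^ (m + 1) - (horner x p + horner x l * y))
    (h : ∀ (k : Type) [Field k] [CharP k r.q] (e : ℕ → k), (Arith.modulo r.q).Represents e →
      IsGenusFourTower (ofList k f) (ofList k p) (ofList k l) m r.N) :
    (∀ (k : Type) [Field k], Nat.card k = r.q →
      (r.ideal k).IsPrime ∧
      ∀ (F : Type) [Field F] [Algebra k F] [Algebra (r.CoordRing k) F]
        [IsScalarTower k (r.CoordRing k) F] [IsFractionRing (r.CoordRing k) F],
        IsCurveFunctionField k F ∧ genus k F = 4 ∧ Nat.card (RationalPoint k F) = r.N) ∧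
    (r.N : ℕ∞) ≤ maxPoints r.q 4 := by
  have := Fact.mk hq
  refine Row.of_isGenusFourTower one_ne_zero (pow_one _).symm hN h₁ h₂ fun k _ hk => ?_
  have : Finite k := Nat.finite_of_card_ne_zero (hk ▸ hq.ne_zero)
  have := Fintype.ofFinite k
  have : CharP k r.q := charP_of_card_eq_prime (by rw [← Nat.card_eq_fintype_card, hk])
  exact h k _ (Arith.modulo_represents hk)

/-- A row of the table with a quadratic extension of a prime field. -/
theorem Row.of_prime_sq {r : Row} {f p l : List ℤ} {m ℓ : ℕ} (hℓ : ℓ.Prime) (hℓ4 : ℓ % 4 = 3)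
    (hq : r.q = ℓ ^ 2) (hN : r.N ≠ 0)
    (h₁ : r.e₁ = y ^ 2 - horner x f) (h₂ : r.e₂ = z ^ (m + 1) - (horner x p + horner x l * y))
    (h : ∀ (k : Type) [Field k] [CharP k ℓ] (e : ℕ → k), (Arith.gaussian ℓ).Represents e →
      IsGenusFourTower (ofList k f) (ofList k p) (ofList k l) m r.N) :
    (∀ (k : Type) [Field k], Nat.card k = r.q →
      (r.ideal k).IsPrime ∧
      ∀ (F : Type) [Field F] [Algebra k F] [Algebra (r.CoordRing k) F]
        [IsScalarTower k (r.CoordRing k) F] [IsFractionRing (r.CoordRing k) F],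
        IsCurveFunctionField k F ∧ genus k F = 4 ∧ Nat.card (RationalPoint k F) = r.N) ∧
    (r.N : ℕ∞) ≤ maxPoints r.q 4 := by
  have := Fact.mk hℓ
  refine Row.of_isGenusFourTower two_ne_zero hq hN h₁ h₂ fun k _ hk => ?_
  rw [hq] at hk
  have : Finite k := Nat.finite_of_card_ne_zero (hk ▸ pow_ne_zero 2 hℓ.ne_zero)
  have := Fintype.ofFinite k
  have : CharP k ℓ := charP_of_card_eq_prime_pow (by rw [← Nat.card_eq_fintype_card, hk])
  obtain ⟨e, he⟩ := Arith.gaussian_represents hℓ4 hk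
  exact h k e he

end GenusFour

/-! ### The certificates for the individual rows. -/

theorem mainTheorem2 :
    ∀ r ∈ GenusFour.table,
      (∀ (k : Type) [Field k], Nat.card k = r.q →
        (r.ideal k).IsPrime ∧
        ∀ (F : Type) [Field F] [Algebra k F] [Algebra (r.CoordRing k) F]
          [IsScalarTower k (r.CoordRing k) F] [IsFractionRing (r.CoordRing k) F],
          GenusFour.IsCurveFunctionField k F ∧
          GenusFour.genus k F = 4 ∧
          Nat.card (GenusFour.RationalPoint k F) = r.N) ∧
      (r.N : ℕ∞) ≤ GenusFour.maxPoints r.q 4 := by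
  intro r hr
  simp only [GenusFour.table, List.mem_cons, List.not_mem_nil, or_false] at hr
  rcases hr with rfl | rfl | rfl | rfl | rfl | rfl | rfl | rfl | rfl | rfl | rfl | rfl | rfl
     | rfl | rfl | rfl | rfl | rfl | rfl | rfl | rfl
  · refine GenusFour.Row.of_prime (by norm_num) (by norm_num)
      (f := [4, 0, 0, 1]) (p := [-3, -4, 1, 1]) (l := [0, 0]) (m := 1)
      (by simp only [GenusFour.horner]; push_cast; ring)
      (by simp only [GenusFour.horner]; push_cast; ring) fun k _ _ e hA => ?_
    exact GenusFour.isGenusFourTower_two hA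
      -- `S` lists Bézout coefficients modulo `q`, lowest degree first: `α f + β f' = 1`, then the
      -- smoothness identity for the cover with right-hand side `u ^ 0 = 1`. When `l = 0` that
      -- identity involves only `p` and `p' f`, so `b` and `c` are empty. `(a, b)` is the point
      -- where `h` is a non-square.
      (S := ⟨[-3], [0, 1], [-2, 0, 2, 5, -1], [], [], [3, 5, -2], 0⟩)
      (a := 8) (b := 3) (by decide +kernel)
  · refine GenusFour.Row.of_prime (by norm_num) (by norm_num)
      (f := [8, 1, 0, 1]) (p := [-8, -2, -5, 1]) (l := [0, 0]) (m := 1)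
      (by simp only [GenusFour.horner]; push_cast; ring)
      (by simp only [GenusFour.horner]; push_cast; ring) fun k _ _ e hA => ?_
    exact GenusFour.isGenusFourTower_two hA
      (S := ⟨[-6, -8], [-2, 2, -3], [7, -2, -3, -8], [], [], [3, 7], 0⟩)
      (a := 2) (b := 1) (by decide +kernel)
  · refine GenusFour.Row.of_prime (by norm_num) (by norm_num)
      (f := [8, 0, 0, 1]) (p := [-5, 0, -9, 1]) (l := [0, 0]) (m := 1)
      (by simp only [GenusFour.horner]; push_cast; ring)
      (by simp only [GenusFour.horner]; push_cast; ring) fun k _ _ e hA => ?_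
    exact GenusFour.isGenusFourTower_two hA
      (S := ⟨[-7], [0, -4], [-4, 0, -4, 3, -6], [], [], [0, 6, 1], 0⟩)
      (a := 15) (b := 1) (by decide +kernel)
  · refine GenusFour.Row.of_prime (by norm_num) (by norm_num)
      (f := [-7, -3, -6, 1]) (p := [1, 7, -11, 2]) (l := [0, 1]) (m := 1)
      (by simp only [GenusFour.horner]; push_cast; ring)
      (by simp only [GenusFour.horner]; push_cast; ring) fun k _ _ e hA => ?_
    exact GenusFour.isGenusFourTower_two hA
      (S := ⟨[-5, 9], [-4, 0, -3], [-5, -6, 4, -9, 2],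
        [-10, -2, -7, -1], [-6, -5, -9, 9, 4], [-10], 0⟩)
      (a := 3) (b := 7) (by decide +kernel)
  · refine GenusFour.Row.of_prime (by norm_num) (by norm_num)
      (f := [18, -3, 0, 1]) (p := [-10, 2, 6, 7]) (l := [1, 0]) (m := 1)
      (by simp only [GenusFour.horner]; push_cast; ring)
      (by simp only [GenusFour.horner]; push_cast; ring) fun k _ _ e hA => ?_
    exact GenusFour.isGenusFourTower_two hA
      (S := ⟨[-11, 2], [11, -6, 9], [0, 10, 10, -7, 10], [7, -5], [3, 7, 9], [0, 0, 8], 0⟩)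
      (a := 8) (b := 10) (by decide +kernel)
  · refine GenusFour.Row.of_prime (by norm_num) (by norm_num)
      (f := [10, 1, 0, 1]) (p := [-13, -13, 7, 1]) (l := [0, 0]) (m := 1)
      (by simp only [GenusFour.horner]; push_cast; ring)
      (by simp only [GenusFour.horner]; push_cast; ring) fun k _ _ e hA => ?_
    exact GenusFour.isGenusFourTower_two hA
      (S := ⟨[12, -7], [5, -4, -8], [12, -2, -3, 2, -6], [], [], [5, 2, 1], 0⟩)
      (a := 7) (b := 9) (by decide +kernel)
  · refine GenusFour.Row.of_prime (by norm_num) (by norm_num)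
      (f := [0, 2, 0, 1]) (p := [-13, -10, 1, 1]) (l := [0, 0]) (m := 1)
      (by simp only [GenusFour.horner]; push_cast; ring)
      (by simp only [GenusFour.horner]; push_cast; ring) fun k _ _ e hA => ?_
    exact GenusFour.isGenusFourTower_two hA
      (S := ⟨[0, -15], [-18, 0, 5], [17, -6, 7, 13], [], [], [-6, 4], 0⟩)
      (a := 0) (b := 0) (by decide +kernel)
  · refine GenusFour.Row.of_prime (by norm_num) (by norm_num)
      (f := [5, 6, 0, 1]) (p := [0, -11, -17, 3]) (l := [0, 0]) (m := 1)
      (by simp only [GenusFour.horner]; push_cast; ring)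
      (by simp only [GenusFour.horner]; push_cast; ring) fun k _ _ e hA => ?_
    exact GenusFour.isGenusFourTower_two hA
      (S := ⟨[8, 10], [14, 11, -17], [-19, 17, -16, -2, -14], [], [], [19, 2, 16], 0⟩)
      (a := 9) (b := 3) (by decide +kernel)
  · refine GenusFour.Row.of_prime (by norm_num) (by norm_num)
      (f := [1, 2, 0, 1]) (p := [0, 11, -6, 1]) (l := [0, 0]) (m := 1)
      (by simp only [GenusFour.horner]; push_cast; ring)
      (by simp only [GenusFour.horner]; push_cast; ring) fun k _ _ e hA => ?_
    exact GenusFour.isGenusFourTower_two hA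
      (S := ⟨[-1, -13], [1, -14, -10], [-8, 14, -19, 4, -11], [], [], [2, 10, 9], 0⟩)
      (a := 14) (b := 8) (by decide +kernel)
  · refine GenusFour.Row.of_prime (by norm_num) (by norm_num)
      (f := [12, -5, 8, -6, 0, 1]) (p := [-3, -1, 6, 6]) (l := [1]) (m := 1)
      (by simp only [GenusFour.horner]; push_cast; ring)
      (by simp only [GenusFour.horner]; push_cast; ring) fun k _ _ e hA => ?_
    exact GenusFour.isGenusFourTower_nodal hA
      -- The double points lie over the roots of `u = x² + 34 x + 32`, irreducible modulo `47`. `s`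
      -- and `t` witness that `u` is prime to `2 p v`, and smoothness holds only where `u ≠ 0`, with
      -- exponent `1`.
      (u₀ := 32) (u₁ := 34) (v := [5, 20, 36]) (s := [12, -18, 10, 19, -11]) (t := [-17, -4])
      (S := ⟨[7, 21, 15, 23], [-21, -5, 20, -3, -14], [10, -13, 12, -6],
        [-16, -22, 9], [-13, -20, -7, 22], [-2], 1⟩)
      (a := 0) (b := 23) (by decide +kernel)
  · refine GenusFour.Row.of_prime_sq (ℓ := 7) (by norm_num) (by norm_num) rfl (by norm_num)
      (f := [0, 1, 0, 1]) (p := [4, 1, 1, 1]) (l := [0, 0]) (m := 1)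
      (by simp only [GenusFour.horner]; push_cast; ring)
      (by simp only [GenusFour.horner]; push_cast; ring) fun k _ _ e hA => ?_
    exact GenusFour.isGenusFourTower_two hA
      (S := ⟨[0, -1], [1, 0, -2], [2, 0, -2, 0, 1], [], [], [-1, -2, 1], 0⟩)
      -- In base `7` the number `15 = 1 + 7 · 2` encodes `1 + 2 i`.
      (a := 15) (b := 2) (by decide +kernel)
  · refine GenusFour.Row.of_prime (by norm_num) (by norm_num)
      (f := [10, 4, 0, 1]) (p := [9, 17, 12, 1]) (l := [0, 0]) (m := 1)
      (by simp only [GenusFour.horner]; push_cast; ring)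
      (by simp only [GenusFour.horner]; push_cast; ring) fun k _ _ e hA => ?_
    exact GenusFour.isGenusFourTower_two hA
      (S := ⟨[4, 6], [-23, -19, -2], [-20, 8, -6, -26, 23], [], [], [1, -11, 5], 0⟩)
      (a := 1) (b := 11) (by decide +kernel)
  · refine GenusFour.Row.of_prime (by norm_num) (by norm_num)
      (f := [22, 2, 0, 1]) (p := [9, -1, 1, 2]) (l := [0, 0]) (m := 1)
      (by simp only [GenusFour.horner]; push_cast; ring)
      (by simp only [GenusFour.horner]; push_cast; ring) fun k _ _ e hA => ?_
    exact GenusFour.isGenusFourTower_two hA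
      (S := ⟨[2, -18], [8, 19, 6], [21, 14, 19, -11, -21], [], [], [15, 27, -26], 0⟩)
      (a := 1) (b := 5) (by decide +kernel)
  · refine GenusFour.Row.of_prime (by norm_num) (by norm_num)
      (f := [4, 0, 0, 1]) (p := [36, 25, 23, 1]) (l := [0, 0]) (m := 1)
      (by simp only [GenusFour.horner]; push_cast; ring)
      (by simp only [GenusFour.horner]; push_cast; ring) fun k _ _ e hA => ?_
    exact GenusFour.isGenusFourTower_two hA
      (S := ⟨[-15], [0, 5], [0, -6, -3, 27, -9], [], [], [18, 7, -29], 0⟩)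
      (a := 1) (b := 26) (by decide +kernel)
  · refine GenusFour.Row.of_prime (by norm_num) (by norm_num)
      (f := [25, 0, 0, 1]) (p := [4, -27, 0, -8]) (l := [0, 1]) (m := 1)
      (by simp only [GenusFour.horner]; push_cast; ring)
      (by simp only [GenusFour.horner]; push_cast; ring) fun k _ _ e hA => ?_
    exact GenusFour.isGenusFourTower_two hA
      (S := ⟨[-8], [0, 25], [1, -6, 15, -19, -29],
        [29, -24, 19, 15], [-14, 16, -9, 6, 31], [4], 0⟩)
      (a := 4) (b := 25) (by decide +kernel)
  · refine GenusFour.Row.of_prime (by norm_num) (by norm_num)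
      (f := [9, 1, 0, 1]) (p := [-9, 24, 9, 1]) (l := [0, 0]) (m := 1)
      (by simp only [GenusFour.horner]; push_cast; ring)
      (by simp only [GenusFour.horner]; push_cast; ring) fun k _ _ e hA => ?_
    exact GenusFour.isGenusFourTower_two hA
      (S := ⟨[-3, 16], [28, 1, -29], [-27, -20, 16, -13, 30], [], [], [7, -1, -5], 0⟩)
      (a := 0) (b := 3) (by decide +kernel)
  · refine GenusFour.Row.of_prime (by norm_num) (by norm_num)
      (f := [11, 3, 0, 1]) (p := [40, 18, 34, 1]) (l := [0, 0]) (m := 1)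
      (by simp only [GenusFour.horner]; push_cast; ring)
      (by simp only [GenusFour.horner]; push_cast; ring) fun k _ _ e hA => ?_
    exact GenusFour.isGenusFourTower_two hA
      (S := ⟨[-4, 14], [15, -23, -29], [0, -8, -31, 21, 7], [], [], [33, 36, 11], 0⟩)
      (a := 10) (b := 26) (by decide +kernel)
  · refine GenusFour.Row.of_prime (by norm_num) (by norm_num)
      (f := [6, 1, 0, 1]) (p := [2, 33]) (l := [1]) (m := 2)
      (by simp only [GenusFour.horner]; push_cast; ring)
      (by simp only [GenusFour.horner]; push_cast; ring) fun k _ _ e hA => ?_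
    -- `23` is a primitive cube root of unity modulo `79`: `23² + 23 + 1 = 7 · 79`.
    exact GenusFour.isGenusFourTower_three hA (ζ := 23)
      (S := ⟨[34, 5], [34, 15, -28], [3, 20, -12], [11, 37], [8, 23, 14], [], 0⟩)
      (a := 1) (b := 18) (by decide +kernel)
  · refine GenusFour.Row.of_prime (by norm_num) (by norm_num)
      (f := [19, 2, 0, 1]) (p := [39, -6, 38, 1]) (l := [0, 0]) (m := 1)
      (by simp only [GenusFour.horner]; push_cast; ring)
      (by simp only [GenusFour.horner]; push_cast; ring) fun k _ _ e hA => ?_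
    exact GenusFour.isGenusFourTower_two hA
      (S := ⟨[-1, 19], [10, 28, -34], [-23, -4, 13, 6, -39], [], [], [23, 26, -35], 0⟩)
      (a := 15) (b := 41) (by decide +kernel)
  · refine GenusFour.Row.of_prime (by norm_num) (by norm_num)
      (f := [0, 3, 0, 1]) (p := [28, -22, 13, 1]) (l := [0, 0]) (m := 1)
      (by simp only [GenusFour.horner]; push_cast; ring)
      (by simp only [GenusFour.horner]; push_cast; ring) fun k _ _ e hA => ?_
    exact GenusFour.isGenusFourTower_two hA
      (S := ⟨[0, 44], [30, 0, 15], [35, 11, 39, -27, -12], [], [], [41, 28, 2], 0⟩)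
      (a := 0) (b := 0) (by decide +kernel)
  · refine GenusFour.Row.of_prime (by norm_num) (by norm_num)
      (f := [26, 5, 0, 1]) (p := [16, 37]) (l := [1]) (m := 2)
      (by simp only [GenusFour.horner]; push_cast; ring)
      (by simp only [GenusFour.horner]; push_cast; ring) fun k _ _ e hA => ?_
    exact GenusFour.isGenusFourTower_three hA (ζ := 35)
      (S := ⟨[7, 19], [22, 30, 26], [-2, 15, -32], [7, -21], [9, -28, 7], [], 0⟩)
      (a := 1) (b := 41) (by decide +kernel)
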